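/- **Setting.** Write $\langle x\rangle=\sqrt{1+x^2}$, $\hat h(\xi)=\frac1{\sqrt{2\pi}}\int e^{-ix\xi}h(x)\,dx$, $\mathbf 1_+=\mathbf 1_{[0,\infty)}$, $\mathbf 1_-=\mathbf 1_{(-\infty,0)}$. Let $\gamma>5/2$ and let $V:\mathbb R\to\mathbb R$ satisfy $\langle x\rangle^\gamma V\in L^1(\mathbb R)$. For real $k$ let $\psi_\pm(x,k)$ be the Jost functions, i.e. the solutions of $-\psi''+V\psi=k^2\psi$ with $e^{\mp ikx}\psi_\pm(x,k)\to1$ as $x\to\pm\infty$, and let $m_\pm(x,k)=e^{\mp ikx}\psi_\pm(x,k)$. Define $T,R_\pm$ for $k\ne0$ by $$\frac1{T(k)}=1-\frac1{2ik}\int V(x)m_+(x,k)\,dx,\qquad \frac{R_\pm(k)}{T(k)}=\frac1{2ik}\int e^{\mp2ikx}V(x)m_\mp(x,k)\,dx,$$ and at $k=0$ by their limits. Assume that $V$ is non-generic, $\int V(x)m_\pm(x,0)\,dx=0$, and that its zero-energy resonance $\psi_+(\cdot,0)$ is odd. Let $$\mathcal K(x,k)=\tfrac1{\sqrt{2\pi}}\begin{cases}T(k)\psi_+(x,k),&k\ge0\\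 T(-k)\psi_-(x,-k),&k<0,\end{cases}\qquad \mathcal K^\sharp(x,k)=\begin{cases}\mathcal K(x,k),&k\ge0\\-\mathcal K(x,k),&k<0.\end{cases}$$ Let $\Phi\ge0$ be smooth, equal to $1$ near $0$, zero outside $[-2,2]$, with $\int\Phi=1$, and let $\chi_+(x)=\int_{-\infty}^x\Phi$, $\chi_-=1-\chi_+$. Put $$\mathcal K^\sharp_S=\mathcal K_0^\sharp+\chi_+\mathcal K_+^\sharp+\chi_-\mathcal K_-^\sharp,\qquad \mathcal K_0^\sharp=T(0)m_+(x,0)e^{ikx},$$ $$\mathcal K_+^\sharp=(T(k)-T(0))\mathbf 1_+(k)e^{ikx}-R_+(-k)\mathbf 1_-(k)e^{-ikx},\qquad \mathcal K_-^\sharp=R_-(k)\mathbf 1_+(k)e^{-ikx}-(T(-k)-T(0))\mathbf 1_-(k)e^{ikx},$$ and let $\mathcal K_R^\sharp(x,k)$ be, for $k\ge0$, $$\chi_+\big[(T(k)-T(0))(m_+(x,0)-1)+T(k)(m_+(x,k)-m_+(x,0))\big]e^{ikx}+\chi_-\big[(m_-(x,-k)-m_-(x,0))e^{ikx}+R_-(k)(m_-(x,k)-1)e^{-ikx}\big],$$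 and, for $k<0$, $$-\chi_-\big[(T(-k)-T(0))(m_-(x,0)-1)+T(-k)(m_-(x,-k)-m_-(x,0))\big]e^{ikx}-\chi_+\big[(m_+(x,k)-m_+(x,0))e^{ikx}+R_+(-k)(m_+(x,-k)-1)e^{-ikx}\big].$$ Write $\prod_* z_j=\bar z_1z_2\bar z_3z_4$. Let $A$ be the set of the six functions $(T(k)-T(0))\mathbf 1_+(k)$, $-R_+(-k)\mathbf 1_-(k)$, $R_-(k)\mathbf 1_+(k)$, $-(T(-k)-T(0))\mathbf 1_-(k)$, $1$, $-1$. Let $\mathcal C$ be the set of functions $\mathbf k\mapsto\prod_*a_j(k_j)$ on $\mathbb R^4$ with all $a_j\in A$, and $\mathcal C_L=\mathcal C\setminus\{1,-1\}$. For $\boldsymbol\varepsilon\in\{1,-1\}^4$ let $\boldsymbol\varepsilon\cdot\mathbf k=\sum_j\varepsilon_jk_j$. **Theorem.** Define the modified nonlinear spectral distribution $$\mu^\sharp(\mathbf k)=\int\overline{\mathcal K^\sharp(x,k_1)}\,\mathcal K^\sharp(x,k_2)\,\overline{\mathcal K^\sharp(x,k_3)}\,\mathcal K^\sharp(x,k_4)\,dx$$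 as a distribution on $\mathbb R^4$, the $x$-integral being taken (and converging absolutely) after integrating in $\mathbf k$ against a Schwartz function. Then, tested against Schwartz functions of $\mathbf k\in\mathbb R^4$, $$(2\pi)^2\mu^\sharp(\mathbf k)=2\pi\,\delta(k_1-k_2+k_3-k_4)+\mu^\sharp_L(\mathbf k)+\mu^\sharp_{R,1}(\mathbf k)+\mu^\sharp_{R,2}(\mathbf k),$$ where: * $\mu_L^\sharp$ is a finite real linear combination of terms $$a(\mathbf k)\Big[\sqrt{\tfrac\pi2}\,\delta(\boldsymbol\varepsilon\cdot\mathbf k)\pm\mathrm{p.v.}\,\frac{\varphi(\boldsymbol\varepsilon\cdot\mathbf k)}{i\,\boldsymbol\varepsilon\cdot\mathbf k}\Big],\qquad a\in\mathcal C_L,\ \boldsymbol\varepsilon\in\{1,-1\}^4,$$ where for each term there is a $j$ with $a(\mathbf k)=0$ whenever $k_j=0$, and $\varphi$ is an even Schwartz function with $\int\varphi=1$ and $\varphi(0)=(2\pi)^{-1/2}$ (that is, its inverse Fourier transform also has integral $1$); * with $\mathcal X_R=\{S,R\}^4\setminus\{(S,S,S,S)\}$, $$\mu^\sharp_{R,1}(\mathbf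 k)=\sum_{(A_1,A_2,A_3,A_4)\in\mathcal X_R}\int\prod_*\mathcal K^\sharp_{A_j}(x,k_j)\,dx,$$ where the integrals converge absolutely for every $\mathbf k$; * $\mu^\sharp_{R,2}$ is a finite linear combination of terms $a(\mathbf k)\,\phi(\boldsymbol\varepsilon\cdot\mathbf k)$ with $a\in\mathcal C$, $\boldsymbol\varepsilon\in\{1,-1\}^4$ and $\phi=\hat g$ for a $C^1$ function $g$ with $|g(x)|+|g'(x)|\lesssim\langle x\rangle^{-\gamma+1}$. -/

import Mathlib

open MeasureTheory Filter Topology Set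
open scoped SchwartzMap

noncomputable section

namespace OddResonance

/-! ### Jost functions and scattering coefficients -/

/-- The Japanese bracket `⟨x⟩ = (1 + x ^ 2) ^ (1/2)`. -/
def jb (x : ℝ) : ℝ := Real.sqrt (1 + x ^ 2)

/-- `ψ` solves `-ψ'' + V ψ = k ^ 2 ψ` on the line. Since `V` is only locally integrable, this is
meant in the usual (Carathéodory) sense: `ψ` is differentiable and `ψ'` is an
indefinite integral of `(V - k ^ 2) ψ`. -/
def IsSolution (V : ℝ → ℝ) (k : ℝ) (ψ : ℝ → ℂ) : Prop :=
  Differentiable ℝ ψ ∧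
    ∀ x y : ℝ, deriv ψ y - deriv ψ x = ∫ t in x..y, ((V t - k ^ 2 : ℝ) : ℂ) * ψ t

/-- `ψ` is the Jost solution at `+∞`: `exp (-ikx) ψ x → 1` as `x → +∞`. -/
def IsJostPlus (V : ℝ → ℝ) (k : ℝ) (ψ : ℝ → ℂ) : Prop :=
  IsSolution V k ψ ∧
    Tendsto (fun x : ℝ => Complex.exp (-(Complex.I * k * x)) * ψ x) atTop (𝓝 1)

/-- `ψ` is the Jost solution at `-∞`: `exp (ikx) ψ x → 1` as `x → -∞`. -/
def IsJostMinus (V : ℝ → ℝ) (k : ℝ) (ψ : ℝ → ℂ) : Prop :=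
  IsSolution V k ψ ∧
    Tendsto (fun x : ℝ => Complex.exp (Complex.I * k * x) * ψ x) atBot (𝓝 1)

/-- The Jost function `ψ₊(x, k)`; for the potentials considered it is the unique function
with `IsJostPlus`. -/
def psiPlus (V : ℝ → ℝ) (x k : ℝ) : ℂ := Classical.epsilon (IsJostPlus V k) x

/-- The Jost function `ψ₋(x, k)`. -/
def psiMinus (V : ℝ → ℝ) (x k : ℝ) : ℂ := Classical.epsilon (IsJostMinus V k) x

/-- `m₊(x, k) = exp (-ikx) ψ₊(x, k)`. -/
def mPlus (V : ℝ → ℝ) (x k : ℝ) : ℂ := Complex.exp (-(Complex.I * k * x)) * psiPlus V x k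

/-- `m₋(x, k) = exp (ikx) ψ₋(x, k)`. -/
def mMinus (V : ℝ → ℝ) (x k : ℝ) : ℂ := Complex.exp (Complex.I * k * x) * psiMinus V x k

/-- The transmission coefficient at `k ≠ 0`:
`1 / T(k) = 1 - (2ik)⁻¹ ∫ V(x) m₊(x, k) dx`. -/
def transAux (V : ℝ → ℝ) (k : ℝ) : ℂ :=
  (1 - (2 * Complex.I * k)⁻¹ * ∫ x : ℝ, (V x : ℂ) * mPlus V x k)⁻¹

/-- `R₊(k) / T(k) = (2ik)⁻¹ ∫ exp (-2ikx) V(x) m₋(x, k) dx` at `k ≠ 0`. -/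
def reflPlusAux (V : ℝ → ℝ) (k : ℝ) : ℂ :=
  transAux V k * ((2 * Complex.I * k)⁻¹ *
    ∫ x : ℝ, Complex.exp (-(2 * Complex.I * k * x)) * (V x : ℂ) * mMinus V x k)

/-- `R₋(k) / T(k) = (2ik)⁻¹ ∫ exp (2ikx) V(x) m₊(x, k) dx` at `k ≠ 0`. -/
def reflMinusAux (V : ℝ → ℝ) (k : ℝ) : ℂ :=
  transAux V k * ((2 * Complex.I * k)⁻¹ *
    ∫ x : ℝ, Complex.exp (2 * Complex.I * k * x) * (V x : ℂ) * mPlus V x k)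

open Classical in
/-- A function on `ℝ ∖ {0}`, extended to `0` by its limit there. -/
def extendZero (f : ℝ → ℂ) (k : ℝ) : ℂ := if k = 0 then limUnder (𝓝[≠] (0 : ℝ)) f else f k

/-- The transmission coefficient `T`. -/
def trans (V : ℝ → ℝ) : ℝ → ℂ := extendZero (transAux V)

/-- The reflection coefficient `R₊`. -/
def reflPlus (V : ℝ → ℝ) : ℝ → ℂ := extendZero (reflPlusAux V)

/-- The reflection coefficient `R₋`. -/
def reflMinus (V : ℝ → ℝ) : ℝ → ℂ := extendZero (reflMinusAux V)

/-- `V` is non-generic (exceptional): `∫ V(x) m₊(x, 0) dx = 0` and `∫ V(x) m₋(x, 0) dx = 0`. -/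
def NonGeneric (V : ℝ → ℝ) : Prop :=
  (∫ x : ℝ, (V x : ℂ) * mPlus V x 0) = 0 ∧ (∫ x : ℝ, (V x : ℂ) * mMinus V x 0) = 0

/-- The zero energy resonance `x ↦ ψ₊(x, 0)` is odd. -/
def OddZeroEnergyResonance (V : ℝ → ℝ) : Prop := ∀ x : ℝ, psiPlus V (-x) 0 = -psiPlus V x 0

/-! ### Generalized eigenfunctions -/

/-- The generalized eigenfunctions `𝒦(x, k)` of `-∂ₓₓ + V`. -/
def eigK (V : ℝ → ℝ) (x k : ℝ) : ℂ :=
  ((Real.sqrt (2 * Real.pi) : ℝ) : ℂ)⁻¹ *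
    (if 0 ≤ k then trans V k * psiPlus V x k else trans V (-k) * psiMinus V x (-k))

/-- The modified eigenfunctions `𝒦♯(x, k) = sgn(k) 𝒦(x, k)`, with the convention
`sgn(0) = 1`. -/
def sharpK (V : ℝ → ℝ) (x k : ℝ) : ℂ := if 0 ≤ k then eigK V x k else -eigK V x k

/-- The bump functions used to build the cut-offs: smooth, non-negative, equal to one near zero,
vanishing outside `[-2, 2]`, with integral one. -/
structure IsBump (Φ : ℝ → ℝ) : Prop where
  smooth : ContDiff ℝ (⊤ : ℕ∞) Φ
  nonneg : ∀ x, 0 ≤ Φ x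
  eq_one : ∀ᶠ x in 𝓝 (0 : ℝ), Φ x = 1
  vanish : ∀ x, x ∉ Icc (-2 : ℝ) 2 → Φ x = 0
  integral_eq : ∫ x : ℝ, Φ x = 1

/-- `χ₊(x) = ∫_{-∞}^x Φ`. -/
def chiPlus (Φ : ℝ → ℝ) (x : ℝ) : ℝ := ∫ y in Iic x, Φ y

/-- `χ₋ = 1 - χ₊`. -/
def chiMinus (Φ : ℝ → ℝ) (x : ℝ) : ℝ := 1 - chiPlus Φ x

/-- `1₊`, the indicator function of `[0, ∞)`. -/
def indPlus (k : ℝ) : ℂ := if 0 ≤ k then 1 else 0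

/-- `1₋`, the indicator function of `(-∞, 0)`. -/
def indMinus (k : ℝ) : ℂ := if k < 0 then 1 else 0

/-- `exp (ikx)`. -/
def wave (x k : ℝ) : ℂ := Complex.exp (Complex.I * k * x)

/-- `𝒦♯₀(x, k) = T(0) m₊(x, 0) exp (ikx)`. -/
def sharpK0 (V : ℝ → ℝ) (x k : ℝ) : ℂ := trans V 0 * mPlus V x 0 * wave x k

/-- `𝒦♯₊(x, k)`. -/
def sharpKp (V : ℝ → ℝ) (x k : ℝ) : ℂ :=
  (trans V k - trans V 0) * indPlus k * wave x k - reflPlus V (-k) * indMinus k * wave x (-k)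

/-- `𝒦♯₋(x, k)`. -/
def sharpKm (V : ℝ → ℝ) (x k : ℝ) : ℂ :=
  reflMinus V k * indPlus k * wave x (-k) - (trans V (-k) - trans V 0) * indMinus k * wave x k

/-- The singular part `𝒦♯_S` of `√(2π) 𝒦♯`. -/
def sharpKS (V Φ : ℝ → ℝ) (x k : ℝ) : ℂ :=
  sharpK0 V x k + (chiPlus Φ x : ℂ) * sharpKp V x k + (chiMinus Φ x : ℂ) * sharpKm V x k

/-- The regular part `𝒦♯_R` of `√(2π) 𝒦♯`. -/
def sharpKR (V Φ : ℝ → ℝ) (x k : ℝ) : ℂ :=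
  if 0 ≤ k then
    (chiPlus Φ x : ℂ) *
        ((trans V k - trans V 0) * (mPlus V x 0 - 1)
          + trans V k * (mPlus V x k - mPlus V x 0)) * wave x k
      + (chiMinus Φ x : ℂ) *
        ((mMinus V x (-k) - mMinus V x 0) * wave x k
          + reflMinus V k * (mMinus V x k - 1) * wave x (-k))
  else
    -((chiMinus Φ x : ℂ) *
        ((trans V (-k) - trans V 0) * (mMinus V x 0 - 1)
          + trans V (-k) * (mMinus V x (-k) - mMinus V x 0)) * wave x k)
      - (chiPlus Φ x : ℂ) *
        ((mPlus V x k - mPlus V x 0) * wave x k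
          + reflPlus V (-k) * (mPlus V x (-k) - 1) * wave x (-k))

/-! ### Fourfold products and coefficients -/

/-- The product of four numbers with alternate conjugation, `z̄₁ z₂ z̄₃ z₄`. -/
def altProd (z : Fin 4 → ℂ) : ℂ :=
  (starRingEnd ℂ) (z 0) * z 1 * (starRingEnd ℂ) (z 2) * z 3

/-- The set `A` of good coefficients. -/
def goodCoeff (V : ℝ → ℝ) : Set (ℝ → ℂ) :=
  {fun k => (trans V k - trans V 0) * indPlus k,
   fun k => -reflPlus V (-k) * indMinus k,
   fun k => reflMinus V k * indPlus k,
   fun k => -(trans V (-k) - trans V 0) * indMinus k,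
   fun _ => 1,
   fun _ => -1}

/-- The set `𝒞 = Ā ⊗ A ⊗ Ā ⊗ A` of functions on `ℝ⁴`. -/
def coeffC (V : ℝ → ℝ) : Set ((Fin 4 → ℝ) → ℂ) :=
  {f | ∃ a : Fin 4 → ℝ → ℂ, (∀ j, a j ∈ goodCoeff V) ∧
    f = fun k => altProd (fun j => a j (k j))}

/-- `𝒞_L = 𝒞 ∖ {1, -1}`. -/
def coeffCL (V : ℝ → ℝ) : Set ((Fin 4 → ℝ) → ℂ) :=
  coeffC V \ {fun _ => 1, fun _ => -1}

/-- `ε · k` for a vector of signs `ε`. -/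
def sdot (ε : Fin 4 → ℤˣ) (k : Fin 4 → ℝ) : ℝ := ∑ j, ((ε j : ℤ) : ℝ) * k j

/-! ### Distributions on `ℝ⁴`, through their action on functions -/

/-- The point of the hyperplane `ε · k = 0` whose first three coordinates are `q`. -/
def hyperPoint (ε : Fin 4 → ℤˣ) (q : Fin 3 → ℝ) : Fin 4 → ℝ :=
  ![q 0, q 1, q 2,
    -(((ε 3 : ℤ) : ℝ) *
      (((ε 0 : ℤ) : ℝ) * q 0 + ((ε 1 : ℤ) : ℝ) * q 1 + ((ε 2 : ℤ) : ℝ) * q 2))]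

/-- The action `⟨δ(ε · k), F⟩ = v`. Integrating out the variable `k₄`, whose coefficient in
`ε · k` is `±1`, leaves the Lebesgue integral over the other three variables. -/
def HasDelta (ε : Fin 4 → ℤˣ) (F : (Fin 4 → ℝ) → ℂ) (v : ℂ) : Prop :=
  Integrable (fun q : Fin 3 → ℝ => F (hyperPoint ε q)) ∧
    (∫ q : Fin 3 → ℝ, F (hyperPoint ε q)) = v

/-- The action `⟨p.v. φ(ε · k) / (i ε · k), F⟩ = v`. -/
def HasPV (ε : Fin 4 → ℤˣ) (φ : ℝ → ℂ) (F : (Fin 4 → ℝ) → ℂ) (v : ℂ) : Prop :=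
  (∀ η : ℝ, 0 < η → IntegrableOn
    (fun k : Fin 4 → ℝ => φ (sdot ε k) / (Complex.I * (sdot ε k : ℂ)) * F k)
    {k | η < |sdot ε k|}) ∧
  Tendsto (fun η : ℝ => ∫ k in {k : Fin 4 → ℝ | η < |sdot ε k|},
      φ (sdot ε k) / (Complex.I * (sdot ε k : ℂ)) * F k) (𝓝[>] (0 : ℝ)) (𝓝 v)

/-- The action `∫ f F = v` of a function `f` on `ℝ⁴`. -/
def HasAction (f F : (Fin 4 → ℝ) → ℂ) (v : ℂ) : Prop :=
  Integrable (fun k => f k * F k) ∧ (∫ k, f k * F k) = v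

/-- The action `⟨μ♯, G⟩ = v` of the modified nonlinear spectral distribution
`μ♯(k) = ∫ 𝒦̄♯(x, k₁) 𝒦♯(x, k₂) 𝒦̄♯(x, k₃) 𝒦♯(x, k₄) dx`. The integral in `x`, which does not
converge for fixed `k`, is taken after testing in `k`. -/
def HasMuSharp (V : ℝ → ℝ) (G : (Fin 4 → ℝ) → ℂ) (v : ℂ) : Prop :=
  (∀ x : ℝ, Integrable (fun k : Fin 4 → ℝ => altProd (fun j => sharpK V x (k j)) * G k)) ∧
  Integrable (fun x : ℝ => ∫ k : Fin 4 → ℝ, altProd (fun j => sharpK V x (k j)) * G k) ∧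
  (∫ x : ℝ, ∫ k : Fin 4 → ℝ, altProd (fun j => sharpK V x (k j)) * G k) = v

/-! ### The regular part -/

/-- `𝒦♯_S` (for `false`) or `𝒦♯_R` (for `true`). -/
def sharpKA (V Φ : ℝ → ℝ) (A : Bool) (x k : ℝ) : ℂ :=
  if A then sharpKR V Φ x k else sharpKS V Φ x k

/-- `𝒳_R = {S, R}⁴ ∖ {(S, S, S, S)}`. -/
def indexR : Finset (Fin 4 → Bool) := Finset.univ.erase (fun _ => false)

/-- `μ♯_{R,1}`. -/
def muR1 (V Φ : ℝ → ℝ) (k : Fin 4 → ℝ) : ℂ :=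
  ∑ A ∈ indexR, ∫ x : ℝ, altProd (fun j => sharpKA V Φ (A j) x (k j))

/-- The unitary Fourier transform `ĝ(ξ) = (2π)^(-1/2) ∫ exp (-ixξ) g(x) dx`. -/
def unitaryFT (g : ℝ → ℂ) (ξ : ℝ) : ℂ :=
  ((Real.sqrt (2 * Real.pi) : ℝ) : ℂ)⁻¹ * ∫ x : ℝ, Complex.exp (-(Complex.I * x * ξ)) * g x

/-- `g` is `C¹`, and `g`, `g'` are bounded by a multiple of `⟨x⟩ ^ (-γ + 1)`. -/
def DecaysC1 (γ : ℝ) (g : ℝ → ℂ) : Prop :=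
  ContDiff ℝ 1 g ∧
    ∃ C : ℝ, ∀ x : ℝ, ‖g x‖ ≤ C * jb x ^ (-γ + 1) ∧ ‖deriv g x‖ ≤ C * jb x ^ (-γ + 1)

end OddResonance

end

/-!
The zero energy resonance `f = ψ₊(·, 0)` is odd, so it tends to `±1` at `±∞` and `ψ₋(·, 0) = -f`.
Comparing the Wronskian of `f` and `ψ₊(·, k)` with its value at infinity gives
`-f'(0) ψ₊(0, k) = ik + O(k²)` (`exists_psiPlus_expansion`), whence `f'(0) ≠ 0`, `T(0) = -1` and
`R_±(0) = 0` (`tendsto_jostAlpha`, `tendsto_jostBeta`); away from zero, `T` and `R_±` are continuous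
and bounded by one by the Wronskian identities of scattering theory (`psiPlus_eq_scattering`,
`normSq_jostAlpha`). The Jost functions come from a Volterra equation, solved by contraction in a
weighted space (`exists_volterra_solution`), and are unique (`eq_zero_of_tendsto`).

The values at `k = 0` are what makes the modified eigenfunctions work. Since `T(0) = -1`, the sign
in `𝒦♯` turns `T(0) m₊(x, 0) exp (ikx)` into a common leading term for `k > 0` and `k < 0`, and all
other plane waves in `𝒦♯_S` have coefficients in `k` that vanish at `0`; these coefficients are
therefore continuous in spite of the cut-off at `k = 0`. The scattering relation gives
`√(2π) 𝒦♯ = 𝒦♯_S + 𝒦♯_R` (`sqrt_mul_sharpK`), and `𝒦♯_R = O(⟨x⟩ ^ (-γ + 1))` uniformly in `k`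
(`exists_decay_sharpKR`), so that every product with a factor `𝒦♯_R` is absolutely integrable
in `x`: this is `μ♯_{R,1}`.

It remains to treat `∏_* 𝒦♯_S`, a sum of terms `P(x) a(k) exp (i x ε · k)` in which `a ∈ 𝒞` and the
profile `P` is a product of resonances and cut-offs (`altProd_sharpKS`). Such a `P` is step-like: it
tends to constants `l` and `m` at `±∞`, with an error `O(⟨x⟩ ^ (-γ + 1))`. Hence
`P = (l + m) / 2 + (l - m) / √(2π) * S + g` with `S(x) = ∫₀ˣ exp (-t² / 2) dt` and `g` decaying, and
the three parts act as `δ(ε · k)`, as `p.v. φ(ε · k) / (i ε · k)` with `φ` the Gaussian density, and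
as `ĝ(-ε · k)` (`integral_stepLike_mul`). When all four factors are resonances, `l = m = 1` and
`a = 1`, which is the term `2π δ(k₁ - k₂ + k₃ - k₄)`; in all other terms a cut-off occurs, so that
`l m = 0`, and a coefficient vanishing at `k_j = 0` occurs, so that `a ∈ 𝒞_L`.

These manipulations need the `x`-integral of `∫ a(k) G(k) exp (i x ε · k) dk` to converge absolutely
for Schwartz functions `G`, although the factors of `a` are only bounded and continuous
(`amplitude_prod_mul`). Two of the four variables suffice: writing `G` as a superposition of
one-sided exponentials in one of them (`integral_integral_decouple`) separates the oscillating
integral into products of two functions of `x`, both in `L²` by Plancherel. Fourier inversion in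
the direction `ε` (`Amplitude.fiberIntegral_eq`) then identifies the delta function and the
principal value (`Amplitude.hasPV`).
-/

noncomputable section

namespace OddResonance

/-! ### Indefinite integrals and Wronskians -/

/-- Absolute continuity passes to every function whose increments are dominated by those of an
absolutely continuous one. -/
lemma AbsolutelyContinuousOnInterval.of_dist_le {X Y : Type*} [PseudoMetricSpace X]
    [PseudoMetricSpace Y] {f : ℝ → X} {g : ℝ → Y} {a b : ℝ} (C : ℝ)
    (hg : AbsolutelyContinuousOnInterval g a b)
    (h : ∀ x ∈ uIcc a b, ∀ y ∈ uIcc a b, dist (f x) (f y) ≤ C * dist (g x) (g y)) :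
    AbsolutelyContinuousOnInterval f a b := by
  unfold AbsolutelyContinuousOnInterval at hg ⊢
  have h2 := hg.const_mul C
  rw [mul_zero] at h2
  refine squeeze_zero' ?_ ?_ h2
  · filter_upwards with E
    exact Finset.sum_nonneg fun _ _ => dist_nonneg
  · have h3 : ∀ᶠ E : ℕ × (ℕ → ℝ × ℝ) in AbsolutelyContinuousOnInterval.totalLengthFilter ⊓
        𝓟 (AbsolutelyContinuousOnInterval.disjWithin a b),
        E ∈ AbsolutelyContinuousOnInterval.disjWithin a b :=
      eventually_inf_principal.mpr (by simp)
    filter_upwards [h3] with E hE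
    rw [Finset.mul_sum]
    refine Finset.sum_le_sum fun i hi => ?_
    exact h _ (hE.1 i hi).1 _ (hE.1 i hi).2

/-- `u` is an indefinite integral of the locally integrable function `u'`. -/
structure HasPrim (u u' : ℝ → ℂ) : Prop where
  loc : LocallyIntegrable u'
  eq : ∀ x y : ℝ, u y - u x = ∫ t in x..y, u' t

namespace HasPrim

variable {u u' v v' : ℝ → ℂ}

lemma intervalIntegrable (h : HasPrim u u') (a b : ℝ) : IntervalIntegrable u' volume a b :=
  (h.loc.integrableOn_isCompact isCompact_uIcc).intervalIntegrable

lemma continuous (h : HasPrim u u') : Continuous u := by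
  have : u = fun y => u 0 + ∫ t in (0 : ℝ)..y, u' t := by
    funext y; rw [← h.eq 0 y]; ring
  rw [this]
  exact continuous_const.add (intervalIntegral.continuous_primitive h.intervalIntegrable 0)

lemma absolutelyContinuous (h : HasPrim u u') (a b : ℝ) :
    AbsolutelyContinuousOnInterval u a b := by
  have hn : IntervalIntegrable (fun t => ‖u' t‖) volume a b := (h.intervalIntegrable a b).norm
  refine AbsolutelyContinuousOnInterval.of_dist_le 1
    (hn.absolutelyContinuousOnInterval_intervalIntegral (c := a) (by simp)) ?_
  intro x _ y _
  have e : (∫ t in a..x, ‖u' t‖) - ∫ t in a..y, ‖u' t‖ = ∫ t in y..x, ‖u' t‖ := by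
    rw [intervalIntegral.integral_interval_sub_left] <;>
      exact (h.intervalIntegrable _ _).norm
  rw [dist_eq_norm, dist_eq_norm, h.eq y x, e, one_mul, Real.norm_eq_abs]
  exact intervalIntegral.norm_integral_le_abs_integral_norm

lemma ae_hasDerivAt (h : HasPrim u u') : ∀ᵐ x, HasDerivAt u (u' x) x := by
  filter_upwards [LocallyIntegrable.ae_hasDerivAt_integral h.loc] with x hx
  have : u = fun y => u 0 + ∫ t in (0 : ℝ)..y, u' t := by
    funext y; rw [← h.eq 0 y]; ring
  rw [this]
  exact (hx 0).const_add _

lemma of_hasDerivAt (h : ∀ x, HasDerivAt u (u' x) x) (hc : Continuous u') : HasPrim u u' :=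
  ⟨hc.locallyIntegrable, fun _ _ =>
    (intervalIntegral.integral_eq_sub_of_hasDerivAt (fun t _ => h t)
      (hc.intervalIntegrable _ _)).symm⟩

lemma congr (h : HasPrim u u') (e : ∀ x, u' x = v' x) : HasPrim u v' := by
  have : u' = v' := funext e
  rwa [← this]

lemma add (h : HasPrim u u') (h' : HasPrim v v') :
    HasPrim (fun x => u x + v x) (fun x => u' x + v' x) :=
  ⟨h.loc.add h'.loc, fun x y => by
    rw [intervalIntegral.integral_add (h.intervalIntegrable _ _) (h'.intervalIntegrable _ _),
      ← h.eq, ← h'.eq]; ring⟩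

lemma const_mul (h : HasPrim u u') (c : ℂ) : HasPrim (fun x => c * u x) (fun x => c * u' x) :=
  ⟨h.loc.smul c, fun x y => by
    rw [intervalIntegral.integral_const_mul, ← h.eq]; ring⟩

lemma sub (h : HasPrim u u') (h' : HasPrim v v') :
    HasPrim (fun x => u x - v x) (fun x => u' x - v' x) := by
  simpa [sub_eq_add_neg] using h.add (h'.const_mul (-1))

lemma conj (h : HasPrim u u') :
    HasPrim (fun x => (starRingEnd ℂ) (u x)) (fun x => (starRingEnd ℂ) (u' x)) := by
  refine ⟨?_, fun x y => ?_⟩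
  · intro x
    obtain ⟨s, hs, hi⟩ := h.loc x
    exact ⟨s, hs, (Complex.conjCLE : ℂ →L[ℝ] ℂ).integrable_comp hi⟩
  · rw [← map_sub, h.eq, intervalIntegral.intervalIntegral_eq_integral_uIoc,
      intervalIntegral.intervalIntegral_eq_integral_uIoc, integral_conj]
    split_ifs <;> simp

lemma eq_of_deriv_zero (h : HasPrim u u') (h0 : ∀ x, u' x = 0) (x y : ℝ) : u x = u y := by
  have := h.eq y x
  simp only [h0, intervalIntegral.integral_zero] at this
  exact sub_eq_zero.1 this

/-- The product rule for indefinite integrals. -/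
lemma mul (h : HasPrim u u') (h' : HasPrim v v') :
    HasPrim (fun x => u x * v x) (fun x => u' x * v x + u x * v' x) := by
  have l1 : LocallyIntegrable (fun x => u' x * v x + u x * v' x) := by
    refine LocallyIntegrable.add ?_ ?_
    · exact LocallyIntegrable.mul_continuous h'.continuous h.loc
    · have := LocallyIntegrable.mul_continuous h.continuous h'.loc
      simpa only [mul_comm] using this
  refine ⟨l1, fun a b => ?_⟩
  set p : ℝ → ℂ := fun x => ∫ t in a..x, (u' t * v t + u t * v' t) with hp
  have P : HasPrim p (fun x => u' x * v x + u x * v' x) := by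
    refine ⟨l1, fun x y => ?_⟩
    rw [hp]
    have l2 : ∀ a b, IntervalIntegrable (fun x => u' x * v x + u x * v' x) volume a b := fun a b =>
      (l1.integrableOn_isCompact isCompact_uIcc).intervalIntegrable
    exact intervalIntegral.integral_interval_sub_left (l2 _ _) (l2 _ _)
  -- the difference is absolutely continuous with derivative zero almost everywhere
  have ac : AbsolutelyContinuousOnInterval (fun x => u x * v x - p x) a b :=
    ((h.absolutelyContinuous a b).smul (h'.absolutelyContinuous a b)).sub
      (P.absolutelyContinuous a b)
  obtain ⟨c, hc⟩ := ac.const_of_ae_hasDerivAt_zero (by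
    filter_upwards [h.ae_hasDerivAt, h'.ae_hasDerivAt, P.ae_hasDerivAt] with x h1 h2 h3 _
    have := (h1.mul h2).sub h3
    rw [sub_self] at this
    exact this)
  have ha := hc a (by simp)
  have hb := hc b (by simp)
  have pa : p a = 0 := by simp [hp]
  simp only [pa, sub_zero] at ha
  show u b * v b - u a * v a = p b
  rw [ha, ← hb]; ring

end HasPrim

/-- If `v` is nonnegative and integrable, then `∫_x^∞ v e^{2w} ≤ e^{2w(x)} / 2` for
`w(x) = ∫_x^∞ v`. -/
lemma integral_Ioi_mul_exp_tail_le {v : ℝ → ℝ} (hv : Integrable v) (hv0 : ∀ x, 0 ≤ v x) (x : ℝ) :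
    IntegrableOn (fun t => v t * Real.exp (2 * ∫ s in Ioi t, v s)) (Ioi x) ∧
    ∫ t in Ioi x, v t * Real.exp (2 * ∫ s in Ioi t, v s)
      ≤ Real.exp (2 * ∫ s in Ioi x, v s) / 2 := by
  set w : ℝ → ℝ := fun t => ∫ s in Ioi t, v s with hw
  have hw_sub : ∀ a b, w a - w b = ∫ t in a..b, v t := fun a b => by
    simp only [hw]
    rw [← intervalIntegral.integral_Ioi_sub_Ioi' hv.integrableOn hv.integrableOn]
  have hwc : Continuous w := by
    have : w = fun y => w 0 - ∫ t in (0 : ℝ)..y, v t := by funext y; rw [← hw_sub 0 y]; ring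
    rw [this]
    exact continuous_const.sub
      (intervalIntegral.continuous_primitive (fun _ _ => hv.intervalIntegrable) 0)
  have hw0 : ∀ a, 0 ≤ w a := fun a => setIntegral_nonneg measurableSet_Ioi fun t _ => hv0 t
  have hwI : ∀ a, w a ≤ ∫ s, v s := fun a =>
    setIntegral_le_integral hv (Eventually.of_forall hv0)
  have hint : Integrable (fun t => v t * Real.exp (2 * w t)) := by
    refine hv.mul_bdd (c := Real.exp (2 * ∫ s, v s))
      (by fun_prop) (Eventually.of_forall fun t => ?_)
    rw [Real.norm_eq_abs, Real.abs_exp]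
    exact Real.exp_le_exp.2 (by linarith [hwI t])
  refine ⟨hint.integrableOn, ?_⟩
  have key : ∀ b, x ≤ b → ∫ t in x..b, v t * Real.exp (2 * w t) ≤ Real.exp (2 * w x) / 2 := by
    intro b hb
    -- `exp (2 w)` is absolutely continuous, because `exp` is Lipschitz on the bounded range of
    -- `w`, and its derivative is `-2 v exp (2 w)` almost everywhere
    have ac : AbsolutelyContinuousOnInterval (fun t => Real.exp (2 * w t)) x b := by
      refine AbsolutelyContinuousOnInterval.of_dist_le (2 * Real.exp (2 * ∫ s, v s))
        ((hv.intervalIntegrable).absolutelyContinuousOnInterval_intervalIntegral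
          (c := x) (by simp)) ?_
      intro y _ z _
      have e1 : dist (∫ t in x..y, v t) (∫ t in x..z, v t) = |w y - w z| := by
        rw [← hw_sub, ← hw_sub, Real.dist_eq, abs_sub_comm]
        congr 1; ring
      rw [e1, Real.dist_eq]
      have := (convex_Iic (∫ s, v s)).norm_image_sub_le_of_norm_hasDerivWithin_le
        (f := fun r => Real.exp (2 * r)) (f' := fun r => Real.exp (2 * r) * (2 * 1))
        (C := 2 * Real.exp (2 * ∫ s, v s))
        (fun r _ => (((hasDerivAt_id r).const_mul 2).exp).hasDerivWithinAt)
        (fun r (hr : r ≤ _) => by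
          rw [Real.norm_eq_abs, abs_of_nonneg (by positivity)]
          have := Real.exp_le_exp.2 (by linarith : 2 * r ≤ 2 * ∫ s, v s)
          linarith) (hwI z) (hwI y)
      simpa [Real.norm_eq_abs] using this
    have h1 := ac.integral_deriv_eq_sub
    have h2 : ∫ t in x..b, deriv (fun t => Real.exp (2 * w t)) t
        = ∫ t in x..b, (-2) * (v t * Real.exp (2 * w t)) := by
      refine intervalIntegral.integral_congr_ae ?_
      filter_upwards [LocallyIntegrable.ae_hasDerivAt_integral hv.locallyIntegrable] with t ht _
      have : w = fun y => w 0 - ∫ t in (0 : ℝ)..y, v t := by funext y; rw [← hw_sub 0 y]; ring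
      have hd : HasDerivAt w (- v t) t := by
        rw [this]
        simpa using (ht 0).const_sub (w 0)
      rw [((hd.const_mul 2).exp).deriv]; ring
    rw [h2, intervalIntegral.integral_const_mul] at h1
    have := Real.exp_pos (2 * w b)
    linarith
  refine le_of_tendsto (intervalIntegral_tendsto_integral_Ioi x hint.integrableOn tendsto_id) ?_
  filter_upwards [eventually_ge_atTop x] with b hb using key b hb

/-- A solution together with its derivative, as a pair of indefinite integrals. -/
lemma IsSolution.hasPrim {V : ℝ → ℝ} {k : ℝ} {ψ : ℝ → ℂ} (hV : LocallyIntegrable V)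
    (h : IsSolution V k ψ) :
    HasPrim (deriv ψ) (fun t => ((V t - k ^ 2 : ℝ) : ℂ) * ψ t) ∧ HasPrim ψ (deriv ψ) := by
  have h1 : HasPrim (deriv ψ) (fun t => ((V t - k ^ 2 : ℝ) : ℂ) * ψ t) := by
    refine ⟨LocallyIntegrable.mul_continuous h.1.continuous ?_, h.2⟩
    have h2 : LocallyIntegrable (fun t => V t - k ^ 2) :=
      hV.sub (locallyIntegrable_const _)
    intro x
    obtain ⟨s, hs, hi⟩ := h2 x
    exact ⟨s, hs, hi.ofReal⟩
  exact ⟨h1, HasPrim.of_hasDerivAt (fun x => (h.1 x).hasDerivAt) h1.continuous⟩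

lemma HasPrim.isSolution {V : ℝ → ℝ} {k : ℝ} {ψ ψ' : ℝ → ℂ} (hd : ∀ x, HasDerivAt ψ (ψ' x) x)
    (h : HasPrim ψ' (fun t => ((V t - k ^ 2 : ℝ) : ℂ) * ψ t)) : IsSolution V k ψ := by
  have : deriv ψ = ψ' := funext fun x => (hd x).deriv
  exact ⟨fun x => (hd x).differentiableAt, by rw [this]; exact h.eq⟩

/-- The Wronskian `u v' - u' v`. -/
def wronskian (u v : ℝ → ℂ) (x : ℝ) : ℂ := u x * deriv v x - deriv u x * v x

/-- The Wronskian of solutions at the energies `k ^ 2` and `l ^ 2` has derivative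
`(k ^ 2 - l ^ 2) u v`. -/
lemma hasPrim_wronskian {V : ℝ → ℝ} {k l : ℝ} {u v : ℝ → ℂ} (hV : LocallyIntegrable V)
    (hu : IsSolution V k u) (hv : IsSolution V l v) :
    HasPrim (wronskian u v) (fun t => ((k ^ 2 - l ^ 2 : ℝ) : ℂ) * (u t * v t)) := by
  obtain ⟨u1, u0⟩ := hu.hasPrim hV
  obtain ⟨v1, v0⟩ := hv.hasPrim hV
  refine ((u0.mul v1).sub (u1.mul v0)).congr fun x => ?_
  push_cast; ring

lemma wronskian_const {V : ℝ → ℝ} {k l : ℝ} {u v : ℝ → ℂ} (hV : LocallyIntegrable V)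
    (hu : IsSolution V k u) (hv : IsSolution V l v) (hkl : k ^ 2 = l ^ 2) (x y : ℝ) :
    wronskian u v x = wronskian u v y :=
  (hasPrim_wronskian hV hu hv).eq_of_deriv_zero (fun t => by simp [hkl]) x y

/-! ### The Volterra equation of the Jost functions -/

/-- The Volterra kernel `∫₀^y exp (2iks) ds`. -/
def volterraKernel (k y : ℝ) : ℂ := ∫ s in (0 : ℝ)..y, Complex.exp (2 * Complex.I * k * s)

lemma norm_exp_two_I (k s : ℝ) : ‖Complex.exp (2 * Complex.I * k * s)‖ = 1 := by
  have : 2 * Complex.I * k * s = ((2 * k * s : ℝ) : ℂ) * Complex.I := by push_cast; ring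
  rw [this, Complex.norm_exp_ofReal_mul_I]

@[simp] lemma volterraKernel_zero_right (k : ℝ) : volterraKernel k 0 = 0 := by
  simp [volterraKernel]

lemma continuous_volterraKernel : Continuous fun p : ℝ × ℝ => volterraKernel p.1 p.2 := by
  unfold volterraKernel
  refine intervalIntegral.continuous_parametric_intervalIntegral_of_continuous
    (f := fun (p : ℝ × ℝ) (s : ℝ) => Complex.exp (2 * Complex.I * p.1 * s)) ?_ continuous_snd
  unfold Function.uncurry
  fun_prop

lemma hasDerivAt_volterraKernel (k y : ℝ) :
    HasDerivAt (volterraKernel k) (Complex.exp (2 * Complex.I * k * y)) y := by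
  have hc : Continuous fun s : ℝ => Complex.exp (2 * Complex.I * k * s) := by fun_prop
  exact intervalIntegral.integral_hasDerivAt_right (hc.intervalIntegrable _ _)
    (hc.stronglyMeasurableAtFilter _ _) hc.continuousAt

lemma norm_volterraKernel_sub_le (k a b : ℝ) :
    ‖volterraKernel k a - volterraKernel k b‖ ≤ |a - b| := by
  have hc : Continuous fun s : ℝ => Complex.exp (2 * Complex.I * k * s) := by fun_prop
  unfold volterraKernel
  rw [intervalIntegral.integral_interval_sub_left (hc.intervalIntegrable _ _)
    (hc.intervalIntegrable _ _)]
  have := intervalIntegral.norm_integral_le_of_norm_le_const (a := b) (b := a) (C := 1)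
    (f := fun s : ℝ => Complex.exp (2 * Complex.I * k * s)) (fun s _ => (norm_exp_two_I k s).le)
  simpa using this

lemma norm_volterraKernel_le (k y : ℝ) : ‖volterraKernel k y‖ ≤ |y| := by
  simpa using norm_volterraKernel_sub_le k y 0

/-- The Volterra operator `F ↦ ∫_x^∞ (∫₀^{t-x} exp (2iks) ds) F(t) dt`. The kernel vanishes at
`0`, so that the positive part of `t - x` cuts the integral off at `t = x`. -/
def volterra (k : ℝ) (F : ℝ → ℂ) (x : ℝ) : ℂ := ∫ t, volterraKernel k (max (t - x) 0) * F t

/-- The weight `1 + x⁻` controlling the growth of the Jost function at `-∞`. -/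
def growthWeight (x : ℝ) : ℝ := 1 + max (-x) 0

lemma one_le_growthWeight (x : ℝ) : 1 ≤ growthWeight x := by
  simp [growthWeight]

lemma growthWeight_le (x : ℝ) : growthWeight x ≤ 1 + |x| := by
  unfold growthWeight
  have := neg_le_abs x
  have := abs_nonneg x
  gcongr
  exact max_le ‹_› ‹_›

@[fun_prop]
lemma continuous_growthWeight : Continuous growthWeight := by
  unfold growthWeight; fun_prop

lemma growthWeight_anti {x y : ℝ} (h : x ≤ y) : growthWeight y ≤ growthWeight x := by
  unfold growthWeight; gcongr

/-- The bound `(t - x)⁺ (1 + t⁻) ≤ (1 + x⁻) (1 + |t|)` makes one moment of `V` suffice for the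
Volterra equation, on the whole line. -/
lemma max_mul_growthWeight_le (t x : ℝ) :
    max (t - x) 0 * growthWeight t ≤ growthWeight x * (1 + |t|) := by
  unfold growthWeight
  rcases le_total t x with h | h
  · rw [max_eq_right (by linarith), zero_mul]; positivity
  · rw [max_eq_left (by linarith)]
    rcases le_total x 0 with hx | hx
    · rw [max_eq_left (by linarith : (0:ℝ) ≤ -x)]
      rcases le_total t 0 with ht | ht
      · rw [max_eq_left (by linarith), abs_of_nonpos ht]; nlinarith
      · rw [max_eq_right (by linarith), abs_of_nonneg ht]; nlinarith
    · rw [max_eq_right (by linarith), max_eq_right (by linarith), abs_of_nonneg (by linarith)]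
      nlinarith

lemma max_sub_le (t x : ℝ) : max (t - x) 0 ≤ growthWeight x * (1 + |t|) := by
  refine le_trans ?_ (max_mul_growthWeight_le t x)
  nlinarith [one_le_growthWeight t, le_max_right (t - x) 0]

/-- The full weight `(1 + x⁻) exp (2 ∫_x^∞ (1 + |t|) |V|)`, for which the Volterra operator is a
contraction. -/
def volterraWeight (V : ℝ → ℝ) (x : ℝ) : ℝ :=
  growthWeight x * Real.exp (2 * ∫ s in Ioi x, (1 + |s|) * |V s|)

section weight

variable {V : ℝ → ℝ}

lemma continuous_inv_one_add_abs : Continuous fun t : ℝ => (1 + |t|)⁻¹ :=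
  (by fun_prop : Continuous fun t : ℝ => 1 + |t|).inv₀ fun t => by positivity

lemma aestronglyMeasurable_of_moment (hV : Integrable fun t => (1 + |t|) * V t) :
    AEStronglyMeasurable V := by
  refine (hV.1.mul continuous_inv_one_add_abs.aestronglyMeasurable).congr
    (Eventually.of_forall fun t => ?_)
  have : (1 : ℝ) + |t| ≠ 0 := by positivity
  simp only [Pi.mul_apply]; field_simp

lemma integrable_one_add_abs_mul_abs (hV : Integrable fun t => (1 + |t|) * V t) :
    Integrable fun t => (1 + |t|) * |V t| := by
  refine hV.norm.congr (Eventually.of_forall fun t => ?_)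
  have : (0 : ℝ) ≤ 1 + |t| := by positivity
  simp only [Real.norm_eq_abs, abs_mul, abs_of_nonneg this]

lemma volterraWeight_pos (x : ℝ) : 0 < volterraWeight V x :=
  mul_pos (by linarith [one_le_growthWeight x]) (Real.exp_pos _)

lemma growthWeight_le_volterraWeight (x : ℝ) : growthWeight x ≤ volterraWeight V x := by
  unfold volterraWeight
  have h : 0 ≤ ∫ s in Ioi x, (1 + |s|) * |V s| :=
    setIntegral_nonneg measurableSet_Ioi fun t _ => by positivity
  have := Real.one_le_exp (by linarith : 0 ≤ 2 * ∫ s in Ioi x, (1 + |s|) * |V s|)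
  nlinarith [one_le_growthWeight x]

lemma volterraWeight_le (hV : Integrable fun t => (1 + |t|) * V t) (x : ℝ) :
    volterraWeight V x ≤ Real.exp (2 * ∫ s, (1 + |s|) * |V s|) * growthWeight x := by
  unfold volterraWeight
  rw [mul_comm]
  have h : ∫ s in Ioi x, (1 + |s|) * |V s| ≤ ∫ s, (1 + |s|) * |V s| :=
    setIntegral_le_integral (integrable_one_add_abs_mul_abs hV)
      (Eventually.of_forall fun t => by positivity)
  have := one_le_growthWeight x
  gcongr

lemma continuous_volterraWeight (hV : Integrable fun t => (1 + |t|) * V t) :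
    Continuous (volterraWeight V) := by
  have hv := integrable_one_add_abs_mul_abs hV
  have : (fun x => ∫ s in Ioi x, (1 + |s|) * |V s|) =
      fun x => (∫ s in Ioi (0 : ℝ), (1 + |s|) * |V s|)
      - ∫ s in (0 : ℝ)..x, (1 + |s|) * |V s| := by
    funext x
    rw [← intervalIntegral.integral_Ioi_sub_Ioi' hv.integrableOn hv.integrableOn]
    ring
  have hc : Continuous fun x => ∫ s in Ioi x, (1 + |s|) * |V s| := by
    rw [this]
    exact continuous_const.sub
      (intervalIntegral.continuous_primitive (fun _ _ => hv.intervalIntegrable) 0)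
  unfold volterraWeight
  fun_prop

/-- The contraction estimate. -/
lemma norm_volterra_le_weight (hV : Integrable fun t => (1 + |t|) * V t) {F : ℝ → ℂ} {M : ℝ}
    (hM : 0 ≤ M) (k x : ℝ) (hF : ∀ t, x < t → ‖F t‖ ≤ M * (|V t| * volterraWeight V t)) :
    ‖volterra k F x‖ ≤ M / 2 * volterraWeight V x := by
  have hv := integrable_one_add_abs_mul_abs hV
  obtain ⟨hi, hle⟩ := integral_Ioi_mul_exp_tail_le hv (fun t => by positivity) x
  set w : ℝ → ℝ := fun t => ∫ s in Ioi t, (1 + |s|) * |V s| with hw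
  have hN := one_le_growthWeight x
  have hb : Integrable ((Ioi x).indicator
      fun t => M * growthWeight x * ((1 + |t|) * |V t| * Real.exp (2 * w t))) :=
    IntegrableOn.integrable_indicator (hi.const_mul _) measurableSet_Ioi
  refine (norm_integral_le_of_norm_le hb (Eventually.of_forall fun t => ?_)).trans ?_
  · rcases le_or_gt t x with h | h
    · rw [max_eq_right (by linarith)]; simp [indicator, not_lt.2 h]
    · rw [indicator_of_mem (show t ∈ Ioi x from h), norm_mul]
      have h1 : ‖volterraKernel k (max (t - x) 0)‖ ≤ max (t - x) 0 := by
        refine (norm_volterraKernel_le _ _).trans (abs_of_nonneg (le_max_right _ _)).le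
      calc _ ≤ max (t - x) 0 * (M * (|V t| * volterraWeight V t)) :=
            mul_le_mul h1 (hF t h) (norm_nonneg _) (le_max_right _ _)
        _ = (max (t - x) 0 * growthWeight t) * (M * |V t| * Real.exp (2 * w t)) := by
            simp only [volterraWeight, hw]; ring
        _ ≤ (growthWeight x * (1 + |t|)) * (M * |V t| * Real.exp (2 * w t)) := by
            gcongr ?_ * _
            exact max_mul_growthWeight_le t x
        _ = _ := by ring
  · rw [integral_indicator measurableSet_Ioi, integral_const_mul]
    calc _ ≤ M * growthWeight x * (Real.exp (2 * w x) / 2) := by gcongr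
      _ = _ := by simp only [volterraWeight, hw]; ring

/-- Joint continuity of the Volterra integral of `V(t) Y(t, k)` in `x` and `k`. -/
lemma continuous_volterra (hV : Integrable fun t => (1 + |t|) * V t) {Y : ℝ → ℝ → ℂ}
    (hY : Continuous (Function.uncurry Y)) {C : ℝ} (hC : ∀ t k, ‖Y t k‖ ≤ C * growthWeight t) :
    Continuous fun p : ℝ × ℝ => volterra p.2 (fun t => V t * Y t p.2) p.1 := by
  have hv := integrable_one_add_abs_mul_abs hV
  have hVm := aestronglyMeasurable_of_moment hV
  have hC0 : 0 ≤ C := by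
    have := (norm_nonneg _).trans (hC 0 0)
    nlinarith [one_le_growthWeight 0]
  rw [continuous_iff_continuousAt]
  rintro ⟨x₀, k₀⟩
  refine continuousAt_of_dominated (bound := fun t => C * growthWeight (x₀ - 1) *
    ((1 + |t|) * |V t|)) ?_ ?_ (hv.const_mul _) ?_
  · filter_upwards with p
    refine AEStronglyMeasurable.mul ?_ (AEStronglyMeasurable.mul ?_ ?_)
    · exact (continuous_volterraKernel.comp (by fun_prop : Continuous fun t : ℝ =>
        (p.2, max (t - p.1) 0))).aestronglyMeasurable
    · exact Complex.continuous_ofReal.comp_aestronglyMeasurable hVm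
    · exact (hY.comp (by fun_prop : Continuous fun t : ℝ => (t, p.2))).aestronglyMeasurable
  · have : ∀ᶠ p : ℝ × ℝ in 𝓝 (x₀, k₀), x₀ - 1 < p.1 :=
      continuous_fst.continuousAt.eventually (lt_mem_nhds (by simp))
    filter_upwards [this] with p hp
    filter_upwards with t
    have h1 : ‖volterraKernel p.2 (max (t - p.1) 0)‖ ≤ max (t - p.1) 0 :=
      (norm_volterraKernel_le _ _).trans (abs_of_nonneg (le_max_right _ _)).le
    rw [norm_mul, norm_mul, Complex.norm_real, Real.norm_eq_abs]
    calc _ ≤ max (t - p.1) 0 * (|V t| * (C * growthWeight t)) := by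
          gcongr
          exact hC _ _
      _ = (max (t - p.1) 0 * growthWeight t) * (C * |V t|) := by ring
      _ ≤ (growthWeight p.1 * (1 + |t|)) * (C * |V t|) := by
          gcongr ?_ * _
          exact max_mul_growthWeight_le _ _
      _ ≤ (growthWeight (x₀ - 1) * (1 + |t|)) * (C * |V t|) := by
          gcongr
          exact growthWeight_anti hp.le
      _ = _ := by ring
  · filter_upwards with t
    refine Continuous.continuousAt ?_
    refine Continuous.mul ?_ (continuous_const.mul ?_)
    · exact continuous_volterraKernel.comp (by fun_prop : Continuous fun p : ℝ × ℝ =>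
        (p.2, max (t - p.1) 0))
    · exact hY.comp (by fun_prop : Continuous fun p : ℝ × ℝ => (t, p.2))

open scoped BoundedContinuousFunction in
/-- The Volterra equation is solved by a contraction in a weighted space of functions that are
jointly continuous in `x` and `k`. -/
lemma exists_volterra_solution (hV : Integrable fun t => (1 + |t|) * V t) :
    ∃ m : ℝ → ℝ → ℂ, Continuous (Function.uncurry m) ∧
      (∃ C, ∀ x k, ‖m x k‖ ≤ C * growthWeight x) ∧
      ∀ x k, m x k = 1 + volterra k (fun t => V t * m t k) x := by
  set W := volterraWeight V with hW
  have hWc : Continuous W := continuous_volterraWeight hV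
  have hW0 : ∀ x, 0 < W x := volterraWeight_pos
  have hW1 : ∀ x, 1 ≤ W x := fun x =>
    (one_le_growthWeight x).trans (growthWeight_le_volterraWeight x)
  set E := Real.exp (2 * ∫ s, (1 + |s|) * |V s|) with hE
  have hWE : ∀ x, W x ≤ E * growthWeight x := volterraWeight_le hV
  have hbd : ∀ (y : (ℝ × ℝ) →ᵇ ℂ) (t k : ℝ), ‖(W t : ℂ) * y (t, k)‖ ≤ ‖y‖ * W t := by
    intro y t k
    rw [norm_mul, Complex.norm_real, Real.norm_eq_abs, abs_of_pos (hW0 t), mul_comm]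
    have := hW0 t
    gcongr
    exact y.norm_coe_le_norm _
  have hcy : ∀ y : (ℝ × ℝ) →ᵇ ℂ,
      Continuous (Function.uncurry fun t k => (W t : ℂ) * y (t, k)) := by
    intro y
    unfold Function.uncurry
    have := y.continuous
    fun_prop
  have hvol : ∀ (y : (ℝ × ℝ) →ᵇ ℂ) (x k : ℝ),
      ‖volterra k (fun t => V t * ((W t : ℂ) * y (t, k))) x‖ ≤ ‖y‖ / 2 * W x := by
    intro y x k
    refine norm_volterra_le_weight hV (norm_nonneg y) k x fun t _ => ?_
    rw [norm_mul, Complex.norm_real, Real.norm_eq_abs]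
    calc _ ≤ |V t| * (‖y‖ * W t) := by gcongr; exact hbd y t k
      _ = _ := by ring
  have hcont : ∀ y : (ℝ × ℝ) →ᵇ ℂ, Continuous fun p : ℝ × ℝ =>
      (1 + volterra p.2 (fun t => V t * ((W t : ℂ) * y (t, p.2))) p.1) / (W p.1 : ℂ) := by
    intro y
    have := continuous_volterra hV (hcy y) (C := ‖y‖ * E) fun t k =>
      (hbd y t k).trans (by
        have := norm_nonneg y
        rw [mul_assoc]; gcongr; exact hWE t)
    refine (continuous_const.add this).div (by fun_prop) fun p => ?_
    exact_mod_cast (hW0 p.1).ne'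
  -- the equation for `y = m / W`, where `y` is bounded
  set Op : ((ℝ × ℝ) →ᵇ ℂ) → ((ℝ × ℝ) →ᵇ ℂ) := fun y =>
    BoundedContinuousFunction.ofNormedAddCommGroup _ (hcont y) (1 + ‖y‖ / 2) (by
      intro p
      rw [norm_div, Complex.norm_real, Real.norm_eq_abs, abs_of_pos (hW0 _),
        div_le_iff₀ (hW0 _)]
      refine (norm_add_le _ _).trans ?_
      have := hvol y p.1 p.2
      rw [norm_one]
      linarith [hW1 p.1]) with hOp
  have hOpv : ∀ y x k, Op y (x, k) =
      (1 + volterra k (fun t => V t * ((W t : ℂ) * y (t, k))) x) / (W x : ℂ) := fun y x k => rfl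
  have hintg : ∀ (y : (ℝ × ℝ) →ᵇ ℂ) (x k : ℝ), Integrable fun t =>
      volterraKernel k (max (t - x) 0) * (V t * ((W t : ℂ) * y (t, k))) := by
    intro y x k
    have hv := integrable_one_add_abs_mul_abs hV
    have hVm := aestronglyMeasurable_of_moment hV
    refine (hv.const_mul (‖y‖ * E * growthWeight x)).mono' ?_ (Eventually.of_forall fun t => ?_)
    · refine AEStronglyMeasurable.mul ?_ (AEStronglyMeasurable.mul ?_ ?_)
      · exact (continuous_volterraKernel.comp (by fun_prop : Continuous fun t : ℝ =>
          (k, max (t - x) 0))).aestronglyMeasurable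
      · exact Complex.continuous_ofReal.comp_aestronglyMeasurable hVm
      · exact ((hcy y).comp (by fun_prop : Continuous fun t : ℝ => (t, k))).aestronglyMeasurable
    · have h1 : ‖volterraKernel k (max (t - x) 0)‖ ≤ max (t - x) 0 :=
        (norm_volterraKernel_le _ _).trans (abs_of_nonneg (le_max_right _ _)).le
      rw [norm_mul, norm_mul, Complex.norm_real, Real.norm_eq_abs]
      have hE0 : 0 < E := Real.exp_pos _
      calc _ ≤ max (t - x) 0 * (|V t| * (‖y‖ * (E * growthWeight t))) := by
            gcongr
            refine (hbd y t k).trans ?_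
            gcongr
            exact hWE t
        _ = (max (t - x) 0 * growthWeight t) * (‖y‖ * E * |V t|) := by ring
        _ ≤ (growthWeight x * (1 + |t|)) * (‖y‖ * E * |V t|) := by
            gcongr ?_ * _
            exact max_mul_growthWeight_le _ _
        _ = _ := by ring
  have hcontr : ContractingWith (1 / 2) Op := by
    refine ⟨by norm_num, LipschitzWith.of_dist_le_mul fun y z => ?_⟩
    rw [BoundedContinuousFunction.dist_le (by positivity)]
    rintro ⟨x, k⟩
    have e : volterra k (fun t => V t * ((W t : ℂ) * y (t, k))) x
        - volterra k (fun t => V t * ((W t : ℂ) * z (t, k))) x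
        = volterra k (fun t => V t * ((W t : ℂ) * (y - z) (t, k))) x := by
      unfold volterra
      rw [← integral_sub (hintg y x k) (hintg z x k)]
      refine integral_congr_ae (Eventually.of_forall fun t => ?_)
      simp only [BoundedContinuousFunction.coe_sub, Pi.sub_apply]
      ring
    rw [dist_eq_norm, dist_eq_norm, hOpv, hOpv, ← sub_div, add_sub_add_left_eq_sub, e, norm_div,
      Complex.norm_real, Real.norm_eq_abs, abs_of_pos (hW0 _), div_le_iff₀ (hW0 _)]
    refine (hvol (y - z) x k).trans (le_of_eq ?_)
    rw [show ((1 / 2 : NNReal) : ℝ) = 1 / 2 by norm_num]; ring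
  set y := ContractingWith.fixedPoint Op hcontr with hy
  have hfix : Op y = y := ContractingWith.fixedPoint_isFixedPt hcontr
  refine ⟨fun x k => (W x : ℂ) * y (x, k), hcy y, ⟨‖y‖ * E, fun x k => ?_⟩, fun x k => ?_⟩
  · refine (hbd y x k).trans ?_
    rw [mul_assoc]
    have := norm_nonneg y
    gcongr
    exact hWE x
  · have : (W x : ℂ) ≠ 0 := by exact_mod_cast (hW0 x).ne'
    show (W x : ℂ) * y (x, k) = _
    rw [show y (x, k) = Op y (x, k) by rw [hfix], hOpv]
    field_simp

end weight

/-- Differentiation of the Volterra integral. -/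
lemma hasDerivAt_volterra {F : ℝ → ℂ} (hF : Integrable fun t : ℝ => ((1 + |t| : ℝ) : ℂ) * F t)
    (k x : ℝ) :
    HasDerivAt (volterra k F)
      (-∫ t in Ioi x, Complex.exp (2 * Complex.I * k * (t - x : ℝ)) * F t) x := by
  have hFm : AEStronglyMeasurable F := by
    have := hF.1.mul (Complex.continuous_ofReal.comp
      continuous_inv_one_add_abs).aestronglyMeasurable
    refine this.congr (Eventually.of_forall fun t => ?_)
    have : ((1 + |t| : ℝ) : ℂ) ≠ 0 := by exact_mod_cast (by positivity : (1 : ℝ) + |t| ≠ 0)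
    simp only [Pi.mul_apply, Function.comp, Complex.ofReal_inv]
    field_simp
  have hF1 : Integrable fun t => (1 + |t|) * ‖F t‖ := by
    refine hF.norm.congr (Eventually.of_forall fun t => ?_)
    have : (0 : ℝ) ≤ 1 + |t| := by positivity
    simp only [norm_mul, Complex.norm_real, Real.norm_eq_abs, abs_of_nonneg this]
  have hF0 : Integrable fun t => ‖F t‖ := by
    refine hF1.mono' hFm.norm (Eventually.of_forall fun t => ?_)
    rw [norm_norm]; nlinarith [abs_nonneg t, norm_nonneg (F t)]
  have hker : ∀ y : ℝ, Continuous fun t : ℝ => volterraKernel k (max (t - y) 0) := fun y =>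
    continuous_volterraKernel.comp (by fun_prop : Continuous fun t : ℝ => (k, max (t - y) 0))
  have e : (-∫ t in Ioi x, Complex.exp (2 * Complex.I * k * (t - x : ℝ)) * F t)
      = ∫ t, (Ioi x).indicator
        (fun t => -(Complex.exp (2 * Complex.I * k * (t - x : ℝ)) * F t)) t := by
    rw [integral_indicator measurableSet_Ioi, integral_neg]
  rw [e]
  refine (hasDerivAt_integral_of_dominated_loc_of_lip (s := univ) (bound := fun t => ‖F t‖)
    univ_mem ?_ ?_ ?_ ?_ hF0 ?_).2
  · exact Eventually.of_forall fun y => (hker y).aestronglyMeasurable.mul hFm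
  · refine (hF1.const_mul (growthWeight x)).mono' ((hker x).aestronglyMeasurable.mul hFm)
      (Eventually.of_forall fun t => ?_)
    rw [norm_mul, ← mul_assoc]
    gcongr
    refine (norm_volterraKernel_le _ _).trans ?_
    rw [abs_of_nonneg (le_max_right _ _)]
    exact max_sub_le t x
  · refine AEStronglyMeasurable.indicator (AEStronglyMeasurable.neg
      (AEStronglyMeasurable.mul ?_ hFm)) measurableSet_Ioi
    exact (by fun_prop : Continuous fun t : ℝ =>
      Complex.exp (2 * Complex.I * k * (t - x : ℝ))).aestronglyMeasurable
  · refine Eventually.of_forall fun t => LipschitzOnWith.of_dist_le_mul fun y _ z _ => ?_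
    rw [dist_eq_norm, ← sub_mul, norm_mul, mul_comm]
    simp only [Real.coe_nnabs, abs_norm]
    gcongr
    refine (norm_volterraKernel_sub_le _ _ _).trans ?_
    rw [Real.dist_eq]
    refine (abs_max_sub_max_le_abs _ _ _).trans (le_of_eq ?_)
    rw [abs_sub_comm]; congr 1; ring
  · have : ∀ᵐ t : ℝ, t ≠ x := by simp [ae_iff, measure_singleton]
    filter_upwards [this] with t ht
    rcases lt_or_gt_of_ne ht with h | h
    · rw [indicator_of_notMem (by simpa using h.le)]
      refine (hasDerivAt_const x (0 : ℂ)).congr_of_eventuallyEq ?_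
      filter_upwards [lt_mem_nhds h] with y hy
      rw [max_eq_right (by linarith)]; simp
    · rw [indicator_of_mem (show t ∈ Ioi x from h)]
      have h1 : HasDerivAt (fun y : ℝ => volterraKernel k (t - y))
          (-Complex.exp (2 * Complex.I * k * (t - x : ℝ))) x := by
        have := (hasDerivAt_volterraKernel k (t - x)).scomp x ((hasDerivAt_id x).const_sub t)
        simpa [Function.comp_def] using this
      have h2 := h1.mul_const (F t)
      rw [neg_mul] at h2
      refine h2.congr_of_eventuallyEq ?_
      filter_upwards [gt_mem_nhds h] with y hy
      rw [max_eq_left (by linarith)]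

lemma norm_volterra_le {F : ℝ → ℂ} (hF : Integrable fun t : ℝ => ((1 + |t| : ℝ) : ℂ) * F t)
    (k x : ℝ) : ‖volterra k F x‖ ≤ growthWeight x * ∫ t in Ioi x, (1 + |t|) * ‖F t‖ := by
  have hF1 : Integrable fun t => (1 + |t|) * ‖F t‖ := by
    refine hF.norm.congr (Eventually.of_forall fun t => ?_)
    have : (0 : ℝ) ≤ 1 + |t| := by positivity
    simp only [norm_mul, Complex.norm_real, Real.norm_eq_abs, abs_of_nonneg this]
  have := norm_integral_le_of_norm_le (f := fun t => volterraKernel k (max (t - x) 0) * F t)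
    (((hF1.const_mul (growthWeight x)).integrableOn (s := Ioi x)).integrable_indicator
      measurableSet_Ioi) (Eventually.of_forall fun t => by
      rcases le_or_gt t x with h | h
      · rw [max_eq_right (by linarith)]; simp [indicator, not_lt.2 h]
      · rw [indicator_of_mem (show t ∈ Ioi x from h), norm_mul, ← mul_assoc]
        gcongr
        refine (norm_volterraKernel_le _ _).trans ?_
        rw [abs_of_nonneg (le_max_right _ _)]
        exact max_sub_le t x)
  refine this.trans (le_of_eq ?_)
  rw [integral_indicator measurableSet_Ioi, integral_const_mul]

lemma tendsto_integral_Ioi_zero {E : Type*} [NormedAddCommGroup E] [NormedSpace ℝ E] {f : ℝ → E}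
    (hf : Integrable f) : Tendsto (fun x => ∫ t in Ioi x, f t) atTop (𝓝 0) := by
  have h := tendsto_setIntegral_of_antitone (s := fun x : ℝ => Ioi x)
    (f := f) (μ := volume) (fun _ => measurableSet_Ioi) (fun a b h => Ioi_subset_Ioi h)
    ⟨0, hf.integrableOn⟩
  have e : ⋂ n : ℝ, Ioi n = ∅ := by
    ext x; simpa using ⟨x, le_rfl⟩
  simpa [e] using h

lemma tendsto_volterra {F : ℝ → ℂ} (hF : Integrable fun t : ℝ => ((1 + |t| : ℝ) : ℂ) * F t)
    (k : ℝ) : Tendsto (volterra k F) atTop (𝓝 0) := by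
  have hF1 : Integrable fun t => (1 + |t|) * ‖F t‖ := by
    refine hF.norm.congr (Eventually.of_forall fun t => ?_)
    have : (0 : ℝ) ≤ 1 + |t| := by positivity
    simp only [norm_mul, Complex.norm_real, Real.norm_eq_abs, abs_of_nonneg this]
  refine squeeze_zero_norm' ?_ (tendsto_integral_Ioi_zero hF1)
  filter_upwards [eventually_ge_atTop 0] with x hx
  refine (norm_volterra_le hF k x).trans (le_of_eq ?_)
  simp [growthWeight, max_eq_right (by linarith : -x ≤ 0)]

/-! ### Existence and uniqueness of the Jost functions -/

lemma norm_wave (x k : ℝ) : ‖wave x k‖ = 1 := by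
  have : Complex.I * k * x = ((k * x : ℝ) : ℂ) * Complex.I := by push_cast; ring
  rw [wave, this, Complex.norm_exp_ofReal_mul_I]

lemma wave_mul_wave (x k l : ℝ) : wave x k * wave x l = wave x (k + l) := by
  simp only [wave, ← Complex.exp_add]; congr 1; push_cast; ring

@[simp] lemma wave_zero_right (x : ℝ) : wave x 0 = 1 := by simp [wave]

@[simp] lemma wave_zero_left (k : ℝ) : wave 0 k = 1 := by simp [wave]

lemma wave_mul_wave_neg (x k : ℝ) : wave x k * wave x (-k) = 1 := by
  rw [wave_mul_wave]; simp

lemma wave_neg_mul_wave (x k : ℝ) : wave x (-k) * wave x k = 1 := by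
  rw [wave_mul_wave]; simp

lemma wave_neg_left (x k : ℝ) : wave (-x) k = wave x (-k) := by
  simp [wave]

lemma conj_wave (x k : ℝ) : (starRingEnd ℂ) (wave x k) = wave x (-k) := by
  simp only [wave, ← Complex.exp_conj, map_mul, Complex.conj_I, Complex.conj_ofReal]
  congr 1; push_cast; ring

lemma exp_two_I_eq_wave (k x : ℝ) :
    Complex.exp (2 * Complex.I * k * x) = wave x k * wave x k := by
  simp only [wave, ← Complex.exp_add]; congr 1; ring

lemma exp_neg_I_eq_wave (k x : ℝ) :
    Complex.exp (-(Complex.I * k * x)) = wave x (-k) := by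
  simp [wave]

lemma continuous_wave : Continuous fun p : ℝ × ℝ => wave p.1 p.2 := by
  unfold wave; fun_prop

@[fun_prop]
lemma Continuous.wave {X : Type*} [TopologicalSpace X] {f g : X → ℝ} (hf : Continuous f)
    (hg : Continuous g) : Continuous fun x => OddResonance.wave (f x) (g x) :=
  continuous_wave.comp (hf.prodMk hg)

lemma hasDerivAt_wave (k x : ℝ) :
    HasDerivAt (fun x => wave x k) (Complex.I * k * wave x k) x := by
  have h := ((Complex.ofRealCLM.hasDerivAt (x := x)).const_mul (Complex.I * k)).cexp
  simp only [Complex.ofRealCLM_apply, Complex.ofReal_one, mul_one] at h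
  exact h.congr_deriv (mul_comm _ _)

lemma hasPrim_wave (k : ℝ) :
    HasPrim (fun x => wave x k) (fun x => Complex.I * k * wave x k) :=
  HasPrim.of_hasDerivAt (hasDerivAt_wave k) (by fun_prop)

/-- The tail integral `-∫_x^∞ F` is an indefinite integral of `F`. -/
lemma hasPrim_neg_tail {F : ℝ → ℂ} (hF : Integrable F) :
    HasPrim (fun x => -∫ t in Ioi x, F t) F := by
  refine ⟨hF.locallyIntegrable, fun x y => ?_⟩
  rw [← intervalIntegral.integral_Ioi_sub_Ioi' hF.integrableOn hF.integrableOn]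
  ring

lemma tendsto_integral_Ioi_atBot {E : Type*} [NormedAddCommGroup E] [NormedSpace ℝ E] {f : ℝ → E}
    (hf : Integrable f) : Tendsto (fun x => ∫ t in Ioi x, f t) atBot (𝓝 (∫ t, f t)) := by
  have h : AECover volume atBot fun x : ℝ => Ioi x := aecover_Ioi tendsto_id
  exact h.integral_tendsto_of_countably_generated hf

lemma integrable_mul_of_moment {V : ℝ → ℝ} (hV : Integrable fun t => (1 + |t|) ^ 2 * V t) :
    Integrable fun t => (1 + |t|) * V t := by
  have hm : AEStronglyMeasurable (fun t => (1 + |t|) * V t) := by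
    refine (hV.1.mul continuous_inv_one_add_abs.aestronglyMeasurable).congr
      (Eventually.of_forall fun t => ?_)
    have : (1 : ℝ) + |t| ≠ 0 := by positivity
    simp only [Pi.mul_apply]; field_simp
  refine hV.norm.mono' hm (Eventually.of_forall fun t => ?_)
  rw [norm_mul, norm_mul, norm_pow]
  have : (1 : ℝ) ≤ ‖1 + |t|‖ := by
    rw [Real.norm_eq_abs, abs_of_nonneg (by positivity)]; linarith [abs_nonneg t]
  gcongr
  nlinarith

/-- A product `V Y` with `Y = O(1 + |t|)` retains one moment of `V`. -/
lemma integrable_moment_mul {V : ℝ → ℝ} (hV : Integrable fun t => (1 + |t|) ^ 2 * V t)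
    {Y : ℝ → ℂ} (hY : AEStronglyMeasurable Y) {C : ℝ} (hC : ∀ t, ‖Y t‖ ≤ C * (1 + |t|)) :
    Integrable fun t : ℝ => ((1 + |t| : ℝ) : ℂ) * (V t * Y t) := by
  have hm := aestronglyMeasurable_of_moment (integrable_mul_of_moment hV)
  refine (hV.norm.const_mul C).mono' ?_ (Eventually.of_forall fun t => ?_)
  · exact (by fun_prop : Continuous fun t : ℝ => ((1 + |t| : ℝ) : ℂ)).aestronglyMeasurable.mul
      ((Complex.continuous_ofReal.comp_aestronglyMeasurable hm).mul hY)
  · have h0 : (0 : ℝ) ≤ 1 + |t| := by positivity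
    simp only [norm_mul, Complex.norm_real, Real.norm_eq_abs, abs_of_nonneg h0, norm_pow]
    calc _ ≤ (1 + |t|) * (|V t| * (C * (1 + |t|))) := by gcongr; exact hC t
      _ = _ := by ring

lemma integrable_of_integrable_moment {F : ℝ → ℂ}
    (hF : Integrable fun t : ℝ => ((1 + |t| : ℝ) : ℂ) * F t) : Integrable F := by
  have hm : AEStronglyMeasurable F := by
    refine (hF.1.mul (Complex.continuous_ofReal.comp
      continuous_inv_one_add_abs).aestronglyMeasurable).congr (Eventually.of_forall fun t => ?_)
    have : ((1 + |t| : ℝ) : ℂ) ≠ 0 := by exact_mod_cast (by positivity : (1 : ℝ) + |t| ≠ 0)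
    simp only [Pi.mul_apply, Function.comp, Complex.ofReal_inv]
    field_simp
  refine hF.norm.mono' hm (Eventually.of_forall fun t => ?_)
  have h0 : (0 : ℝ) ≤ 1 + |t| := by positivity
  rw [norm_mul, Complex.norm_real, Real.norm_eq_abs, abs_of_nonneg h0]
  nlinarith [abs_nonneg t, norm_nonneg (F t)]

lemma integrable_wave_mul {F : ℝ → ℂ} (hF : Integrable F) (k : ℝ) :
    Integrable fun t => wave t k * F t := by
  refine hF.norm.mono' ((by fun_prop : Continuous fun t => wave t k).aestronglyMeasurable.mul hF.1)
    (Eventually.of_forall fun t => ?_)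
  rw [norm_mul, norm_wave, one_mul]

/-- `q(x) = -∫_x^∞ exp (2ikt) V m`, which is `exp (ikx) (ψ' - ikψ)` for the Jost function. -/
def jostTail (V : ℝ → ℝ) (m : ℝ → ℂ) (k x : ℝ) : ℂ :=
  -∫ t in Ioi x, wave t (2 * k) * (V t * m t)

lemma wave_two_mul (x k : ℝ) : wave x (2 * k) = wave x k * wave x k := by
  rw [wave_mul_wave]; congr 1; ring

/-- A bounded solution of the Volterra equation gives a Jost function, whose derivative is
`ikψ + exp (-ikx) q`. -/
lemma isJostPlus_of_volterra {V : ℝ → ℝ} (hV : Integrable fun t => (1 + |t|) ^ 2 * V t) {k : ℝ}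
    {m : ℝ → ℂ} (hm : Continuous m) {C : ℝ} (hC : ∀ x, ‖m x‖ ≤ C * growthWeight x)
    (hvol : ∀ x, m x = 1 + volterra k (fun t => V t * m t) x) :
    IsJostPlus V k (fun x => wave x k * m x) ∧
    ∀ x, HasDerivAt (fun x => wave x k * m x)
      (Complex.I * k * (wave x k * m x) + wave x (-k) * jostTail V m k x) x := by
  have hC0 : 0 ≤ C := by
    have := (norm_nonneg _).trans (hC 0)
    nlinarith [one_le_growthWeight 0]
  have hF : Integrable fun t : ℝ => ((1 + |t| : ℝ) : ℂ) * (V t * m t) :=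
    integrable_moment_mul hV hm.aestronglyMeasurable (C := C) fun t => (hC t).trans (by
      gcongr; exact growthWeight_le t)
  have hF0 := integrable_of_integrable_moment hF
  have hFw := integrable_wave_mul hF0 (2 * k)
  have hdm : ∀ x, HasDerivAt m (wave x (-(2 * k)) * jostTail V m k x) x := by
    intro x
    have h := (hasDerivAt_volterra hF k x).const_add 1
    have e : (fun x => 1 + volterra k (fun t => V t * m t) x) = m := funext fun x => (hvol x).symm
    rw [e] at h
    refine h.congr_deriv ?_
    unfold jostTail
    rw [mul_neg, ← integral_const_mul]
    congr 1
    refine integral_congr_ae (Eventually.of_forall fun t => ?_)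
    simp only [wave, ← mul_assoc, ← Complex.exp_add]
    congr 3; push_cast; ring
  have hd : ∀ x, HasDerivAt (fun x => wave x k * m x)
      (Complex.I * k * (wave x k * m x) + wave x (-k) * jostTail V m k x) x := by
    intro x
    refine ((hasDerivAt_wave k x).mul (hdm x)).congr_deriv ?_
    rw [← mul_assoc (wave x k), wave_mul_wave, ← mul_assoc]
    congr 3; ring
  refine ⟨⟨?_, ?_⟩, hd⟩
  · refine HasPrim.isSolution hd ?_
    have hq : HasPrim (jostTail V m k) (fun t => wave t (2 * k) * (V t * m t)) :=
      hasPrim_neg_tail hFw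
    have hc : Continuous fun x => Complex.I * k * (wave x k * m x)
        + wave x (-k) * jostTail V m k x := by
      have := hq.continuous
      fun_prop
    refine (((HasPrim.of_hasDerivAt hd hc).const_mul (Complex.I * k)).add
      ((hasPrim_wave (-k)).mul hq)).congr fun x => ?_
    have h1 := wave_neg_mul_wave x k
    rw [wave_two_mul]
    push_cast
    linear_combination (↑(V x) * m x * wave x k) * h1 + k ^ 2 * (wave x k * m x) * Complex.I_sq
  · have h1 := (tendsto_volterra hF k).const_add 1
    rw [add_zero] at h1
    refine h1.congr fun x => ?_
    rw [exp_neg_I_eq_wave, ← mul_assoc, wave_neg_mul_wave, one_mul, ← hvol]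

/-- A solution with `exp (-ikx) u → 0` at `+∞` vanishes identically. -/
lemma eq_zero_of_tendsto {V : ℝ → ℝ} (hV : Integrable fun t => (1 + |t|) ^ 2 * V t) {k : ℝ}
    {u : ℝ → ℂ} (hu : IsSolution V k u)
    (hlim : Tendsto (fun x => wave x (-k) * u x) atTop (𝓝 0)) (x : ℝ) : u x = 0 := by
  have hV1 := integrable_mul_of_moment hV
  have hVm := aestronglyMeasurable_of_moment hV1
  have hVl : LocallyIntegrable V := by
    refine (hV1.norm.mono' hVm (Eventually.of_forall fun t => ?_)).locallyIntegrable
    rw [norm_mul, Real.norm_eq_abs (1 + |t|), abs_of_nonneg (by positivity)]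
    nlinarith [abs_nonneg t, norm_nonneg (V t)]
  obtain ⟨P1, P0⟩ := hu.hasPrim hVl
  set h : ℝ → ℂ := fun x => wave x (-k) * u x with hh
  have hhc : Continuous h := by have := P0.continuous; fun_prop
  have hux : ∀ x, u x = wave x k * h x := fun x => by
    rw [hh]; simp only; rw [← mul_assoc, wave_mul_wave_neg, one_mul]
  suffices H : ∀ x₀ x, x₀ < x → h x = 0 by
    rw [hux, H (x - 1) x (by linarith), mul_zero]
  intro x₀
  -- `h` is bounded to the right of `x₀`
  obtain ⟨M, hM0, hM⟩ : ∃ M, 0 ≤ M ∧ ∀ x, x₀ < x → ‖h x‖ ≤ M := by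
    have h1 : ∀ᶠ x in atTop, ‖h x‖ < 1 := by
      have := hlim.norm
      rw [norm_zero] at this
      exact this.eventually (gt_mem_nhds one_pos)
    obtain ⟨X, hX⟩ := eventually_atTop.1 h1
    obtain ⟨B, hB⟩ := (isCompact_Icc (a := x₀) (b := X)).exists_bound_of_continuousOn
      hhc.continuousOn
    refine ⟨max B 1, by positivity, fun x hx => ?_⟩
    rcases le_total X x with h2 | h2
    · exact (hX x h2).le.trans (le_max_right _ _)
    · exact (hB x ⟨hx.le, h2⟩).trans (le_max_left _ _)
  set Y : ℝ → ℂ := (Ioi x₀).indicator h with hY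
  have hYM : ∀ t, ‖Y t‖ ≤ M := by
    intro t
    by_cases ht : t ∈ Ioi x₀
    · rw [hY, indicator_of_mem ht]; exact hM t ht
    · rw [hY, indicator_of_notMem ht, norm_zero]; exact hM0
  have hF : Integrable fun t : ℝ => ((1 + |t| : ℝ) : ℂ) * (V t * Y t) :=
    integrable_moment_mul hV (hhc.aestronglyMeasurable.indicator measurableSet_Ioi) (C := M)
      fun t => (hYM t).trans (by nlinarith [abs_nonneg t])
  have hFw := integrable_wave_mul (integrable_of_integrable_moment hF) (2 * k)
  set g : ℝ → ℂ := fun x => wave x k * (deriv u x - Complex.I * k * u x) with hg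
  have Pg : HasPrim g (fun t => wave t k * (V t * u t)) := by
    refine ((hasPrim_wave k).mul (P1.sub (P0.const_mul (Complex.I * k)))).congr fun x => ?_
    push_cast
    linear_combination (-(wave x k * u x * k ^ 2)) * Complex.I_sq
  set Q : ℝ → ℂ := fun x => -∫ t in Ioi x, wave t (2 * k) * (V t * Y t) with hQ
  have PQ : HasPrim Q (fun t => wave t (2 * k) * (V t * Y t)) := hasPrim_neg_tail hFw
  -- `g` and the tail integral differ by a constant `c`
  set c : ℂ := g x₀ - Q x₀ with hc
  have hgQ : ∀ x, x₀ < x → g x = Q x + c := by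
    intro x hx
    have h1 := Pg.eq x₀ x
    have h2 := PQ.eq x₀ x
    have h3 : ∫ t in x₀..x, wave t k * (V t * u t)
        = ∫ t in x₀..x, wave t (2 * k) * (V t * Y t) := by
      refine intervalIntegral.integral_congr_ae (Eventually.of_forall fun t ht => ?_)
      rw [uIoc_of_le hx.le] at ht
      rw [hY, indicator_of_mem (show t ∈ Ioi x₀ from ht.1), hux t, wave_two_mul]
      ring
    rw [hc]
    linear_combination h1 - h2 + h3
  have hdh : ∀ x, HasDerivAt h (wave x (-(2 * k)) * g x) x := by
    intro x
    refine ((hasDerivAt_wave (-k) x).mul (hu.1 x).hasDerivAt).congr_deriv ?_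
    rw [hg]
    simp only
    rw [← mul_assoc, wave_mul_wave, show -(2 * k) + k = -k by ring]
    push_cast; ring
  have hdv : ∀ x, HasDerivAt (volterra k fun t => V t * Y t) (wave x (-(2 * k)) * Q x) x := by
    intro x
    refine (hasDerivAt_volterra hF k x).congr_deriv ?_
    rw [hQ]
    simp only
    rw [mul_neg, ← integral_const_mul]
    congr 1
    refine integral_congr_ae (Eventually.of_forall fun t => ?_)
    simp only [wave, ← mul_assoc, ← Complex.exp_add]
    congr 3; push_cast; ring
  have hdD : ∀ x, HasDerivAt (fun x => c * volterraKernel (-k) x) (wave x (-(2 * k)) * c) x := by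
    intro x
    refine ((hasDerivAt_volterraKernel (-k) x).const_mul c).congr_deriv ?_
    rw [mul_comm, wave]; congr 2; push_cast; ring
  set J : ℝ → ℂ := fun x => h x - volterra k (fun t => V t * Y t) x with hJ
  have hJlim : Tendsto J atTop (𝓝 0) := by
    simpa using hlim.sub (tendsto_volterra hF k)
  have hconst : ∀ x, x₀ < x → ∀ y, x₀ < y →
      J x - c * volterraKernel (-k) x = J y - c * volterraKernel (-k) y := by
    have hd : ∀ x ∈ Ioi x₀, HasDerivAt (fun x => J x - c * volterraKernel (-k) x) 0 x := by
      intro x hx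
      refine (((hdh x).sub (hdv x)).sub (hdD x)).congr_deriv ?_
      rw [hgQ x hx]; ring
    intro x hx y hy
    exact (isOpen_Ioi).is_const_of_deriv_eq_zero (isPreconnected_Ioi)
      (fun z hz => (hd z hz).differentiableAt.differentiableWithinAt)
      (fun z hz => (hd z hz).deriv) hx hy
  -- `J - c ∫₀ˣ exp (-2iks) ds` is constant and `J → 0`; comparing the values at `x + d` and `x`
  -- gives `c ∫₀ᵈ exp (-2iks) ds = 0` for all `d`, also at `k = 0`
  have hc0 : c = 0 := by
    have hz : ∀ d : ℝ, c * volterraKernel (-k) d = 0 := by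
      intro d
      have h1 : Tendsto (fun x => ‖J (x + d) - J x‖) atTop (𝓝 0) := by
        have := ((hJlim.comp (tendsto_atTop_add_const_right atTop d tendsto_id)).sub hJlim).norm
        simpa using this
      have h2 : ∀ᶠ x in atTop, ‖J (x + d) - J x‖ = ‖c * volterraKernel (-k) d‖ := by
        filter_upwards [eventually_gt_atTop x₀, eventually_gt_atTop (x₀ - d)] with x hx hx'
        have h3 := hconst (x + d) (by linarith) x hx
        have hc : Continuous fun s : ℝ => Complex.exp (2 * Complex.I * (-k : ℝ) * s) := by fun_prop
        have h4 : volterraKernel (-k) (x + d) - volterraKernel (-k) x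
            = wave x (-(2 * k)) * volterraKernel (-k) d := by
          unfold volterraKernel
          rw [intervalIntegral.integral_interval_sub_left (hc.intervalIntegrable _ _)
            (hc.intervalIntegrable _ _), ← intervalIntegral.integral_const_mul]
          have := intervalIntegral.integral_comp_add_right (a := 0) (b := d)
            (fun s : ℝ => Complex.exp (2 * Complex.I * (-k : ℝ) * s)) x
          rw [zero_add, add_comm d x] at this
          rw [← this]
          refine intervalIntegral.integral_congr fun s _ => ?_
          simp only [wave, ← Complex.exp_add]
          congr 1; push_cast; ring
        have h5 : J (x + d) - J x = c * (wave x (-(2 * k)) * volterraKernel (-k) d) := by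
          rw [← h4]; linear_combination h3
        rw [h5, norm_mul, norm_mul, norm_wave, one_mul, norm_mul]
      have h6 := tendsto_nhds_unique (h1.congr' h2) tendsto_const_nhds
      exact norm_eq_zero.1 h6.symm
    have h7 := hdD 0
    rw [funext hz, wave_zero_left, one_mul] at h7
    exact (h7.unique (hasDerivAt_const _ _))
  have hJ0 : ∀ x, x₀ < x → J x = 0 := by
    intro x hx
    have h1 : ∀ᶠ y in atTop, J y = J x := by
      filter_upwards [eventually_gt_atTop x₀] with y hy
      have := hconst y hy x hx
      simpa [hc0] using this
    exact (tendsto_nhds_unique (hJlim.congr' h1) tendsto_const_nhds).symm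
  -- the Volterra operator halves the weighted norm, hence `h` vanishes
  have hiter : ∀ n : ℕ, ∀ x, x₀ < x → ‖h x‖ ≤ M / 2 ^ n * volterraWeight V x := by
    intro n
    induction n with
    | zero =>
      intro x hx
      rw [pow_zero, div_one]
      have h1 := (one_le_growthWeight x).trans (growthWeight_le_volterraWeight (V := V) x)
      refine (hM x hx).trans ?_
      nlinarith
    | succ n ih =>
      intro x hx
      have h1 := sub_eq_zero.1 (hJ0 x hx)
      rw [h1]
      refine (norm_volterra_le_weight hV1 (M := M / 2 ^ n) (by positivity) k x
        fun t ht => ?_).trans (le_of_eq ?_)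
      · rw [norm_mul, Complex.norm_real, Real.norm_eq_abs, hY,
          indicator_of_mem (show t ∈ Ioi x₀ from hx.trans ht)]
        calc _ ≤ |V t| * (M / 2 ^ n * volterraWeight V t) := by
              gcongr; exact ih t (hx.trans ht)
          _ = _ := by ring
      · rw [pow_succ]; ring
  intro x hx
  have h1 : Tendsto (fun n : ℕ => M / 2 ^ n * volterraWeight V x) atTop (𝓝 0) := by
    have h2 : Tendsto (fun n : ℕ => (1 / 2 : ℝ) ^ n) atTop (𝓝 0) :=
      tendsto_pow_atTop_nhds_zero_of_lt_one (by norm_num) (by norm_num)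
    have := (h2.const_mul M).mul_const (volterraWeight V x)
    simp only [mul_zero, zero_mul] at this
    refine this.congr fun n => ?_
    rw [one_div, inv_pow]; ring
  exact norm_le_zero_iff.1 (ge_of_tendsto' h1 fun n => hiter n x hx)

lemma IsSolution.sub {V : ℝ → ℝ} (hV : LocallyIntegrable V) {k : ℝ} {u v : ℝ → ℂ}
    (hu : IsSolution V k u) (hv : IsSolution V k v) : IsSolution V k (fun x => u x - v x) := by
  obtain ⟨u1, u0⟩ := hu.hasPrim hV
  obtain ⟨v1, v0⟩ := hv.hasPrim hV
  refine HasPrim.isSolution (fun x => (hu.1 x).hasDerivAt.sub (hv.1 x).hasDerivAt)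
    ((u1.sub v1).congr fun x => ?_)
  ring

lemma locallyIntegrable_of_moment {V : ℝ → ℝ} (hV : Integrable fun t => (1 + |t|) * V t) :
    LocallyIntegrable V := by
  refine (hV.norm.mono' (aestronglyMeasurable_of_moment hV)
    (Eventually.of_forall fun t => ?_)).locallyIntegrable
  rw [norm_mul, Real.norm_eq_abs (1 + |t|), abs_of_nonneg (by positivity)]
  nlinarith [abs_nonneg t, norm_nonneg (V t)]

/-- The difference of two Jost solutions is a solution with `exp (-ikx) u → 0`. -/
lemma IsJostPlus.unique {V : ℝ → ℝ} (hV : Integrable fun t => (1 + |t|) ^ 2 * V t) {k : ℝ}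
    {u v : ℝ → ℂ} (hu : IsJostPlus V k u) (hv : IsJostPlus V k v) :
    u = v := by
  funext x
  have hVl := locallyIntegrable_of_moment (integrable_mul_of_moment hV)
  refine sub_eq_zero.1 (eq_zero_of_tendsto hV (hu.1.sub hVl hv.1) ?_ x)
  have := hu.2.sub hv.2
  rw [sub_self] at this
  refine this.congr fun x => ?_
  rw [exp_neg_I_eq_wave]; ring

/-- The Jost function `m₊` is jointly continuous, grows at most linearly at `-∞`, uniformly in
`k`, and solves the Volterra equation; `ψ₊` is the Jost solution. -/
lemma mPlus_spec {V : ℝ → ℝ} (hV : Integrable fun t => (1 + |t|) ^ 2 * V t) :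
    Continuous (Function.uncurry (mPlus V)) ∧
    (∃ C, ∀ x k, ‖mPlus V x k‖ ≤ C * growthWeight x) ∧
    (∀ x k, mPlus V x k = 1 + volterra k (fun t => V t * mPlus V t k) x) ∧
    ∀ k, IsJostPlus V k (fun x => psiPlus V x k) := by
  obtain ⟨m, hmc, ⟨C, hC⟩, hvol⟩ := exists_volterra_solution (integrable_mul_of_moment hV)
  have hJ : ∀ k, IsJostPlus V k (fun x => wave x k * m x k) := fun k =>
    (isJostPlus_of_volterra hV (m := fun x => m x k)
      (hmc.comp (by fun_prop : Continuous fun x : ℝ => (x, k)))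
      (fun x => hC x k) (fun x => hvol x k)).1
  have hpsi : ∀ k, IsJostPlus V k (fun x => psiPlus V x k) := fun k =>
    Classical.epsilon_spec (p := IsJostPlus V k) ⟨_, hJ k⟩
  have e : mPlus V = m := by
    funext x k
    have := congrFun (IsJostPlus.unique hV (hpsi k) (hJ k)) x
    rw [mPlus, exp_neg_I_eq_wave, show psiPlus V x k = _ from this, ← mul_assoc,
      wave_neg_mul_wave, one_mul]
  rw [e]
  exact ⟨hmc, ⟨C, hC⟩, hvol, hpsi⟩

/-! ### Reflection of the line -/

/-- The reflected potential `x ↦ V (-x)`, which exchanges the two Jost functions. -/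
def mirror (V : ℝ → ℝ) (x : ℝ) : ℝ := V (-x)

@[simp] lemma mirror_mirror (V : ℝ → ℝ) : mirror (mirror V) = V := by
  funext x; simp [mirror]

lemma integrable_moment_mirror {V : ℝ → ℝ} (hV : Integrable fun t => (1 + |t|) ^ 2 * V t) :
    Integrable fun t => (1 + |t|) ^ 2 * mirror V t := by
  simpa [mirror] using hV.comp_neg

lemma IsSolution.mirror {V : ℝ → ℝ} {k : ℝ} {ψ : ℝ → ℂ} (h : IsSolution V k ψ) :
    IsSolution (mirror V) k (fun x => ψ (-x)) := by
  have hd : ∀ x, HasDerivAt (fun x => ψ (-x)) (-deriv ψ (-x)) x := fun x => by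
    simpa [Function.comp_def] using (h.1 (-x)).hasDerivAt.scomp x (hasDerivAt_neg x)
  refine ⟨fun x => (hd x).differentiableAt, fun x y => ?_⟩
  have e : deriv (fun x => ψ (-x)) = fun x => -deriv ψ (-x) := funext fun x => (hd x).deriv
  have h1 := intervalIntegral.integral_comp_neg (a := x) (b := y)
    (fun t => ((V t - k ^ 2 : ℝ) : ℂ) * ψ t)
  rw [e]
  simp only [OddResonance.mirror] at h1 ⊢
  rw [h1, ← h.2]; ring

lemma isJostMinus_iff {V : ℝ → ℝ} {k : ℝ} {ψ : ℝ → ℂ} :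
    IsJostMinus V k ψ ↔ IsJostPlus (mirror V) k (fun x => ψ (-x)) := by
  constructor
  · rintro ⟨h1, h2⟩
    refine ⟨h1.mirror, ?_⟩
    refine (h2.comp tendsto_neg_atTop_atBot).congr fun x => ?_
    simp
  · rintro ⟨h1, h2⟩
    refine ⟨by simpa using h1.mirror, ?_⟩
    refine (h2.comp tendsto_neg_atBot_atTop).congr fun x => ?_
    simp

lemma isJostMinus_psiMinus {V : ℝ → ℝ} (hV : Integrable fun t => (1 + |t|) ^ 2 * V t) (k : ℝ) :
    IsJostMinus V k (fun x => psiMinus V x k) := by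
  refine Classical.epsilon_spec (p := IsJostMinus V k)
    ⟨fun x => psiPlus (mirror V) (-x) k, isJostMinus_iff.2 ?_⟩
  simpa using (mPlus_spec (integrable_moment_mirror hV)).2.2.2 k

lemma psiMinus_eq_mirror {V : ℝ → ℝ} (hV : Integrable fun t => (1 + |t|) ^ 2 * V t) (x k : ℝ) :
    psiMinus V x k = psiPlus (mirror V) (-x) k := by
  have h1 := isJostMinus_iff.1 (isJostMinus_psiMinus hV k)
  have h2 := (mPlus_spec (integrable_moment_mirror hV)).2.2.2 k
  simpa using congrFun (IsJostPlus.unique (integrable_moment_mirror hV) h1 h2) (-x)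

lemma mMinus_eq_mirror {V : ℝ → ℝ} (hV : Integrable fun t => (1 + |t|) ^ 2 * V t) (x k : ℝ) :
    mMinus V x k = mPlus (mirror V) (-x) k := by
  rw [mMinus, mPlus, psiMinus_eq_mirror hV]; simp

/-! ### Scattering relations -/

lemma psiPlus_eq_wave_mul (V : ℝ → ℝ) (x k : ℝ) : psiPlus V x k = wave x k * mPlus V x k := by
  rw [mPlus, exp_neg_I_eq_wave, ← mul_assoc, wave_mul_wave_neg, one_mul]

/-- The tail `q` of the Jost function `ψ₊`, see `jostTail`. -/
def tailPlus (V : ℝ → ℝ) (k x : ℝ) : ℂ := jostTail V (fun t => mPlus V t k) k x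

section spec

variable {V : ℝ → ℝ}

lemma continuous_mPlus (hV : Integrable fun t => (1 + |t|) ^ 2 * V t) (k : ℝ) :
    Continuous fun x => mPlus V x k :=
  (mPlus_spec hV).1.comp (by fun_prop : Continuous fun x : ℝ => (x, k))

lemma exists_bound_mPlus (hV : Integrable fun t => (1 + |t|) ^ 2 * V t) :
    ∃ C, 0 ≤ C ∧ ∀ x k, ‖mPlus V x k‖ ≤ C * growthWeight x := by
  obtain ⟨C, hC⟩ := (mPlus_spec hV).2.1
  refine ⟨C, ?_, hC⟩
  have := (norm_nonneg _).trans (hC 0 0)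
  nlinarith [one_le_growthWeight 0]

lemma integrable_moment_V_mul_mPlus (hV : Integrable fun t => (1 + |t|) ^ 2 * V t) (k : ℝ) :
    Integrable fun t => ((1 + |t| : ℝ) : ℂ) * (V t * mPlus V t k) := by
  obtain ⟨C, hC0, hC⟩ := exists_bound_mPlus hV
  exact integrable_moment_mul hV (continuous_mPlus hV k).aestronglyMeasurable fun t =>
    (hC t k).trans (by gcongr; exact growthWeight_le t)

lemma integrable_V_mul_mPlus (hV : Integrable fun t => (1 + |t|) ^ 2 * V t) (k : ℝ) :
    Integrable fun t => (V t : ℂ) * mPlus V t k :=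
  integrable_of_integrable_moment (integrable_moment_V_mul_mPlus hV k)

lemma hasDerivAt_psiPlus (hV : Integrable fun t => (1 + |t|) ^ 2 * V t) (x k : ℝ) :
    HasDerivAt (fun x => psiPlus V x k)
      (Complex.I * k * psiPlus V x k + wave x (-k) * tailPlus V k x) x := by
  obtain ⟨C, -, hC⟩ := exists_bound_mPlus hV
  have h := (isJostPlus_of_volterra hV (continuous_mPlus hV k) (fun x => hC x k)
    (fun x => (mPlus_spec hV).2.2.1 x k)).2 x
  simp only [← psiPlus_eq_wave_mul] at h
  exact h

lemma isSolution_psiPlus (hV : Integrable fun t => (1 + |t|) ^ 2 * V t) (k : ℝ) :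
    IsSolution V k (fun x => psiPlus V x k) := ((mPlus_spec hV).2.2.2 k).1

lemma isSolution_psiMinus (hV : Integrable fun t => (1 + |t|) ^ 2 * V t) (k : ℝ) :
    IsSolution V k (fun x => psiMinus V x k) := (isJostMinus_psiMinus hV k).1

lemma hasPrim_tailPlus (hV : Integrable fun t => (1 + |t|) ^ 2 * V t) (k : ℝ) :
    HasPrim (tailPlus V k) (fun t => wave t (2 * k) * (V t * mPlus V t k)) :=
  hasPrim_neg_tail (integrable_wave_mul (integrable_V_mul_mPlus hV k) _)

lemma tendsto_tailPlus_atTop (hV : Integrable fun t => (1 + |t|) ^ 2 * V t) (k : ℝ) :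
    Tendsto (tailPlus V k) atTop (𝓝 0) := by
  have h := (tendsto_integral_Ioi_zero
    (integrable_wave_mul (integrable_V_mul_mPlus hV k) (2 * k))).neg
  rw [neg_zero] at h
  exact h

lemma tendsto_tailPlus_atBot (hV : Integrable fun t => (1 + |t|) ^ 2 * V t) (k : ℝ) :
    Tendsto (tailPlus V k) atBot (𝓝 (-∫ t, wave t (2 * k) * (V t * mPlus V t k))) :=
  (tendsto_integral_Ioi_atBot
    (integrable_wave_mul (integrable_V_mul_mPlus hV k) (2 * k))).neg

lemma tendsto_mPlus (hV : Integrable fun t => (1 + |t|) ^ 2 * V t) (k : ℝ) :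
    Tendsto (fun x => mPlus V x k) atTop (𝓝 1) :=
  ((mPlus_spec hV).2.2.2 k).2

lemma hasDerivAt_psiMinus (hV : Integrable fun t => (1 + |t|) ^ 2 * V t) (x k : ℝ) :
    HasDerivAt (fun x => psiMinus V x k)
      (-(Complex.I * k * psiMinus V x k) - wave x k * tailPlus (mirror V) k (-x)) x := by
  have e : (fun x => psiMinus V x k) = fun x => psiPlus (mirror V) (-x) k :=
    funext fun x => psiMinus_eq_mirror hV x k
  have h := (hasDerivAt_psiPlus (integrable_moment_mirror hV) (-x) k).scomp x (hasDerivAt_neg x)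
  rw [psiMinus_eq_mirror hV, e]
  refine (by simpa [Function.comp_def] using h : HasDerivAt _ _ x).congr_deriv ?_
  rw [wave_neg_left, neg_neg]
  ring

lemma psiMinus_eq_wave_mul (hV : Integrable fun t => (1 + |t|) ^ 2 * V t) (x k : ℝ) :
    psiMinus V x k = wave x (-k) * mPlus (mirror V) (-x) k := by
  rw [psiMinus_eq_mirror hV, psiPlus_eq_wave_mul, wave_neg_left]

lemma tendsto_wave_mul_zero {l : Filter ℝ} {f : ℝ → ℂ} (hf : Tendsto f l (𝓝 0)) (k : ℝ) :
    Tendsto (fun x => wave x k * f x) l (𝓝 0) := by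
  refine squeeze_zero_norm (fun x => ?_) (by simpa using hf.norm)
  rw [norm_mul, norm_wave, one_mul]

/-- The coefficient `α = 1 / T` of `exp (ikx)` in the expansion of `ψ₊` at `-∞`. -/
def jostAlpha (V : ℝ → ℝ) (k : ℝ) : ℂ :=
  1 - (2 * Complex.I * k)⁻¹ * ∫ x : ℝ, (V x : ℂ) * mPlus V x k

/-- The coefficient `β = R₋ / T` of `exp (-ikx)` in the expansion of `ψ₊` at `-∞`. -/
def jostBeta (V : ℝ → ℝ) (k : ℝ) : ℂ :=
  (2 * Complex.I * k)⁻¹ * ∫ x : ℝ, wave x (2 * k) * (V x * mPlus V x k)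

lemma two_I_mul_ne_zero {k : ℝ} (hk : k ≠ 0) : 2 * Complex.I * (k : ℂ) ≠ 0 := by
  simp [hk, Complex.I_ne_zero]

/-- The amplitude of `exp (ikx)` in `ψ₊`. -/
def ampA (V : ℝ → ℝ) (k x : ℝ) : ℂ :=
  mPlus V x k + (2 * Complex.I * k)⁻¹ * (wave x (-(2 * k)) * tailPlus V k x)

/-- The amplitude of `exp (-ikx)` in `ψ₊`. -/
def ampB (V : ℝ → ℝ) (k x : ℝ) : ℂ := -((2 * Complex.I * k)⁻¹ * tailPlus V k x)

lemma psiPlus_eq_amp (V : ℝ → ℝ) (x k : ℝ) :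
    psiPlus V x k = ampA V k x * wave x k + ampB V k x * wave x (-k) := by
  rw [psiPlus_eq_wave_mul, ampA, ampB]
  have : wave x (-(2 * k)) * wave x k = wave x (-k) := by
    rw [wave_mul_wave]; congr 1; ring
  linear_combination (-(2 * Complex.I * k)⁻¹ * tailPlus V k x) * this

lemma deriv_psiPlus_eq_amp (hV : Integrable fun t => (1 + |t|) ^ 2 * V t) {k : ℝ} (hk : k ≠ 0)
    (x : ℝ) : deriv (fun x => psiPlus V x k) x
      = Complex.I * k * (ampA V k x * wave x k - ampB V k x * wave x (-k)) := by
  rw [(hasDerivAt_psiPlus hV x k).deriv, psiPlus_eq_amp]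
  have h : (2 * Complex.I * k) * (2 * Complex.I * k)⁻¹ = 1 := mul_inv_cancel₀ (two_I_mul_ne_zero hk)
  rw [show ampB V k x = -((2 * Complex.I * k)⁻¹ * tailPlus V k x) from rfl]
  linear_combination (-(wave x (-k) * tailPlus V k x)) * h

lemma tendsto_ampA_atTop (hV : Integrable fun t => (1 + |t|) ^ 2 * V t) (k : ℝ) :
    Tendsto (ampA V k) atTop (𝓝 1) := by
  have := (tendsto_mPlus hV k).add
    ((tendsto_wave_mul_zero (tendsto_tailPlus_atTop hV k) (-(2 * k))).const_mul
      (2 * Complex.I * k)⁻¹)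
  rw [mul_zero, add_zero] at this
  exact this

lemma tendsto_ampB_atTop (hV : Integrable fun t => (1 + |t|) ^ 2 * V t) (k : ℝ) :
    Tendsto (ampB V k) atTop (𝓝 0) := by
  have h := ((tendsto_tailPlus_atTop hV k).const_mul (2 * Complex.I * k)⁻¹).neg
  rw [mul_zero, neg_zero] at h
  exact h

lemma tendsto_ampB_atBot (hV : Integrable fun t => (1 + |t|) ^ 2 * V t) (k : ℝ) :
    Tendsto (ampB V k) atBot (𝓝 (jostBeta V k)) := by
  have h := ((tendsto_tailPlus_atBot hV k).const_mul (2 * Complex.I * k)⁻¹).neg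
  rw [mul_neg, neg_neg] at h
  exact h

/-- By variation of constants, the amplitude `ampA` is an indefinite integral of `(2ik)⁻¹ V m₊`. -/
lemma tendsto_ampA_atBot (hV : Integrable fun t => (1 + |t|) ^ 2 * V t) {k : ℝ} (hk : k ≠ 0) :
    Tendsto (ampA V k) atBot (𝓝 (jostAlpha V k)) := by
  have hVl := locallyIntegrable_of_moment (integrable_mul_of_moment hV)
  obtain ⟨P1, P0⟩ := (isSolution_psiPlus hV k).hasPrim hVl
  have hk2 : (2 * Complex.I * k) * (2 * Complex.I * k)⁻¹ = 1 :=
    mul_inv_cancel₀ (two_I_mul_ne_zero hk)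
  -- variation of constants
  have hA : ∀ x, ampA V k x = (2 * Complex.I * k)⁻¹ * (wave x (-k) *
      (deriv (fun x => psiPlus V x k) x + Complex.I * k * psiPlus V x k)) := by
    intro x
    rw [deriv_psiPlus_eq_amp hV hk, psiPlus_eq_amp]
    linear_combination (-ampA V k x) * hk2 -
      (2 * Complex.I * k) * (2 * Complex.I * k)⁻¹ * ampA V k x * wave_neg_mul_wave x k
  have PA : HasPrim (ampA V k) (fun t => (2 * Complex.I * k)⁻¹ * (V t * mPlus V t k)) := by
    rw [funext hA]
    refine (((hasPrim_wave (-k)).mul (P1.add (P0.const_mul (Complex.I * k)))).const_mul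
      (2 * Complex.I * k)⁻¹).congr fun x => ?_
    rw [psiPlus_eq_wave_mul]
    push_cast
    linear_combination (2 * Complex.I * k)⁻¹ * (V x * mPlus V x k) * wave_neg_mul_wave x k
      - (2 * Complex.I * k)⁻¹ * k ^ 2 * (wave x (-k) * wave x k * mPlus V x k) * Complex.I_sq
  have hI := integrable_V_mul_mPlus hV k
  have PT := (hasPrim_neg_tail hI).const_mul (2 * Complex.I * k)⁻¹
  have hconst := (PA.sub PT).eq_of_deriv_zero (fun t => by ring)
  have hlim : ∀ x, ampA V k x
      - (2 * Complex.I * k)⁻¹ * -∫ t in Ioi x, (V t : ℂ) * mPlus V t k = 1 := by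
    intro x
    have h1 := (tendsto_ampA_atTop hV k).sub
      ((tendsto_integral_Ioi_zero hI).neg.const_mul (2 * Complex.I * k)⁻¹)
    rw [neg_zero, mul_zero, sub_zero] at h1
    exact tendsto_nhds_unique (tendsto_const_nhds.congr fun y => hconst x y) h1
  have h2 := ((tendsto_integral_Ioi_atBot hI).neg.const_mul (2 * Complex.I * k)⁻¹).const_add 1
  have e : 1 + (2 * Complex.I * k)⁻¹ * -∫ t, (V t : ℂ) * mPlus V t k = jostAlpha V k := by
    rw [jostAlpha]; ring
  rw [e] at h2
  refine h2.congr fun x => ?_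
  linear_combination -(hlim x)

/-- The constant value of the Wronskian is computed in the limit `x → -∞`, where both functions are
explicit combinations of plane waves. -/
lemma wronskian_minus_plus (hV : Integrable fun t => (1 + |t|) ^ 2 * V t) {k : ℝ} (hk : k ≠ 0)
    (x : ℝ) : wronskian (fun x => psiMinus V x k) (fun x => psiPlus V x k) x
      = 2 * Complex.I * k * jostAlpha V k := by
  have hVl := locallyIntegrable_of_moment (integrable_mul_of_moment hV)
  have hV' := integrable_moment_mirror hV
  have hc := wronskian_const hVl (isSolution_psiMinus hV k) (isSolution_psiPlus hV k) rfl
  have hm := (tendsto_mPlus hV' k).comp tendsto_neg_atBot_atTop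
  have hq := (tendsto_tailPlus_atTop hV' k).comp tendsto_neg_atBot_atTop
  have h1 := ((tendsto_ampA_atBot hV hk).mul ((hm.const_mul (2 * Complex.I * k)).add
    (tendsto_wave_mul_zero hq (2 * k)))).add ((tendsto_ampB_atBot hV k).mul hq)
  rw [mul_zero, add_zero, add_zero, mul_one, mul_comm (jostAlpha V k)] at h1
  refine tendsto_nhds_unique (tendsto_const_nhds.congr fun y => hc x y) (h1.congr fun y => ?_)
  rw [wronskian, deriv_psiPlus_eq_amp hV hk, (hasDerivAt_psiMinus hV y k).deriv,
    psiPlus_eq_amp, psiMinus_eq_wave_mul hV, wave_two_mul]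
  simp only [Function.comp]
  have h := wave_neg_mul_wave y k
  linear_combination (-(ampA V k y * 2 * Complex.I * k * mPlus (mirror V) (-y) k) -
    ampB V k y * tailPlus (mirror V) k (-y)) * h

lemma wronskian_minus_neg_plus (hV : Integrable fun t => (1 + |t|) ^ 2 * V t) {k : ℝ}
    (hk : k ≠ 0) (x : ℝ) :
    wronskian (fun x => psiMinus V x (-k)) (fun x => psiPlus V x k) x
      = -(2 * Complex.I * k * jostBeta V k) := by
  have hVl := locallyIntegrable_of_moment (integrable_mul_of_moment hV)
  have hV' := integrable_moment_mirror hV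
  have hc := wronskian_const hVl (isSolution_psiMinus hV (-k)) (isSolution_psiPlus hV k) (by ring)
  have hm := (tendsto_mPlus hV' (-k)).comp tendsto_neg_atBot_atTop
  have hq := (tendsto_tailPlus_atTop hV' (-k)).comp tendsto_neg_atBot_atTop
  have h1 := ((tendsto_ampA_atBot hV hk).mul hq).sub
    ((tendsto_ampB_atBot hV k).mul ((hm.const_mul (2 * Complex.I * k)).sub
      (tendsto_wave_mul_zero hq (-(2 * k)))))
  rw [mul_zero, zero_sub, sub_zero, mul_one, mul_comm (jostBeta V k)] at h1
  refine tendsto_nhds_unique (tendsto_const_nhds.congr fun y => hc x y) (h1.congr fun y => ?_)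
  rw [wronskian, deriv_psiPlus_eq_amp hV hk, (hasDerivAt_psiMinus hV y (-k)).deriv,
    psiPlus_eq_amp, psiMinus_eq_wave_mul hV, neg_neg, show -(2 * k) = 2 * -k by ring,
    wave_two_mul]
  simp only [Function.comp]
  have h := wave_neg_mul_wave y k
  push_cast
  linear_combination (ampB V k y * 2 * Complex.I * k * mPlus (mirror V) (-y) (-k) -
    ampA V k y * tailPlus (mirror V) (-k) (-y)) * h

lemma wronskian_minus_minus (hV : Integrable fun t => (1 + |t|) ^ 2 * V t) (k x : ℝ) :
    wronskian (fun x => psiMinus V x k) (fun x => psiMinus V x (-k)) x = 2 * Complex.I * k := by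
  have hVl := locallyIntegrable_of_moment (integrable_mul_of_moment hV)
  have hV' := integrable_moment_mirror hV
  have hc := wronskian_const hVl (isSolution_psiMinus hV k) (isSolution_psiMinus hV (-k)) (by ring)
  have hm := (tendsto_mPlus hV' k).comp tendsto_neg_atBot_atTop
  have hq := (tendsto_tailPlus_atTop hV' k).comp tendsto_neg_atBot_atTop
  have hm' := (tendsto_mPlus hV' (-k)).comp tendsto_neg_atBot_atTop
  have hq' := (tendsto_tailPlus_atTop hV' (-k)).comp tendsto_neg_atBot_atTop
  have h1 := (((hm.mul hm').const_mul (2 * Complex.I * k)).sub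
    (hm.mul (tendsto_wave_mul_zero hq' (-(2 * k))))).add
    (hm'.mul (tendsto_wave_mul_zero hq (2 * k)))
  rw [mul_zero, add_zero, sub_zero, mul_one, mul_one] at h1
  refine tendsto_nhds_unique (tendsto_const_nhds.congr fun y => hc x y) (h1.congr fun y => ?_)
  rw [wronskian, (hasDerivAt_psiMinus hV y (-k)).deriv, (hasDerivAt_psiMinus hV y k).deriv,
    psiMinus_eq_wave_mul hV, psiMinus_eq_wave_mul hV, neg_neg, show -(2 * k) = 2 * -k by ring,
    wave_two_mul, wave_two_mul]
  simp only [Function.comp]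
  have h := wave_neg_mul_wave y k
  push_cast
  linear_combination
    (-(2 * Complex.I * k * mPlus (mirror V) (-y) (-k) * mPlus (mirror V) (-y) k)) * h

/-- The scattering relation `ψ₊(k) = α ψ₋(-k) + β ψ₋(k)`, for the functions and their
derivatives. -/
lemma psiPlus_eq_scattering (hV : Integrable fun t => (1 + |t|) ^ 2 * V t) {k : ℝ} (hk : k ≠ 0)
    (x : ℝ) :
    psiPlus V x k = jostAlpha V k * psiMinus V x (-k) + jostBeta V k * psiMinus V x k ∧
    deriv (fun x => psiPlus V x k) x = jostAlpha V k * deriv (fun x => psiMinus V x (-k)) x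
      + jostBeta V k * deriv (fun x => psiMinus V x k) x := by
  have h1 := wronskian_minus_plus hV hk x
  have h2 := wronskian_minus_neg_plus hV hk x
  have h3 := wronskian_minus_minus hV k x
  simp only [wronskian] at h1 h2 h3
  constructor <;> refine mul_left_cancel₀ (two_I_mul_ne_zero hk) ?_
  · linear_combination (-psiPlus V x k) * h3 - psiMinus V x k * h2 + psiMinus V x (-k) * h1
  · linear_combination (-deriv (fun x => psiPlus V x k) x) * h3
      - deriv (fun x => psiMinus V x k) x * h2 + deriv (fun x => psiMinus V x (-k)) x * h1

/-- Conservation of flux, `|α|² = 1 + |β|²`. -/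
lemma normSq_jostAlpha (hV : Integrable fun t => (1 + |t|) ^ 2 * V t) {k : ℝ} (hk : k ≠ 0) :
    ‖jostAlpha V k‖ ^ 2 = 1 + ‖jostBeta V k‖ ^ 2 := by
  have hVl := locallyIntegrable_of_moment (integrable_mul_of_moment hV)
  have hs := isSolution_psiPlus hV k
  have hdc : ∀ x, HasDerivAt (fun x => (starRingEnd ℂ) (psiPlus V x k))
      ((starRingEnd ℂ) (deriv (fun x => psiPlus V x k) x)) x := fun x =>
    (Complex.conjCLE : ℂ →L[ℝ] ℂ).hasFDerivAt.comp_hasDerivAt x (hs.1 x).hasDerivAt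
  have hsc : IsSolution V k (fun x => (starRingEnd ℂ) (psiPlus V x k)) := by
    refine HasPrim.isSolution hdc (((hs.hasPrim hVl).1.conj).congr fun x => ?_)
    rw [map_mul, Complex.conj_ofReal]
  have hc := wronskian_const hVl hs hsc rfl
  have hW : ∀ x, wronskian (fun x => psiPlus V x k) (fun x => (starRingEnd ℂ) (psiPlus V x k)) x
      = -(2 * Complex.I * k) * ((‖ampA V k x‖ ^ 2 - ‖ampB V k x‖ ^ 2 : ℝ) : ℂ) := by
    intro x
    rw [wronskian, (hdc x).deriv, deriv_psiPlus_eq_amp hV hk, psiPlus_eq_amp]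
    simp only [map_mul, map_add, map_sub, conj_wave, Complex.conj_I, Complex.conj_ofReal, neg_neg]
    push_cast
    rw [← Complex.mul_conj', ← Complex.mul_conj']
    have h := wave_neg_mul_wave x k
    linear_combination (-(2 * Complex.I * k)) * (ampA V k x * (starRingEnd ℂ) (ampA V k x)
      - ampB V k x * (starRingEnd ℂ) (ampB V k x)) * h
  have hD : ∀ x y, ‖ampA V k x‖ ^ 2 - ‖ampB V k x‖ ^ 2 = ‖ampA V k y‖ ^ 2 - ‖ampB V k y‖ ^ 2 := by
    intro x y
    have h1 := hc x y
    rw [hW, hW] at h1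
    have := mul_left_cancel₀ (neg_ne_zero.2 (two_I_mul_ne_zero hk)) h1
    exact_mod_cast this
  have ht := ((tendsto_ampA_atTop hV k).norm.pow 2).sub ((tendsto_ampB_atTop hV k).norm.pow 2)
  have hb := ((tendsto_ampA_atBot hV hk).norm.pow 2).sub ((tendsto_ampB_atBot hV k).norm.pow 2)
  have e1 := tendsto_nhds_unique (tendsto_const_nhds.congr fun y => hD 0 y) ht
  have e2 := tendsto_nhds_unique (tendsto_const_nhds.congr fun y => hD 0 y) hb
  rw [e1] at e2
  simp only [norm_one, norm_zero] at e2
  linarith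

lemma one_le_norm_jostAlpha (hV : Integrable fun t => (1 + |t|) ^ 2 * V t) {k : ℝ} (hk : k ≠ 0) :
    1 ≤ ‖jostAlpha V k‖ := by
  have := normSq_jostAlpha hV hk
  nlinarith [sq_nonneg ‖jostBeta V k‖, norm_nonneg (jostAlpha V k)]

lemma norm_jostBeta_le (hV : Integrable fun t => (1 + |t|) ^ 2 * V t) {k : ℝ} (hk : k ≠ 0) :
    ‖jostBeta V k‖ ≤ ‖jostAlpha V k‖ := by
  have := normSq_jostAlpha hV hk
  nlinarith [norm_nonneg (jostBeta V k), norm_nonneg (jostAlpha V k)]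

/-- The transmission coefficients from the left and from the right agree. -/
lemma jostAlpha_mirror (hV : Integrable fun t => (1 + |t|) ^ 2 * V t) {k : ℝ} (hk : k ≠ 0) :
    jostAlpha (mirror V) k = jostAlpha V k := by
  have hV' := integrable_moment_mirror hV
  have h1 := wronskian_minus_plus hV hk 0
  have h2 := wronskian_minus_plus hV' hk 0
  have e1 : ∀ x, psiMinus (mirror V) x k = psiPlus V (-x) k := fun x => by
    rw [psiMinus_eq_mirror hV', mirror_mirror]
  have e2 : ∀ x, psiMinus V x k = psiPlus (mirror V) (-x) k := fun x =>
    psiMinus_eq_mirror hV x k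
  have d1 : deriv (fun x => psiMinus (mirror V) x k) 0 = - deriv (fun x => psiPlus V x k) 0 := by
    rw [funext e1, deriv_comp_neg (fun x => psiPlus V x k), neg_zero]
  have d2 : deriv (fun x => psiMinus V x k) 0 = - deriv (fun x => psiPlus (mirror V) x k) 0 := by
    rw [funext e2, deriv_comp_neg (fun x => psiPlus (mirror V) x k), neg_zero]
  rw [wronskian, d2, e2, neg_zero] at h1
  rw [wronskian, d1, e1, neg_zero] at h2
  refine mul_left_cancel₀ (two_I_mul_ne_zero hk) ?_
  linear_combination h1 - h2

end spec

/-! ### Decay of the Jost functions -/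

lemma one_le_jb (x : ℝ) : 1 ≤ jb x := by
  rw [jb, Real.one_le_sqrt]; nlinarith [sq_nonneg x]

lemma jb_pos (x : ℝ) : 0 < jb x := lt_of_lt_of_le one_pos (one_le_jb x)

lemma jb_neg (x : ℝ) : jb (-x) = jb x := by simp [jb]

lemma one_add_abs_le_jb (x : ℝ) : 1 + |x| ≤ 2 * jb x := by
  have h1 := one_le_jb x
  have h2 : |x| ≤ jb x := Real.abs_le_sqrt (by linarith)
  linarith

lemma jb_le_three_mul_jb {x t : ℝ} (hx : -2 ≤ x) (ht : x ≤ t) : jb x ≤ 3 * jb t := by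
  have h1 := one_le_jb t
  rcases le_total 0 x with h | h
  · have : jb x ≤ jb t := Real.sqrt_le_sqrt (by nlinarith)
    linarith
  · have : jb x ≤ 3 := by
      rw [jb, Real.sqrt_le_left (by norm_num)]; nlinarith
    linarith

@[fun_prop]
lemma continuous_jb : Continuous jb := by
  unfold jb; fun_prop

lemma integrable_jb_rpow {r : ℝ} (hr : r < -1) : Integrable fun x => jb x ^ r := by
  have h := integrable_rpow_neg_one_add_norm_sq (E := ℝ) (μ := volume) (r := -r) (by simp; linarith)
  refine h.congr (Eventually.of_forall fun x => ?_)
  simp only [jb, Real.sqrt_eq_rpow, Real.norm_eq_abs, sq_abs]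
  rw [← Real.rpow_mul (by positivity)]
  congr 1; ring

section decay

variable {V : ℝ → ℝ} {γ : ℝ}

lemma integrable_moment_of_jb (hγ : 2 ≤ γ) (hV : Integrable fun x => jb x ^ γ * V x) :
    Integrable fun t => (1 + |t|) ^ 2 * V t := by
  have hc : Continuous fun t => (1 + |t|) ^ 2 * (jb t ^ γ)⁻¹ := by
    refine Continuous.mul (by fun_prop) (Continuous.inv₀ ?_ fun t => ?_)
    · exact continuous_jb.rpow_const fun t => Or.inl (jb_pos t).ne'
    · exact (Real.rpow_pos_of_pos (jb_pos t) _).ne'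
  refine (hV.bdd_mul (c := 4) hc.aestronglyMeasurable (Eventually.of_forall fun t => ?_)).congr
    (Eventually.of_forall fun t => ?_)
  · have h1 : jb t ^ (2 : ℝ) ≤ jb t ^ γ := Real.rpow_le_rpow_of_exponent_le (one_le_jb t) hγ
    have h2 := Real.rpow_pos_of_pos (jb_pos t) γ
    rw [Real.norm_eq_abs, abs_of_nonneg (by positivity), ← div_eq_mul_inv, div_le_iff₀ h2]
    rw [Real.rpow_two] at h1
    have h3 := one_add_abs_le_jb t
    nlinarith [abs_nonneg t]
  · have h2 := (Real.rpow_pos_of_pos (jb_pos t) γ).ne'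
    simp only
    field_simp

/-- The tails of `(1 + |t|) |V|` decay like `⟨x⟩ ^ (1 - γ)` to the right. -/
lemma exists_tail_le (hγ : 2 ≤ γ) (hV : Integrable fun x => jb x ^ γ * V x) :
    ∃ C, 0 ≤ C ∧ ∀ x, -2 ≤ x → ∫ t in Ioi x, (1 + |t|) * |V t| ≤ C * jb x ^ (-γ + 1) := by
  refine ⟨2 * 3 ^ (γ - 1) * ∫ t, ‖jb t ^ γ * V t‖,
    mul_nonneg (by positivity) (integral_nonneg fun t => norm_nonneg _), fun x hx => ?_⟩
  have hi := integrable_one_add_abs_mul_abs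
    (integrable_mul_of_moment (integrable_moment_of_jb hγ hV))
  have h0 := Real.rpow_pos_of_pos (jb_pos x) (-γ + 1)
  calc ∫ t in Ioi x, (1 + |t|) * |V t|
      ≤ ∫ t in Ioi x, 2 * 3 ^ (γ - 1) * jb x ^ (-γ + 1) * ‖jb t ^ γ * V t‖ := by
        refine setIntegral_mono_on hi.integrableOn (hV.norm.const_mul _).integrableOn
          measurableSet_Ioi fun t ht => ?_
        have hp := Real.rpow_pos_of_pos (jb_pos t) γ
        rw [norm_mul, Real.norm_eq_abs (V t), Real.norm_eq_abs, abs_of_pos hp, ← mul_assoc]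
        gcongr
        have h1 : jb t = jb t ^ (-γ + 1) * jb t ^ γ := by
          rw [← Real.rpow_add (jb_pos t)]; simp
        have h2 : jb t ^ (-γ + 1) ≤ 3 ^ (γ - 1) * jb x ^ (-γ + 1) := by
          have h3 : jb t ^ (-γ + 1) ≤ (jb x / 3) ^ (-γ + 1) :=
            Real.rpow_le_rpow_of_nonpos (by have := jb_pos x; positivity)
              (by have := jb_le_three_mul_jb hx (le_of_lt ht); linarith) (by linarith)
          refine h3.trans (le_of_eq ?_)
          rw [Real.div_rpow (jb_pos x).le (by norm_num), show γ - 1 = -(-γ + 1) by ring,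
            Real.rpow_neg (by norm_num : (0:ℝ) ≤ 3), div_eq_inv_mul]
        calc 1 + |t| ≤ 2 * jb t := one_add_abs_le_jb t
          _ = 2 * (jb t ^ (-γ + 1) * jb t ^ γ) := by rw [← h1]
          _ ≤ 2 * ((3 ^ (γ - 1) * jb x ^ (-γ + 1)) * jb t ^ γ) := by gcongr
          _ = _ := by ring
    _ = 2 * 3 ^ (γ - 1) * jb x ^ (-γ + 1) * ∫ t in Ioi x, ‖jb t ^ γ * V t‖ := integral_const_mul _ _
    _ ≤ 2 * 3 ^ (γ - 1) * jb x ^ (-γ + 1) * ∫ t, ‖jb t ^ γ * V t‖ := by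
        exact mul_le_mul_of_nonneg_left (setIntegral_le_integral hV.norm
          (Eventually.of_forall fun t => norm_nonneg _)) (by positivity)
    _ = _ := by ring

lemma growthWeight_le_three {x : ℝ} (hx : -2 ≤ x) : growthWeight x ≤ 3 := by
  unfold growthWeight
  have : max (-x) 0 ≤ 2 := max_le (by linarith) (by norm_num)
  linarith

/-- `m₊ - 1` and the tail of the Jost function are `O(⟨x⟩ ^ (1 - γ))` to the right, uniformly
in `k`. -/
lemma exists_decay_mPlus (hγ : 2 ≤ γ) (hV : Integrable fun x => jb x ^ γ * V x) :
    ∃ C, 0 ≤ C ∧ ∀ x k, -2 ≤ x → ‖mPlus V x k - 1‖ ≤ C * jb x ^ (-γ + 1) ∧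
      ‖tailPlus V k x‖ ≤ C * jb x ^ (-γ + 1) := by
  have hV2 := integrable_moment_of_jb hγ hV
  have hi := integrable_one_add_abs_mul_abs (integrable_mul_of_moment hV2)
  obtain ⟨C₁, hC₁, h1⟩ := exists_tail_le hγ hV
  obtain ⟨C₂, hC₂, h2⟩ := exists_bound_mPlus hV2
  refine ⟨3 * (C₂ * 3) * C₁, by positivity, fun x k hx => ?_⟩
  have h0 := Real.rpow_pos_of_pos (jb_pos x) (-γ + 1)
  have hint := integrable_moment_V_mul_mPlus hV2 k
  have hN : ∀ a : ℝ, (0 : ℝ) ≤ 1 + |a| := fun a => by positivity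
  have hint' : Integrable fun t => (1 + |t|) * ‖(V t : ℂ) * mPlus V t k‖ := by
    refine hint.norm.congr (Eventually.of_forall fun t => ?_)
    simp only [norm_mul, Complex.norm_real, Real.norm_eq_abs, abs_of_nonneg (hN t)]
  have key : ∫ t in Ioi x, (1 + |t|) * ‖(V t : ℂ) * mPlus V t k‖
      ≤ (C₂ * 3) * (C₁ * jb x ^ (-γ + 1)) := by
    calc _ ≤ ∫ t in Ioi x, (C₂ * 3) * ((1 + |t|) * |V t|) := by
          refine setIntegral_mono_on hint'.integrableOn
            (hi.const_mul _).integrableOn measurableSet_Ioi fun t ht => ?_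
          rw [norm_mul, Complex.norm_real, Real.norm_eq_abs]
          have : ‖mPlus V t k‖ ≤ C₂ * 3 := (h2 t k).trans (by
            gcongr; exact growthWeight_le_three (hx.trans (le_of_lt ht)))
          calc _ ≤ (1 + |t|) * (|V t| * (C₂ * 3)) := by gcongr
            _ = _ := by ring
      _ ≤ _ := by
          rw [integral_const_mul]
          gcongr
          exact h1 x hx
  constructor
  · rw [(mPlus_spec hV2).2.2.1 x k, add_sub_cancel_left]
    refine (norm_volterra_le hint k x).trans ?_
    calc _ ≤ 3 * ((C₂ * 3) * (C₁ * jb x ^ (-γ + 1))) := by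
          gcongr
          exact growthWeight_le_three hx
      _ = _ := by ring
  · rw [tailPlus, jostTail, norm_neg]
    refine (norm_integral_le_integral_norm _).trans ?_
    calc _ ≤ ∫ t in Ioi x, (1 + |t|) * ‖(V t : ℂ) * mPlus V t k‖ := by
          refine integral_mono ((integrable_wave_mul (integrable_V_mul_mPlus hV2 k)
            (2 * k)).norm.integrableOn) hint'.integrableOn fun t => ?_
          simp only [norm_mul, norm_wave, one_mul]
          nlinarith [abs_nonneg t, norm_nonneg (V t : ℂ), norm_nonneg (mPlus V t k),
            mul_nonneg (norm_nonneg (V t : ℂ)) (norm_nonneg (mPlus V t k))]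
      _ ≤ (C₂ * 3) * (C₁ * jb x ^ (-γ + 1)) := key
      _ ≤ _ := by
          have : 0 ≤ (C₂ * 3) * (C₁ * jb x ^ (-γ + 1)) := by positivity
          linarith

end decay

/-! ### Scattering coefficients near zero energy -/

section continuity

variable {V : ℝ → ℝ}

lemma continuous_integral_V_mul_mPlus (hV : Integrable fun t => (1 + |t|) ^ 2 * V t) (s : Set ℝ)
    (c : ℝ) : Continuous fun k => ∫ t in s, wave t (c * k) * ((V t : ℂ) * mPlus V t k) := by
  obtain ⟨C, hC0, hC⟩ := exists_bound_mPlus hV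
  have hi := integrable_one_add_abs_mul_abs (integrable_mul_of_moment hV)
  have hm := aestronglyMeasurable_of_moment (integrable_mul_of_moment hV)
  have hmc := (mPlus_spec hV).1
  refine continuous_of_dominated (bound := fun t => C * ((1 + |t|) * |V t|)) (fun k => ?_)
    (fun k => Eventually.of_forall fun t => ?_) (hi.const_mul C).integrableOn
    (Eventually.of_forall fun t => ?_)
  · exact ((by fun_prop : Continuous fun t => wave t (c * k)).aestronglyMeasurable.mul
      ((Complex.continuous_ofReal.comp_aestronglyMeasurable hm).mul
        (continuous_mPlus hV k).aestronglyMeasurable)).restrict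
  · rw [norm_mul, norm_mul, norm_wave, one_mul, Complex.norm_real, Real.norm_eq_abs]
    calc _ ≤ |V t| * (C * (1 + |t|)) := by
          gcongr
          exact (hC t k).trans (by gcongr; exact growthWeight_le t)
      _ = _ := by ring
  · have : Continuous fun k => mPlus V t k :=
      hmc.comp (by fun_prop : Continuous fun k : ℝ => (t, k))
    fun_prop

lemma continuous_mPlus_right (hV : Integrable fun t => (1 + |t|) ^ 2 * V t) (x : ℝ) :
    Continuous fun k => mPlus V x k :=
  (mPlus_spec hV).1.comp (by fun_prop : Continuous fun k : ℝ => (x, k))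

lemma continuousAt_jostAlpha (hV : Integrable fun t => (1 + |t|) ^ 2 * V t) {k : ℝ} (hk : k ≠ 0) :
    ContinuousAt (jostAlpha V) k := by
  have h := continuous_integral_V_mul_mPlus hV univ 0
  simp only [zero_mul, wave_zero_right, one_mul, Measure.restrict_univ] at h
  have h2 : ContinuousAt (fun k : ℝ => (2 * Complex.I * (k : ℂ))⁻¹) k :=
    ContinuousAt.inv₀ (by fun_prop) (two_I_mul_ne_zero hk)
  exact continuousAt_const.sub (h2.mul h.continuousAt)

lemma continuousAt_jostBeta (hV : Integrable fun t => (1 + |t|) ^ 2 * V t) {k : ℝ} (hk : k ≠ 0) :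
    ContinuousAt (jostBeta V) k := by
  have h := continuous_integral_V_mul_mPlus hV univ 2
  simp only [Measure.restrict_univ] at h
  have h2 : ContinuousAt (fun k : ℝ => (2 * Complex.I * (k : ℂ))⁻¹) k :=
    ContinuousAt.inv₀ (by fun_prop) (two_I_mul_ne_zero hk)
  exact h2.mul h.continuousAt

lemma continuous_psiPlus_zero (hV : Integrable fun t => (1 + |t|) ^ 2 * V t) :
    Continuous fun k => psiPlus V 0 k := by
  simpa [psiPlus_eq_wave_mul] using continuous_mPlus_right hV 0

lemma continuous_deriv_psiPlus_zero (hV : Integrable fun t => (1 + |t|) ^ 2 * V t) :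
    Continuous fun k => deriv (fun x => psiPlus V x k) 0 := by
  have h : ∀ k, deriv (fun x => psiPlus V x k) 0
      = Complex.I * k * psiPlus V 0 k + wave 0 (-k) * tailPlus V k 0 := fun k =>
    (hasDerivAt_psiPlus hV 0 k).deriv
  simp only [h]
  have h1 := continuous_psiPlus_zero hV
  have h2 : Continuous fun k => tailPlus V k 0 := (continuous_integral_V_mul_mPlus hV (Ioi 0) 2).neg
  fun_prop

end continuity

section resonance

variable {V : ℝ → ℝ} {γ : ℝ}

lemma psiPlus_zero_eq (V : ℝ → ℝ) (x : ℝ) : psiPlus V x 0 = mPlus V x 0 := by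
  rw [psiPlus_eq_wave_mul]; simp

/-- An odd zero energy resonance is, up to sign, the Jost solution at both ends, and hence
invariant under reflection of the potential. -/
lemma psiPlus_mirror_zero (hV : Integrable fun t => (1 + |t|) ^ 2 * V t)
    (hodd : OddZeroEnergyResonance V) (x : ℝ) : psiPlus (mirror V) x 0 = psiPlus V x 0 := by
  have hJ : IsJostMinus V 0 (fun x => psiPlus V (-x) 0) := by
    have e : (fun x => psiPlus V (-x) 0) = fun x => (0 : ℂ) - psiPlus V x 0 := by
      funext x; rw [hodd x, zero_sub]
    have hVl := locallyIntegrable_of_moment (integrable_mul_of_moment hV)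
    have h0 : IsSolution V 0 (fun _ => (0 : ℂ)) := by
      refine ⟨differentiable_const _, fun x y => ?_⟩
      simp
    refine ⟨?_, ?_⟩
    · rw [e]; exact h0.sub hVl (isSolution_psiPlus hV 0)
    · refine (((mPlus_spec hV).2.2.2 0).2.comp tendsto_neg_atBot_atTop).congr fun x => ?_
      simp
  have h1 := isJostMinus_iff.1 hJ
  simp only [neg_neg] at h1
  exact congrFun (IsJostPlus.unique (integrable_moment_mirror hV)
    ((mPlus_spec (integrable_moment_mirror hV)).2.2.2 0) h1) x

lemma OddZeroEnergyResonance.mirror (hV : Integrable fun t => (1 + |t|) ^ 2 * V t)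
    (hodd : OddZeroEnergyResonance V) : OddZeroEnergyResonance (mirror V) := fun x => by
  rw [psiPlus_mirror_zero hV hodd, psiPlus_mirror_zero hV hodd, hodd]

lemma psiMinus_zero (hV : Integrable fun t => (1 + |t|) ^ 2 * V t)
    (hodd : OddZeroEnergyResonance V) (x : ℝ) : psiMinus V x 0 = -psiPlus V x 0 := by
  rw [psiMinus_eq_mirror hV, psiPlus_mirror_zero hV hodd, hodd]

lemma psiPlus_zero_zero (hodd : OddZeroEnergyResonance V) : psiPlus V 0 0 = 0 := by
  have h := hodd 0
  rw [neg_zero] at h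
  exact self_eq_neg.1 h

lemma integrable_jb_mirror (hV : Integrable fun x => jb x ^ γ * V x) :
    Integrable fun x => jb x ^ γ * mirror V x := by
  simpa [mirror, jb_neg] using hV.comp_neg

/-- The expansion `-ψ₊'(0, 0) ψ₊(0, k) = ik + O(k²)`. It compares the Wronskian of `ψ₊(·, 0)` and
`ψ₊(·, k)` with that of `1` and `exp (ikx)` on the half line. -/
lemma exists_psiPlus_expansion (hγ : 2 < γ) (hV : Integrable fun x => jb x ^ γ * V x)
    (hodd : OddZeroEnergyResonance V) :
    ∃ C, ∀ k : ℝ, ‖-(deriv (fun x => psiPlus V x 0) 0 * psiPlus V 0 k) - Complex.I * k‖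
      ≤ k ^ 2 * C := by
  have hV2 := integrable_moment_of_jb hγ.le hV
  have hVl := locallyIntegrable_of_moment (integrable_mul_of_moment hV2)
  obtain ⟨C, hC0, hC⟩ := exists_decay_mPlus hγ.le hV
  obtain ⟨B, hB0, hB⟩ := exists_bound_mPlus hV2
  have hj : Integrable fun x => jb x ^ (-γ + 1) := integrable_jb_rpow (by linarith)
  have hj0 : ∀ x, 0 ≤ jb x ^ (-γ + 1) := fun x => (Real.rpow_pos_of_pos (jb_pos x) _).le
  refine ⟨(C * B + C) * ∫ x, jb x ^ (-γ + 1), fun k => ?_⟩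
  set f : ℝ → ℂ := fun x => psiPlus V x 0 with hf
  set u : ℝ → ℂ := fun x => psiPlus V x k with hu
  set w : ℝ → ℂ := fun x => wronskian f u x - Complex.I * k * wave x k with hw
  have hB1 : ∀ t k, 0 ≤ t → ‖mPlus V t k‖ ≤ B := fun t k ht => (hB t k).trans (by
    simp [growthWeight, max_eq_right (by linarith : -t ≤ 0)])
  have Pw : HasPrim w (fun t => -(k ^ 2 * (f t * u t - wave t k))) := by
    refine ((hasPrim_wronskian hVl (isSolution_psiPlus hV2 0) (isSolution_psiPlus hV2 k)).sub
      ((hasPrim_wave k).const_mul (Complex.I * k))).congr fun x => ?_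
    push_cast
    linear_combination (-(k ^ 2 * wave x k)) * Complex.I_sq
  have hwlim : Tendsto w atTop (𝓝 0) := by
    have h1 := tendsto_mPlus hV2 0
    have h2 := tendsto_mPlus hV2 k
    have h3 := tendsto_tailPlus_atTop hV2 0
    have h4 := tendsto_tailPlus_atTop hV2 k
    have h5 : Tendsto (fun x => mPlus V x 0 * mPlus V x k - 1) atTop (𝓝 0) := by
      simpa using (h1.mul h2).sub_const 1
    have h6 : Tendsto (fun x => mPlus V x 0 * tailPlus V k x) atTop (𝓝 0) := by
      simpa using h1.mul h4
    have h7 : Tendsto (fun x => tailPlus V 0 x * mPlus V x k) atTop (𝓝 0) := by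
      simpa using h3.mul h2
    have h8 := (((tendsto_wave_mul_zero h5 k).const_mul (Complex.I * k)).add
      (tendsto_wave_mul_zero h6 (-k))).sub (tendsto_wave_mul_zero h7 k)
    simp only [mul_zero, add_zero, sub_zero] at h8
    refine h8.congr fun x => ?_
    rw [hw]
    simp only
    rw [wronskian, hf, hu, (hasDerivAt_psiPlus hV2 x 0).deriv, (hasDerivAt_psiPlus hV2 x k).deriv,
      neg_zero, wave_zero_right]
    simp only [psiPlus_zero_eq, psiPlus_eq_wave_mul V x k]
    push_cast
    ring
  have hdiff : ∀ t, 0 ≤ t → ‖f t * u t - wave t k‖ ≤ (C * B + C) * jb t ^ (-γ + 1) := by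
    intro t ht
    have e : f t * u t - wave t k = wave t k *
        ((mPlus V t 0 - 1) * mPlus V t k + (mPlus V t k - 1)) := by
      rw [hf, hu]; simp only; rw [psiPlus_zero_eq, psiPlus_eq_wave_mul V t k]; ring
    rw [e, norm_mul, norm_wave, one_mul]
    refine (norm_add_le _ _).trans ?_
    rw [norm_mul, add_mul]
    have h1 := (hC t 0 (by linarith)).1
    have h2 := (hC t k (by linarith)).1
    have h3 := hB1 t k ht
    have h4 := hj0 t
    have h5 : ‖mPlus V t 0 - 1‖ * ‖mPlus V t k‖ ≤ (C * jb t ^ (-γ + 1)) * B :=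
      mul_le_mul h1 h3 (norm_nonneg _) (by positivity)
    linarith
  -- the term `f 0 * deriv u 0` of the Wronskian vanishes, as `f` is odd
  have hw0 : w 0 = -(deriv f 0 * u 0) - Complex.I * k := by
    rw [hw]; simp only
    rw [wronskian, show f 0 = 0 from psiPlus_zero_zero hodd, wave_zero_left]; ring
  have hint : ∀ X, 0 ≤ X → ‖w 0‖ ≤ ‖w X‖ + k ^ 2 * ((C * B + C) * ∫ x, jb x ^ (-γ + 1)) := by
    intro X hX
    have h1 := Pw.eq 0 X
    have h2 : ‖w X - w 0‖ ≤ k ^ 2 * ((C * B + C) * ∫ x, jb x ^ (-γ + 1)) := by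
      rw [h1]
      calc _ ≤ ∫ t in (0:ℝ)..X, k ^ 2 * ((C * B + C) * jb t ^ (-γ + 1)) := by
            refine intervalIntegral.norm_integral_le_of_norm_le hX
              (Eventually.of_forall fun t ht => ?_)
              ((hj.const_mul _).const_mul _).intervalIntegrable
            rw [norm_neg, norm_mul, norm_pow, Complex.norm_real, Real.norm_eq_abs, sq_abs]
            gcongr
            exact hdiff t ht.1.le
        _ = k ^ 2 * ((C * B + C) * ∫ t in (0:ℝ)..X, jb t ^ (-γ + 1)) := by
            rw [intervalIntegral.integral_const_mul, intervalIntegral.integral_const_mul]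
        _ ≤ _ := by
            gcongr
            rw [intervalIntegral.integral_of_le hX]
            exact setIntegral_le_integral hj (Eventually.of_forall hj0)
    have h3 : ‖w 0‖ ≤ ‖w X‖ + ‖w X - w 0‖ := by
      have := norm_sub_norm_le (w 0) (w X)
      rw [norm_sub_rev (w 0) (w X)] at this
      linarith
    linarith
  rw [← hw0]
  have h1 := (hwlim.norm.add_const (k ^ 2 * ((C * B + C) * ∫ x, jb x ^ (-γ + 1))))
  rw [norm_zero, zero_add] at h1
  refine ge_of_tendsto h1 ?_
  filter_upwards [eventually_ge_atTop 0] with X hX using hint X hX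

/-- Otherwise the expansion would give `|k| ≤ C k²` for small `k`. -/
lemma deriv_psiPlus_zero_ne_zero (hγ : 2 < γ) (hV : Integrable fun x => jb x ^ γ * V x)
    (hodd : OddZeroEnergyResonance V) : deriv (fun x => psiPlus V x 0) 0 ≠ 0 := by
  obtain ⟨C, hC⟩ := exists_psiPlus_expansion hγ hV hodd
  intro h0
  have h1 := hC (1 / (|C| + 1))
  have hp : 0 < |C| + 1 := by positivity
  rw [h0, zero_mul, neg_zero, zero_sub, norm_neg, norm_mul, Complex.norm_I, one_mul,
    Complex.norm_real, Real.norm_eq_abs, abs_of_pos (by positivity)] at h1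
  rw [div_pow, one_pow, div_mul_eq_mul_div, one_mul, div_le_div_iff₀ hp (by positivity)] at h1
  nlinarith [le_abs_self C]

lemma tendsto_psiPlus_div (hγ : 2 < γ) (hV : Integrable fun x => jb x ^ γ * V x)
    (hodd : OddZeroEnergyResonance V) :
    Tendsto (fun k : ℝ => psiPlus V 0 k / k) (𝓝[≠] 0)
      (𝓝 (-Complex.I / deriv (fun x => psiPlus V x 0) 0)) := by
  obtain ⟨C, hC⟩ := exists_psiPlus_expansion hγ hV hodd
  have hd := deriv_psiPlus_zero_ne_zero hγ hV hodd
  set d := deriv (fun x => psiPlus V x 0) 0 with hdd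
  rw [tendsto_iff_norm_sub_tendsto_zero]
  have hlim : Tendsto (fun k : ℝ => |k| * |C| * ‖d‖⁻¹) (𝓝[≠] 0) (𝓝 0) := by
    have : Continuous fun k : ℝ => |k| * |C| * ‖d‖⁻¹ := by fun_prop
    have h := this.tendsto 0
    simp only [abs_zero, zero_mul] at h
    exact h.mono_left nhdsWithin_le_nhds
  refine squeeze_zero' (Eventually.of_forall fun _ => norm_nonneg _) ?_ hlim
  filter_upwards [self_mem_nhdsWithin] with k hk
  have hk' : (k : ℂ) ≠ 0 := by exact_mod_cast hk
  have e : psiPlus V 0 k / k - -Complex.I / d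
      = -((-(d * psiPlus V 0 k) - Complex.I * k) * (k : ℂ)⁻¹ * d⁻¹) := by
    field_simp; ring
  rw [e, norm_neg, norm_mul, norm_mul, norm_inv, norm_inv, Complex.norm_real, Real.norm_eq_abs]
  have hk0 : 0 < |k| := abs_pos.2 hk
  refine mul_le_mul_of_nonneg_right ?_ (by positivity)
  rw [← div_eq_mul_inv, div_le_iff₀ hk0]
  refine (hC k).trans ?_
  rw [← sq_abs k]
  nlinarith [le_abs_self C, mul_pos hk0 hk0]

lemma deriv_psiMinus_zero (hV : Integrable fun t => (1 + |t|) ^ 2 * V t) (k : ℝ) :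
    deriv (fun x => psiMinus V x k) 0 = -deriv (fun x => psiPlus (mirror V) x k) 0 := by
  rw [show (fun x => psiMinus V x k) = fun x => psiPlus (mirror V) (-x) k from
    funext fun x => psiMinus_eq_mirror hV x k, deriv_comp_neg (fun x => psiPlus (mirror V) x k),
    neg_zero]

/-- `T(0) = -1` for an odd zero energy resonance. -/
lemma tendsto_jostAlpha (hγ : 2 < γ) (hV : Integrable fun x => jb x ^ γ * V x)
    (hodd : OddZeroEnergyResonance V) : Tendsto (jostAlpha V) (𝓝[≠] 0) (𝓝 (-1)) := by
  have hV2 := integrable_moment_of_jb hγ.le hV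
  have hV2' := integrable_moment_mirror hV2
  have hodd' := hodd.mirror hV2
  have hd := deriv_psiPlus_zero_ne_zero hγ hV hodd
  have h1 := tendsto_psiPlus_div hγ hV hodd
  have h2 := tendsto_psiPlus_div hγ (integrable_jb_mirror hV) hodd'
  rw [show (fun x => psiPlus (mirror V) x 0) = fun x => psiPlus V x 0 from
    funext (psiPlus_mirror_zero hV2 hodd)] at h2
  have h3 : Tendsto (fun k => deriv (fun x => psiPlus V x k) 0) (𝓝[≠] 0) _ :=
    ((continuous_deriv_psiPlus_zero hV2).tendsto 0).mono_left nhdsWithin_le_nhds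
  have h4 : Tendsto (fun k => deriv (fun x => psiPlus (mirror V) x k) 0) (𝓝[≠] 0) _ :=
    ((continuous_deriv_psiPlus_zero hV2').tendsto 0).mono_left nhdsWithin_le_nhds
  rw [show (fun x => psiPlus (mirror V) x 0) = fun x => psiPlus V x 0 from
    funext (psiPlus_mirror_zero hV2 hodd)] at h4
  set d := deriv (fun x => psiPlus V x 0) 0 with hdd
  have h5 := ((h2.mul h3).add (h4.mul h1)).const_mul (2 * Complex.I)⁻¹
  have e : (2 * Complex.I)⁻¹ * (-Complex.I / d * d + d * (-Complex.I / d)) = -1 := by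
    have := Complex.I_ne_zero
    field_simp; ring
  rw [e] at h5
  refine h5.congr' ?_
  filter_upwards [self_mem_nhdsWithin] with k hk
  have hk' : (k : ℂ) ≠ 0 := by exact_mod_cast hk
  -- `2ik α(k)` is the Wronskian at `x = 0`, which is of first order in `k`
  have h6 := wronskian_minus_plus hV2 hk 0
  rw [wronskian, deriv_psiMinus_zero hV2, psiMinus_eq_mirror hV2, neg_zero] at h6
  have := Complex.I_ne_zero
  field_simp
  linear_combination h6

/-- `R₋(0) = 0` for an odd zero energy resonance. -/
lemma tendsto_jostBeta (hγ : 2 < γ) (hV : Integrable fun x => jb x ^ γ * V x)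
    (hodd : OddZeroEnergyResonance V) : Tendsto (jostBeta V) (𝓝[≠] 0) (𝓝 0) := by
  have hV2 := integrable_moment_of_jb hγ.le hV
  have hV2' := integrable_moment_mirror hV2
  have hd := deriv_psiPlus_zero_ne_zero hγ hV hodd
  have h1 := tendsto_jostAlpha hγ hV hodd
  have h3 : Tendsto (fun k => deriv (fun x => psiPlus V x k) 0) (𝓝[≠] 0) _ :=
    ((continuous_deriv_psiPlus_zero hV2).tendsto 0).mono_left nhdsWithin_le_nhds
  have h4 := (continuous_deriv_psiPlus_zero hV2').tendsto 0
  have h5 : Tendsto (fun k => deriv (fun x => psiPlus (mirror V) x (-k)) 0) (𝓝[≠] 0) _ :=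
    (((continuous_deriv_psiPlus_zero hV2').comp continuous_neg).tendsto 0).mono_left
      nhdsWithin_le_nhds
  simp only [Function.comp, neg_zero] at h5
  rw [show (fun x => psiPlus (mirror V) x 0) = fun x => psiPlus V x 0 from
    funext (psiPlus_mirror_zero hV2 hodd)] at h4 h5
  set d := deriv (fun x => psiPlus V x 0) 0 with hdd
  have h6 := ((h3.add (h1.mul h5)).neg).div (h4.mono_left nhdsWithin_le_nhds) hd
  rw [show -(d + -1 * d) / d = 0 by ring] at h6
  refine h6.congr' ?_
  have hne : ∀ᶠ k in 𝓝[≠] (0 : ℝ), deriv (fun x => psiPlus (mirror V) x k) 0 ≠ 0 :=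
    (h4.mono_left nhdsWithin_le_nhds).eventually_ne hd
  filter_upwards [self_mem_nhdsWithin, hne] with k hk hk2
  have h7 := (psiPlus_eq_scattering hV2 hk 0).2
  rw [deriv_psiMinus_zero hV2, deriv_psiMinus_zero hV2] at h7
  rw [Pi.div_apply, div_eq_iff hk2]
  linear_combination -h7

lemma extendZero_spec {g : ℝ → ℂ} {L : ℂ} (hc : ∀ k, k ≠ 0 → ContinuousAt g k)
    (hl : Tendsto g (𝓝[≠] 0) (𝓝 L)) : extendZero g 0 = L ∧ Continuous (extendZero g) := by
  have h0 : extendZero g 0 = L := by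
    rw [extendZero, if_pos rfl]; exact hl.limUnder_eq
  have hev : ∀ k, k ≠ 0 → extendZero g k = g k := fun k hk => by rw [extendZero, if_neg hk]
  refine ⟨h0, continuous_iff_continuousAt.2 fun k => ?_⟩
  by_cases hk : k = 0
  · subst hk
    rw [continuousAt_iff_punctured_nhds, h0]
    refine hl.congr' ?_
    filter_upwards [self_mem_nhdsWithin] with k hk using (hev k hk).symm
  · refine (hc k hk).congr ?_
    filter_upwards [isOpen_ne.mem_nhds hk] with l hl using (hev l hl).symm

lemma transAux_eq (V : ℝ → ℝ) : transAux V = fun k => (jostAlpha V k)⁻¹ := rfl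

lemma reflMinusAux_eq (V : ℝ → ℝ) :
    reflMinusAux V = fun k => (jostAlpha V k)⁻¹ * jostBeta V k := by
  funext k
  rw [reflMinusAux, transAux_eq, jostBeta]
  congr 2
  refine integral_congr_ae (Eventually.of_forall fun x => ?_)
  simp only [exp_two_I_eq_wave, wave_two_mul]
  ring

lemma jostAlpha_ne_zero (hV : Integrable fun t => (1 + |t|) ^ 2 * V t) {k : ℝ} (hk : k ≠ 0) :
    jostAlpha V k ≠ 0 := by
  have := one_le_norm_jostAlpha hV hk
  exact norm_pos_iff.1 (by linarith)

/-- `T` is continuous and bounded by one, with `T(0) = -1`. -/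
lemma trans_spec (hγ : 2 < γ) (hV : Integrable fun x => jb x ^ γ * V x)
    (hodd : OddZeroEnergyResonance V) :
    trans V 0 = -1 ∧ Continuous (trans V) ∧ (∀ k, ‖trans V k‖ ≤ 1) ∧
      ∀ k, k ≠ 0 → trans V k = (jostAlpha V k)⁻¹ := by
  have hV2 := integrable_moment_of_jb hγ.le hV
  have h := extendZero_spec (g := transAux V) (L := -1)
    (fun k hk => by
      rw [transAux_eq]; exact (continuousAt_jostAlpha hV2 hk).inv₀ (jostAlpha_ne_zero hV2 hk))
    (by
      rw [transAux_eq]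
      have := (tendsto_jostAlpha hγ hV hodd).inv₀ (by norm_num)
      rwa [show (-1 : ℂ)⁻¹ = -1 by norm_num] at this)
  have hev : ∀ k, k ≠ 0 → trans V k = (jostAlpha V k)⁻¹ := fun k hk => by
    rw [trans, extendZero, if_neg hk, transAux_eq]
  refine ⟨h.1, h.2, fun k => ?_, hev⟩
  by_cases hk : k = 0
  · rw [hk, show trans V 0 = -1 from h.1]; simp
  · rw [hev k hk, norm_inv]
    exact inv_le_one_of_one_le₀ (one_le_norm_jostAlpha hV2 hk)

/-- `R₋` is continuous and bounded by one, with `R₋(0) = 0`. -/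
lemma reflMinus_spec (hγ : 2 < γ) (hV : Integrable fun x => jb x ^ γ * V x)
    (hodd : OddZeroEnergyResonance V) :
    reflMinus V 0 = 0 ∧ Continuous (reflMinus V) ∧ (∀ k, ‖reflMinus V k‖ ≤ 1) ∧
      ∀ k, k ≠ 0 → reflMinus V k = (jostAlpha V k)⁻¹ * jostBeta V k := by
  have hV2 := integrable_moment_of_jb hγ.le hV
  have h := extendZero_spec (g := reflMinusAux V) (L := 0)
    (fun k hk => by
      rw [reflMinusAux_eq]
      exact ((continuousAt_jostAlpha hV2 hk).inv₀ (jostAlpha_ne_zero hV2 hk)).mul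
        (continuousAt_jostBeta hV2 hk))
    (by
      rw [reflMinusAux_eq]
      have := ((tendsto_jostAlpha hγ hV hodd).inv₀ (by norm_num)).mul (tendsto_jostBeta hγ hV hodd)
      rwa [mul_zero] at this)
  have hev : ∀ k, k ≠ 0 → reflMinus V k = (jostAlpha V k)⁻¹ * jostBeta V k := fun k hk => by
    rw [reflMinus, extendZero, if_neg hk, reflMinusAux_eq]
  refine ⟨h.1, h.2, fun k => ?_, hev⟩
  by_cases hk : k = 0
  · rw [hk, show reflMinus V 0 = 0 from h.1]; simp
  · rw [hev k hk, norm_mul, norm_inv]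
    have h1 := one_le_norm_jostAlpha hV2 hk
    rw [inv_mul_le_iff₀ (by linarith), mul_one]
    exact norm_jostBeta_le hV2 hk

lemma trans_mirror (hγ : 2 < γ) (hV : Integrable fun x => jb x ^ γ * V x)
    (hodd : OddZeroEnergyResonance V) : trans (mirror V) = trans V := by
  have hV2 := integrable_moment_of_jb hγ.le hV
  have h1 := trans_spec hγ hV hodd
  have h2 := trans_spec hγ (integrable_jb_mirror hV) (hodd.mirror hV2)
  funext k
  by_cases hk : k = 0
  · rw [hk, h1.1, h2.1]
  · rw [h1.2.2.2 k hk, h2.2.2.2 k hk, jostAlpha_mirror hV2 hk]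

/-- Reflection exchanges the two reflection coefficients. -/
lemma reflPlus_eq_mirror (hγ : 2 < γ) (hV : Integrable fun x => jb x ^ γ * V x) :
    reflPlus V = reflMinus (mirror V) := by
  have hV2 := integrable_moment_of_jb hγ.le hV
  have haux : ∀ k, k ≠ 0 → reflPlusAux V k = reflMinusAux (mirror V) k := by
    intro k hk
    rw [reflPlusAux, reflMinusAux, transAux_eq, transAux_eq]
    simp only
    rw [jostAlpha_mirror hV2 hk]
    congr 2
    rw [← integral_neg_eq_self]
    refine integral_congr_ae (Eventually.of_forall fun x => ?_)
    simp only [mMinus_eq_mirror hV2, mirror, neg_neg]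
    congr 3
    push_cast; ring
  funext k
  unfold reflPlus reflMinus extendZero
  by_cases hk : k = 0
  · rw [if_pos hk, if_pos hk]
    unfold limUnder
    congr 1
    exact Filter.map_congr (by filter_upwards [self_mem_nhdsWithin] with k hk using haux k hk)
  · rw [if_neg hk, if_neg hk, haux k hk]

end resonance

/-! ### A Plancherel inequality for integrable functions -/

open FourierTransform in
/-- The `L²` Fourier transform of an integrable function is given by the Fourier integral. -/
theorem fourier_ae_eq_toLp {φ : ℝ → ℂ} (h1 : Integrable φ) (h2 : MemLp φ 2) :
    (𝓕 (h2.toLp φ) : Lp ℂ 2 (volume : Measure ℝ)) =ᵐ[volume] 𝓕 φ := by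
  have hc : Continuous (𝓕 φ) := VectorFourier.fourierIntegral_continuous
    Real.continuous_fourierChar (by fun_prop) h1
  refine ae_eq_of_integral_contDiff_smul_eq ?_ hc.locallyIntegrable ?_
  · exact (Lp.memLp _).locallyIntegrable (by norm_num)
  intro g hg hs
  let gs : 𝓢(ℝ, ℂ) := (hs.comp_left (g := fun t : ℝ => (t : ℂ)) (by simp)).toSchwartzMap
    (Complex.ofRealCLM.contDiff.comp hg)
  have hgs : ∀ x, gs x = (g x : ℂ) := fun x => rfl
  have e1 : ∫ x, g x • (𝓕 (h2.toLp φ) : Lp ℂ 2 (volume : Measure ℝ)) x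
      = Lp.toTemperedDistribution (𝓕 (h2.toLp φ)) gs := by
    rw [Lp.toTemperedDistribution_apply]
    exact integral_congr_ae (.of_forall fun x => by simp [hgs])
  rw [e1, ← Lp.fourier_toTemperedDistribution_eq, TemperedDistribution.fourier_apply,
    Lp.toTemperedDistribution_apply]
  have e2 : ∫ x, (𝓕 gs) x • (h2.toLp φ) x = ∫ x, (𝓕 (gs : ℝ → ℂ)) x * φ x := by
    refine integral_congr_ae ?_
    filter_upwards [h2.coeFn_toLp] with x hx
    rw [hx, SchwartzMap.fourier_coe]; rfl
  rw [e2]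
  have := VectorFourier.integral_fourierIntegral_smul_eq_flip (L := innerₗ ℝ)
    (μ := volume) (ν := volume) Real.continuous_fourierChar (by fun_prop) (f := gs) (g := φ)
    gs.integrable h1
  simp only [smul_eq_mul] at this
  rw [flip_innerₗ] at this
  refine this.trans (integral_congr_ae (.of_forall fun x => ?_))
  simp only [hgs]
  rfl

theorem integral_mul_wave_eq_fourier (φ : ℝ → ℂ) (x s : ℝ) :
    ∫ k, φ k * wave x (s * k) = FourierTransform.fourier φ (-(s / (2 * Real.pi)) * x) := by
  rw [Real.fourier_real_eq_integral_exp_smul]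
  refine integral_congr_ae (.of_forall fun k => ?_)
  simp only [wave, smul_eq_mul]
  rw [mul_comm]
  congr 2
  push_cast
  field_simp

theorem lintegral_comp_mul_left_real (f : ℝ → ENNReal) {a : ℝ} (ha : a ≠ 0) :
    ∫⁻ x, f (a * x) = ENNReal.ofReal |a⁻¹| * ∫⁻ x, f x := by
  rw [← smul_eq_mul, ← lintegral_smul_measure, ← Real.map_volume_mul_left ha,
    show (fun x => a * x) = Homeomorph.mulLeft₀ a ha from rfl,
    (Homeomorph.mulLeft₀ a ha).measurableEmbedding.lintegral_map]
  rfl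

/-- Plancherel, for integrable and square integrable `φ`. -/
theorem lintegral_integral_mul_wave_sq_le {φ : ℝ → ℂ} (h1 : Integrable φ)
    (h2 : Integrable fun k => ‖φ k‖ ^ 2) {s : ℝ} (hs : |s| = 1) :
    ∫⁻ x, ‖∫ k, φ k * wave x (s * k)‖ₑ ^ 2 ≤ ENNReal.ofReal (2 * Real.pi * ∫ k, ‖φ k‖ ^ 2) := by
  have hm : MemLp φ 2 := (memLp_two_iff_integrable_sq_norm h1.1).2 h2
  simp_rw [integral_mul_wave_eq_fourier]
  have hs0 : -(s / (2 * Real.pi)) ≠ 0 := by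
    have : s ≠ 0 := by rintro rfl; simp at hs
    have := Real.pi_ne_zero
    simp; tauto
  rw [lintegral_comp_mul_left_real (fun y => ‖FourierTransform.fourier φ y‖ₑ ^ 2) hs0]
  have e1 : |(-(s / (2 * Real.pi)))⁻¹| = 2 * Real.pi := by
    rw [abs_inv, abs_neg, abs_div, hs, abs_of_pos Real.two_pi_pos]; simp
  have e2 : ∫⁻ x, ‖FourierTransform.fourier φ x‖ₑ ^ 2 = ∫⁻ x, ‖φ x‖ₑ ^ 2 := by
    have a1 : eLpNorm (FourierTransform.fourier φ) 2 = eLpNorm φ 2 := by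
      rw [← eLpNorm_congr_ae (fourier_ae_eq_toLp h1 hm), ← eLpNorm_congr_ae hm.coeFn_toLp,
        ← Lp.enorm_def, ← Lp.enorm_def, ← ofReal_norm, ← ofReal_norm, Lp.norm_fourier_eq]
    have a2 := eLpNorm_nnreal_pow_eq_lintegral (f := FourierTransform.fourier φ) (p := 2)
      (μ := volume) (by norm_num)
    have a3 := eLpNorm_nnreal_pow_eq_lintegral (f := φ) (p := 2) (μ := volume) (by norm_num)
    simp only [ENNReal.coe_ofNat, NNReal.coe_ofNat, ENNReal.rpow_ofNat] at a2 a3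
    rw [← a2, ← a3, a1]
  rw [e1, e2, ENNReal.ofReal_mul Real.two_pi_pos.le, ofReal_integral_eq_lintegral_ofReal h2
    (.of_forall fun k => by positivity)]
  refine mul_le_mul_right (le_of_eq (lintegral_congr fun k => ?_)) _
  rw [ENNReal.ofReal_pow (norm_nonneg _), ofReal_norm]

/-! ### Decoupling two frequencies -/

/-- The fundamental solution of `∂ + 1`: `expKernel k u = exp (u - k)` for `u ≤ k`, and `0` for
`u > k`. -/
def expKernel (k u : ℝ) : ℝ := if u ≤ k then Real.exp (u - k) else 0

theorem expKernel_nonneg (k u : ℝ) : 0 ≤ expKernel k u := by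
  unfold expKernel; split_ifs <;> positivity

theorem expKernel_le_one (k u : ℝ) : expKernel k u ≤ 1 := by
  unfold expKernel; split_ifs with h
  · exact Real.exp_le_one_iff.2 (by linarith)
  · norm_num

theorem measurable_expKernel : Measurable (Function.uncurry expKernel) := by
  refine Measurable.ite (measurableSet_le measurable_snd measurable_fst) ?_ measurable_const
  fun_prop

theorem expKernel_eq_indicator_left (u : ℝ) :
    (fun k => expKernel k u) = (Ici u).indicator fun k => Real.exp u * Real.exp (-k) := by
  ext k
  by_cases h : u ≤ k
  · simp [expKernel, h, sub_eq_add_neg, Real.exp_add]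
  · simp [expKernel, h]

theorem expKernel_eq_indicator_right (k : ℝ) :
    (fun u => expKernel k u) = (Iic k).indicator fun u => Real.exp (u - k) := by
  ext u
  by_cases h : u ≤ k <;> simp [expKernel, h]

theorem integrable_expKernel_left (u : ℝ) : Integrable fun k => expKernel k u := by
  rw [expKernel_eq_indicator_left, integrable_indicator_iff measurableSet_Ici,
    integrableOn_Ici_iff_integrableOn_Ioi]
  have := exp_neg_integrableOn_Ioi u (zero_lt_one)
  simp only [neg_mul, one_mul] at this
  exact this.const_mul _

theorem integral_expKernel_left (u : ℝ) : ∫ k, expKernel k u = 1 := by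
  rw [expKernel_eq_indicator_left, integral_indicator measurableSet_Ici,
    integral_Ici_eq_integral_Ioi, integral_const_mul, integral_exp_neg_Ioi, ← Real.exp_add]
  simp

theorem integrable_expKernel_right (k : ℝ) : Integrable fun u => expKernel k u := by
  rw [expKernel_eq_indicator_right, integrable_indicator_iff measurableSet_Iic]
  simp_rw [sub_eq_add_neg, Real.exp_add]
  exact (integrableOn_exp_Iic k).mul_const _

theorem one_add_sq_inv_pos (t : ℝ) : 0 < (1 + t ^ 2)⁻¹ := by positivity

theorem one_add_sq_inv_le_one (t : ℝ) : (1 + t ^ 2)⁻¹ ≤ 1 :=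
  inv_le_one_of_one_le₀ (by nlinarith [sq_nonneg t])

/-- A function is the convolution of `expKernel` with its image under `∂ + 1`. -/
theorem eq_integral_expKernel {g g' : ℝ → ℂ} (hd : ∀ t, HasDerivAt g (g' t) t) (hg' : Continuous g')
    {M : ℝ} (hgM : ∀ t, ‖g t‖ ≤ M) (hgM' : ∀ t, ‖g' t‖ ≤ M) (k : ℝ) :
    g k = ∫ u, (expKernel k u : ℂ) * (g u + g' u) := by
  have hg : Continuous g := continuous_iff_continuousAt.2 fun t => (hd t).continuousAt
  have e : ∀ u, (expKernel k u : ℂ) * (g u + g' u)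
      = (Iic k).indicator (fun u => (Real.exp (u - k) : ℂ) * (g u + g' u)) u := by
    intro u
    by_cases h : u ≤ k <;> simp [expKernel, h]
  simp_rw [e]
  rw [integral_indicator measurableSet_Iic]
  have hder : ∀ u, HasDerivAt (fun u => (Real.exp (u - k) : ℂ) * g u)
      ((Real.exp (u - k) : ℂ) * (g u + g' u)) u := by
    intro u
    have h1 : HasDerivAt (fun u : ℝ => (Real.exp (u - k) : ℂ)) (Real.exp (u - k) : ℂ) u := by
      have := ((hasDerivAt_id u).sub_const k).exp
      exact (this.congr_deriv (by simp)).ofReal_comp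
    exact (h1.mul (hd u)).congr_deriv (by ring)
  have hi : Integrable (fun u => (expKernel k u : ℂ) * (g u + g' u)) := by
    refine (integrable_expKernel_right k).ofReal.mul_bdd (c := M + M)
      (by fun_prop) (.of_forall fun u => (norm_add_le _ _).trans (add_le_add (hgM u) (hgM' u)))
  have hi' : IntegrableOn (fun u => (Real.exp (u - k) : ℂ) * (g u + g' u)) (Iic k) := by
    rw [← integrable_indicator_iff measurableSet_Iic]
    exact hi.congr (.of_forall e)
  have ht : Tendsto (fun u => (Real.exp (u - k) : ℂ) * g u) atBot (𝓝 0) := by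
    have h0 : Tendsto (fun u => Real.exp (u - k) * M) atBot (𝓝 0) := by
      have : Tendsto (fun u : ℝ => Real.exp (u - k)) atBot (𝓝 0) :=
        Real.tendsto_exp_atBot.comp (tendsto_atBot_add_const_right _ _ tendsto_id)
      simpa using this.mul_const M
    refine squeeze_zero_norm (fun u => ?_) h0
    rw [norm_mul, Complex.norm_real, Real.norm_of_nonneg (Real.exp_pos _).le]
    exact mul_le_mul_of_nonneg_left (hgM u) (Real.exp_pos _).le
  rw [integral_Iic_of_hasDerivAt_of_tendsto (hder k).continuousAt.continuousWithinAt
    (fun u _ => hder u) hi' ht]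
  simp

/-- Two variables are decoupled by writing `g` as a superposition, in its first variable, of
translates of `expKernel`. -/
theorem integral_integral_decouple {B₀ B₁ : ℝ → ℂ} (hB₀ : Continuous B₀) (hB₁ : Continuous B₁)
    {C : ℝ} (hC₀ : ∀ k, ‖B₀ k‖ ≤ C) (hC₁ : ∀ k, ‖B₁ k‖ ≤ C) {g g' : ℝ → ℝ → ℂ}
    (hg : Continuous (Function.uncurry g)) (hg' : Continuous (Function.uncurry g'))
    (hd : ∀ k l, HasDerivAt (fun t => g t l) (g' k l) k) {M : ℝ}
    (hgM : ∀ k l, ‖g k l‖ ≤ M * ((1 + k ^ 2)⁻¹ * (1 + l ^ 2)⁻¹))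
    (hgM' : ∀ k l, ‖g' k l‖ ≤ M * ((1 + k ^ 2)⁻¹ * (1 + l ^ 2)⁻¹)) :
    ∫ k, ∫ l, B₀ k * B₁ l * g k l
      = ∫ u, (∫ k, B₀ k * (expKernel k u : ℂ)) * ∫ l, B₁ l * (g u l + g' u l) := by
  have hM : 0 ≤ M := by
    have := (norm_nonneg _).trans (hgM 0 0); simpa using this
  have hC : 0 ≤ C := (norm_nonneg _).trans (hC₀ 0)
  have hh : Continuous (Function.uncurry fun u l => g u l + g' u l) := hg.add hg'
  have hhM : ∀ u l, ‖g u l + g' u l‖ ≤ (M + M) * ((1 + u ^ 2)⁻¹ * (1 + l ^ 2)⁻¹) := fun u l =>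
    (norm_add_le _ _).trans (by linarith [hgM u l, hgM' u l])
  set h : ℝ → ℝ → ℂ := fun u l => g u l + g' u l
  have hbd : ∀ k l : ℝ, M * ((1 + k ^ 2)⁻¹ * (1 + l ^ 2)⁻¹) ≤ M := fun k l => by
    refine mul_le_of_le_one_right hM (mul_le_one₀ (one_add_sq_inv_le_one k)
      (one_add_sq_inv_pos l).le (one_add_sq_inv_le_one l))
  have hmk : Measurable fun p : ℝ × ℝ => (expKernel p.1 p.2 : ℂ) :=
    Complex.measurable_ofReal.comp measurable_expKernel
  -- the inner integral, for fixed `k`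
  have inner : ∀ k, ∫ l, B₁ l * g k l = ∫ u, (expKernel k u : ℂ) * ∫ l, B₁ l * h u l := by
    intro k
    have e : ∀ l, B₁ l * g k l = ∫ u, (expKernel k u : ℂ) * (B₁ l * h u l) := by
      intro l
      rw [eq_integral_expKernel (fun t => hd t l) (by fun_prop)
        (fun t => (hgM t l).trans (hbd t l)) (fun t => (hgM' t l).trans (hbd t l)) k,
        ← integral_const_mul]
      exact integral_congr_ae (.of_forall fun u => by simp only [h]; ring)
    simp_rw [e]
    rw [integral_integral_swap]
    · exact integral_congr_ae (.of_forall fun u => by simp only [integral_const_mul])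
    refine Integrable.mono' (g := fun p : ℝ × ℝ => (1 + p.1 ^ 2)⁻¹ *
      (C * (M + M) * (1 + p.2 ^ 2)⁻¹))
      (integrable_inv_one_add_sq.mul_prod (integrable_inv_one_add_sq.const_mul _)) ?_ ?_
    · refine Measurable.aestronglyMeasurable ?_
      refine Measurable.mul ?_ ?_
      · exact hmk.comp (measurable_const.prodMk measurable_snd)
      · exact (Continuous.mul (by fun_prop) (hh.comp continuous_swap)).measurable
    · refine .of_forall fun p => ?_
      simp only [Function.uncurry, norm_mul, Complex.norm_real]
      rw [Real.norm_of_nonneg (expKernel_nonneg _ _)]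
      calc expKernel k p.2 * (‖B₁ p.1‖ * ‖h p.2 p.1‖)
          ≤ 1 * (C * ((M + M) * ((1 + p.2 ^ 2)⁻¹ * (1 + p.1 ^ 2)⁻¹))) := by
            gcongr
            · exact expKernel_le_one _ _
            · exact hC₁ _
            · exact hhM _ _
        _ = _ := by ring
  have e : ∀ k, ∫ l, B₀ k * B₁ l * g k l
      = ∫ u, (B₀ k * (expKernel k u : ℂ)) * ∫ l, B₁ l * h u l := by
    intro k
    simp_rw [mul_assoc]
    rw [integral_const_mul, inner, ← integral_const_mul]
  simp_rw [e]
  -- the double integral over `k` and `u` converges absolutely: `expKernel` is integrable in `k`,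
  -- the inner integral in `u`
  have hE : ∀ u, ‖∫ l, B₁ l * h u l‖ ≤ (C * (M + M) * Real.pi) * (1 + u ^ 2)⁻¹ := by
    intro u
    calc ‖∫ l, B₁ l * h u l‖ ≤ ∫ l : ℝ, (C * (M + M) * (1 + u ^ 2)⁻¹) * (1 + l ^ 2)⁻¹ := by
          refine norm_integral_le_of_norm_le (integrable_inv_one_add_sq.const_mul _)
            (.of_forall fun l => ?_)
          rw [norm_mul]
          calc ‖B₁ l‖ * ‖h u l‖ ≤ C * ((M + M) * ((1 + u ^ 2)⁻¹ * (1 + l ^ 2)⁻¹)) := by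
                gcongr
                · exact hC₁ _
                · exact hhM _ _
            _ = _ := by ring
      _ = _ := by rw [integral_const_mul, integral_univ_inv_one_add_sq]; ring
  have hEm : StronglyMeasurable fun u => ∫ l, B₁ l * h u l := by
    refine StronglyMeasurable.integral_prod_right (f := fun u l => B₁ l * h u l) ?_
    exact (Continuous.mul (by fun_prop) hh).stronglyMeasurable
  rw [integral_integral_swap]
  · exact integral_congr_ae (.of_forall fun u => by simp only [integral_mul_const, h])
  have hmeas : AEStronglyMeasurable (Function.uncurry fun k u =>
      (B₀ k * (expKernel k u : ℂ)) * ∫ l, B₁ l * h u l) (volume.prod volume) := by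
    refine Measurable.aestronglyMeasurable ?_
    refine Measurable.mul (Measurable.mul ?_ hmk) (hEm.measurable.comp measurable_snd)
    exact hB₀.measurable.comp measurable_fst
  have hbound : ∀ k u, ‖(B₀ k * (expKernel k u : ℂ)) * ∫ l, B₁ l * h u l‖
      ≤ expKernel k u * (C * ((C * (M + M) * Real.pi) * (1 + u ^ 2)⁻¹)) := by
    intro k u
    rw [norm_mul, norm_mul, Complex.norm_real, Real.norm_of_nonneg (expKernel_nonneg _ _)]
    calc ‖B₀ k‖ * expKernel k u * ‖∫ l, B₁ l * h u l‖
        ≤ C * expKernel k u * ((C * (M + M) * Real.pi) * (1 + u ^ 2)⁻¹) := by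
          gcongr
          · exact mul_nonneg hC (expKernel_nonneg _ _)
          · exact expKernel_nonneg _ _
          · exact hC₀ _
          · exact hE _
      _ = _ := by ring
  refine Integrable.mono' (g := Function.uncurry fun k u =>
    expKernel k u * (C * ((C * (M + M) * Real.pi) * (1 + u ^ 2)⁻¹))) ?_ hmeas
    (.of_forall fun p => hbound p.1 p.2)
  refine (integrable_prod_iff' ?_).2 ⟨.of_forall fun u => ?_, ?_⟩
  · exact (measurable_expKernel.mul (by fun_prop)).aestronglyMeasurable
  · simp only [Function.uncurry]
    exact (integrable_expKernel_left u).mul_const _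
  · have hn : ∀ k u, ‖expKernel k u * (C * ((C * (M + M) * Real.pi) * (1 + u ^ 2)⁻¹))‖
        = expKernel k u * (C * ((C * (M + M) * Real.pi) * (1 + u ^ 2)⁻¹)) := fun k u =>
      Real.norm_of_nonneg (mul_nonneg (expKernel_nonneg _ _) (by positivity))
    simp only [Function.uncurry, hn, integral_mul_const, integral_expKernel_left]
    exact ((integrable_inv_one_add_sq.const_mul _).const_mul _).const_mul _

theorem lintegral_expKernel_wave_sq_le {b₀ : ℝ → ℂ} (hb₀ : Continuous b₀) {C : ℝ}
    (hC₀ : ∀ k, ‖b₀ k‖ ≤ C) {s₀ : ℝ} (hs₀ : |s₀| = 1) (u : ℝ) :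
    ∫⁻ x, ‖∫ k, (b₀ k * (expKernel k u : ℂ)) * wave x (s₀ * k)‖ₑ ^ 2
      ≤ ENNReal.ofReal (2 * Real.pi * C ^ 2) := by
  have hn : ∀ k, ‖b₀ k * (expKernel k u : ℂ)‖ ≤ C * expKernel k u := fun k => by
    rw [norm_mul, Complex.norm_real, Real.norm_of_nonneg (expKernel_nonneg _ _)]
    exact mul_le_mul_of_nonneg_right (hC₀ k) (expKernel_nonneg _ _)
  have hn2 : ∀ k, ‖b₀ k * (expKernel k u : ℂ)‖ ^ 2 ≤ C ^ 2 * expKernel k u := fun k => by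
    have h0 := expKernel_nonneg k u
    have h1 := expKernel_le_one k u
    calc _ ≤ (C * expKernel k u) ^ 2 := by gcongr; exact hn k
      _ = C ^ 2 * (expKernel k u * expKernel k u) := by ring
      _ ≤ C ^ 2 * (expKernel k u * 1) := by gcongr
      _ = _ := by ring
  have hm : AEStronglyMeasurable (fun k => b₀ k * (expKernel k u : ℂ)) :=
    hb₀.aestronglyMeasurable.mul (integrable_expKernel_left u).ofReal.1
  have hI2 : Integrable fun k => ‖b₀ k * (expKernel k u : ℂ)‖ ^ 2 :=
    ((integrable_expKernel_left u).const_mul (C ^ 2)).mono' (hm.norm.pow 2)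
      (.of_forall fun k => by rw [Real.norm_of_nonneg (by positivity)]; exact hn2 k)
  refine (lintegral_integral_mul_wave_sq_le
    (((integrable_expKernel_left u).const_mul C).mono' hm (.of_forall hn)) hI2 hs₀).trans ?_
  refine ENNReal.ofReal_le_ofReal (mul_le_mul_of_nonneg_left ?_ Real.two_pi_pos.le)
  refine (integral_mono hI2 ((integrable_expKernel_left u).const_mul (C ^ 2)) hn2).trans ?_
  rw [integral_const_mul, integral_expKernel_left, mul_one]

theorem lintegral_decay_wave_sq_le {b₁ h : ℝ → ℂ} (hb₁ : Continuous b₁) (hh : Continuous h) {C : ℝ}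
    (hC₁ : ∀ k, ‖b₁ k‖ ≤ C) {r : ℝ} (hr : ∀ l, ‖h l‖ ≤ r * (1 + l ^ 2)⁻¹) {s₁ : ℝ}
    (hs₁ : |s₁| = 1) :
    ∫⁻ x, ‖∫ l, (b₁ l * h l) * wave x (s₁ * l)‖ₑ ^ 2
      ≤ ENNReal.ofReal (2 * Real.pi * (C ^ 2 * r ^ 2 * Real.pi)) := by
  have hC : 0 ≤ C := (norm_nonneg _).trans (hC₁ 0)
  have hn : ∀ l, ‖b₁ l * h l‖ ≤ (C * r) * (1 + l ^ 2)⁻¹ :=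
    fun l => by
      rw [norm_mul]
      calc _ ≤ C * (r * (1 + l ^ 2)⁻¹) := by
            gcongr
            · exact hC₁ _
            · exact hr l
        _ = _ := by ring
  have hn2 : ∀ l, ‖b₁ l * h l‖ ^ 2
      ≤ (C ^ 2 * r ^ 2) * (1 + l ^ 2)⁻¹ := fun l => by
    have h0 := one_add_sq_inv_pos l
    have h1 := one_add_sq_inv_le_one l
    calc _ ≤ ((C * r) * (1 + l ^ 2)⁻¹) ^ 2 := by gcongr; exact hn l
      _ = (C ^ 2 * r ^ 2) * ((1 + l ^ 2)⁻¹ * (1 + l ^ 2)⁻¹) := by ring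
      _ ≤ (C ^ 2 * r ^ 2) * ((1 + l ^ 2)⁻¹ * 1) := by gcongr
      _ = _ := by ring
  have hm : AEStronglyMeasurable (fun l => b₁ l * h l) := by
    refine Continuous.aestronglyMeasurable (hb₁.mul hh)
  have hI2 : Integrable fun l => ‖b₁ l * h l‖ ^ 2 :=
    (integrable_inv_one_add_sq.const_mul _).mono' (hm.norm.pow 2)
      (.of_forall fun k => by rw [Real.norm_of_nonneg (by positivity)]; exact hn2 k)
  refine (lintegral_integral_mul_wave_sq_le
    ((integrable_inv_one_add_sq.const_mul _).mono' hm (.of_forall hn)) hI2 hs₁).trans ?_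
  refine ENNReal.ofReal_le_ofReal (mul_le_mul_of_nonneg_left ?_ Real.two_pi_pos.le)
  refine (integral_mono hI2 (integrable_inv_one_add_sq.const_mul _) hn2).trans ?_
  rw [integral_const_mul, integral_univ_inv_one_add_sq]

/-- The weighted arithmetic-geometric inequality replaces Cauchy–Schwarz; the weight `r` lets a
bound that decays in a parameter enter linearly. -/
theorem lintegral_enorm_mul_enorm_le {A E : ℝ → ℂ} (hA : Measurable A) {r a b : ℝ} (hr : 0 < r)
    (ha : 0 ≤ a) (hb : 0 ≤ b) (hAa : ∫⁻ x, ‖A x‖ₑ ^ 2 ≤ ENNReal.ofReal a)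
    (hEb : ∫⁻ x, ‖E x‖ₑ ^ 2 ≤ ENNReal.ofReal b) :
    ∫⁻ x, ‖A x‖ₑ * ‖E x‖ₑ ≤ ENNReal.ofReal (r * a + r⁻¹ * b) := by
  have hr' := inv_pos.2 hr
  have key : ∀ x, ‖A x‖ₑ * ‖E x‖ₑ
      ≤ ENNReal.ofReal r * ‖A x‖ₑ ^ 2 + ENNReal.ofReal r⁻¹ * ‖E x‖ₑ ^ 2 := by
    intro x
    simp only [← ofReal_norm]
    rw [← ENNReal.ofReal_mul (norm_nonneg _), ← ENNReal.ofReal_pow (norm_nonneg _),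
      ← ENNReal.ofReal_pow (norm_nonneg _), ← ENNReal.ofReal_mul hr.le,
      ← ENNReal.ofReal_mul hr'.le, ← ENNReal.ofReal_add (by positivity) (by positivity)]
    refine ENNReal.ofReal_le_ofReal ?_
    have h1 : 0 ≤ r⁻¹ * (r * ‖A x‖ - ‖E x‖) ^ 2 := by positivity
    have h2 : r⁻¹ * (r * ‖A x‖ - ‖E x‖) ^ 2
        = r * ‖A x‖ ^ 2 + r⁻¹ * ‖E x‖ ^ 2 - 2 * (‖A x‖ * ‖E x‖) := by
      field_simp; ring
    have h3 : 0 ≤ ‖A x‖ * ‖E x‖ := by positivity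
    linarith
  refine (lintegral_mono key).trans ?_
  rw [lintegral_add_left (by fun_prop), lintegral_const_mul' _ _ ENNReal.ofReal_ne_top,
    lintegral_const_mul' _ _ ENNReal.ofReal_ne_top]
  refine (add_le_add (mul_le_mul_right hAa _) (mul_le_mul_right hEb _)).trans (le_of_eq ?_)
  rw [← ENNReal.ofReal_mul hr.le, ← ENNReal.ofReal_mul hr'.le,
    ← ENNReal.ofReal_add (by positivity) (by positivity)]

/-- The oscillating integral over two frequencies is integrable in `x`. The factors `b₀` and `b₁`
are merely bounded and continuous: after decoupling, the integral is a superposition of products of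
two `L²` functions of `x`, and only `g` is differentiated. -/
theorem lintegral_integral_integral_wave_le {b₀ b₁ : ℝ → ℂ} (hb₀ : Continuous b₀)
    (hb₁ : Continuous b₁) {C : ℝ} (hC₀ : ∀ k, ‖b₀ k‖ ≤ C) (hC₁ : ∀ k, ‖b₁ k‖ ≤ C)
    {g g' : ℝ → ℝ → ℂ} (hg : Continuous (Function.uncurry g))
    (hg' : Continuous (Function.uncurry g'))
    (hd : ∀ k l, HasDerivAt (fun t => g t l) (g' k l) k) {M : ℝ} (hM : 0 < M)
    (hgM : ∀ k l, ‖g k l‖ ≤ M * ((1 + k ^ 2)⁻¹ * (1 + l ^ 2)⁻¹))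
    (hgM' : ∀ k l, ‖g' k l‖ ≤ M * ((1 + k ^ 2)⁻¹ * (1 + l ^ 2)⁻¹))
    {s₀ s₁ : ℝ} (hs₀ : |s₀| = 1) (hs₁ : |s₁| = 1) :
    ∫⁻ x, ‖∫ k, ∫ l, (b₀ k * wave x (s₀ * k)) * (b₁ l * wave x (s₁ * l)) * g k l‖ₑ
      ≤ ENNReal.ofReal (4 * Real.pi ^ 2 * (1 + Real.pi) * C ^ 2 * M) := by
  have hC : 0 ≤ C := (norm_nonneg _).trans (hC₀ 0)
  have hh : Continuous (Function.uncurry fun u l => g u l + g' u l) := hg.add hg'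
  have hhM : ∀ u l, ‖g u l + g' u l‖ ≤ (2 * M) * ((1 + u ^ 2)⁻¹ * (1 + l ^ 2)⁻¹) := fun u l =>
    (norm_add_le _ _).trans (by linarith [hgM u l, hgM' u l])
  set A : ℝ → ℝ → ℂ := fun x u => ∫ k, (b₀ k * wave x (s₀ * k)) * (expKernel k u : ℂ)
  set E : ℝ → ℝ → ℂ := fun x u => ∫ l, (b₁ l * wave x (s₁ * l)) * (g u l + g' u l)
  have hAm : StronglyMeasurable (Function.uncurry A) := by
    refine StronglyMeasurable.integral_prod_right (f := fun (p : ℝ × ℝ) k =>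
      (b₀ k * wave p.1 (s₀ * k)) * (expKernel k p.2 : ℂ)) (Measurable.stronglyMeasurable ?_)
    refine Measurable.mul (Measurable.mul ?_ ?_) ?_
    · exact hb₀.measurable.comp measurable_snd
    · exact Continuous.measurable (by fun_prop)
    · exact Complex.measurable_ofReal.comp (measurable_expKernel.comp
        (measurable_snd.prodMk (measurable_snd.comp measurable_fst)))
  have hEm : StronglyMeasurable (Function.uncurry E) := by
    refine StronglyMeasurable.integral_prod_right (f := fun (p : ℝ × ℝ) l =>
      (b₁ l * wave p.1 (s₁ * l)) * (g p.2 l + g' p.2 l)) (Continuous.stronglyMeasurable ?_)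
    refine Continuous.mul (by fun_prop) ?_
    exact hh.comp (f := fun p : (ℝ × ℝ) × ℝ => (p.1.2, p.2)) (by fun_prop)
  have hA2 : ∀ u, ∫⁻ x, ‖A x u‖ₑ ^ 2 ≤ ENNReal.ofReal (2 * Real.pi * C ^ 2) := by
    intro u
    refine le_trans (le_of_eq (lintegral_congr fun x => ?_))
      (lintegral_expKernel_wave_sq_le hb₀ hC₀ hs₀ u)
    congr 2
    exact integral_congr_ae (.of_forall fun k => by ring)
  have hE2 : ∀ u, ∫⁻ x, ‖E x u‖ₑ ^ 2
      ≤ ENNReal.ofReal (2 * Real.pi * (C ^ 2 * (2 * M * (1 + u ^ 2)⁻¹) ^ 2 * Real.pi)) := by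
    intro u
    have hu := one_add_sq_inv_pos u
    refine le_trans (le_of_eq (lintegral_congr fun x => ?_))
      (lintegral_decay_wave_sq_le (h := fun l => g u l + g' u l) hb₁
        (hh.comp (f := fun l : ℝ => (u, l)) (by fun_prop)) hC₁
        (fun l => (hhM u l).trans (le_of_eq (by ring))) hs₁)
    congr 2
    exact integral_congr_ae (.of_forall fun k => by ring)
  have hAE : ∀ u, ∫⁻ x, ‖A x u‖ₑ * ‖E x u‖ₑ
      ≤ ENNReal.ofReal ((4 * Real.pi * (1 + Real.pi) * C ^ 2 * M) * (1 + u ^ 2)⁻¹) := by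
    intro u
    have hu := one_add_sq_inv_pos u
    refine (lintegral_enorm_mul_enorm_le (r := 2 * M * (1 + u ^ 2)⁻¹)
      (hAm.measurable.comp measurable_prodMk_right) (by positivity) (by positivity)
      (by positivity) (hA2 u) (hE2 u)).trans (le_of_eq ?_)
    congr 1
    field_simp
    ring
  calc ∫⁻ x, ‖∫ k, ∫ l, (b₀ k * wave x (s₀ * k)) * (b₁ l * wave x (s₁ * l)) * g k l‖ₑ
      = ∫⁻ x, ‖∫ u, A x u * E x u‖ₑ := by
        refine lintegral_congr fun x => ?_
        rw [integral_integral_decouple (B₀ := fun k => b₀ k * wave x (s₀ * k))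
          (B₁ := fun l => b₁ l * wave x (s₁ * l)) (by fun_prop) (by fun_prop)
          (fun k => by rw [norm_mul, norm_wave, mul_one]; exact hC₀ k)
          (fun k => by rw [norm_mul, norm_wave, mul_one]; exact hC₁ k) hg hg' hd hgM hgM']
    _ ≤ ∫⁻ x, ∫⁻ u, ‖A x u‖ₑ * ‖E x u‖ₑ := by
        refine lintegral_mono fun x => (enorm_integral_le_lintegral_enorm _).trans
          (le_of_eq (lintegral_congr fun u => ?_))
        rw [enorm_mul]
    _ = ∫⁻ u, ∫⁻ x, ‖A x u‖ₑ * ‖E x u‖ₑ := by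
        refine lintegral_lintegral_swap ?_
        exact (hAm.enorm.mul hEm.enorm).aemeasurable
    _ ≤ ∫⁻ u : ℝ, ENNReal.ofReal ((4 * Real.pi * (1 + Real.pi) * C ^ 2 * M) * (1 + u ^ 2)⁻¹) :=
        lintegral_mono hAE
    _ = _ := by
        rw [← ofReal_integral_eq_lintegral_ofReal (integrable_inv_one_add_sq.const_mul _)
          (.of_forall fun u => by positivity), integral_const_mul, integral_univ_inv_one_add_sq]
        congr 1; ring

/-! ### Amplitudes on `ℝ⁴` -/

theorem measurePreserving_insertNth {n : ℕ} (i : Fin (n + 1)) :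
    MeasurePreserving (fun p : ℝ × (Fin n → ℝ) => (i.insertNth p.1 p.2 : Fin (n + 1) → ℝ)) :=
  (volume_preserving_piFinSuccAbove (fun _ : Fin (n + 1) => ℝ) i).symm

theorem integrable_insertNth {n : ℕ} (i : Fin (n + 1)) {F : (Fin (n + 1) → ℝ) → ℂ}
    (hF : Integrable F) :
    Integrable fun p : ℝ × (Fin n → ℝ) => F (i.insertNth p.1 p.2) :=
  (measurePreserving_insertNth i).integrable_comp_of_integrable hF

theorem integral_insertNth {n : ℕ} (i : Fin (n + 1)) {F : (Fin (n + 1) → ℝ) → ℂ}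
    (hF : Integrable F) :
    ∫ k, F k = ∫ z : Fin n → ℝ, ∫ a : ℝ, F (i.insertNth a z) := by
  have h := (volume_preserving_piFinSuccAbove (fun _ : Fin (n + 1) => ℝ) i).symm.integral_comp
    (MeasurableEquiv.measurableEmbedding _) F
  rw [← h]
  exact integral_prod_symm _ (integrable_insertNth i hF)

/-- The weight `∏ j, (1 + k j ^ 2)⁻¹`. -/
def prodDecay {n : ℕ} (k : Fin n → ℝ) : ℝ := ∏ j, (1 + k j ^ 2)⁻¹

theorem prodDecay_pos {n : ℕ} (k : Fin n → ℝ) : 0 < prodDecay k :=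
  Finset.prod_pos fun _ _ => one_add_sq_inv_pos _

theorem prodDecay_cons {n : ℕ} (a : ℝ) (k : Fin n → ℝ) :
    prodDecay (Fin.cons a k : Fin (n + 1) → ℝ) = (1 + a ^ 2)⁻¹ * prodDecay k := by
  rw [prodDecay, Fin.prod_univ_succ]
  simp only [Fin.cons_zero, Fin.cons_succ, prodDecay]

theorem integrable_prodDecay {n : ℕ} : Integrable (prodDecay (n := n)) :=
  Integrable.fintype_prod (μ := fun _ => volume) fun _ => integrable_inv_one_add_sq

theorem exists_prodDecay_bound (G : 𝓢(Fin 4 → ℝ, ℂ)) :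
    ∃ M, 0 < M ∧ ∀ k, ‖G k‖ ≤ M * prodDecay k := by
  set c : ℝ := 2 ^ 8 * ((Finset.Iic ((8, 0) : ℕ × ℕ)).sup
    fun m => SchwartzMap.seminorm ℂ m.1 m.2) G
  refine ⟨c + 1, ?_, fun k => ?_⟩
  · have : 0 ≤ c := by positivity
    linarith
  have h := SchwartzMap.one_add_le_sup_seminorm_apply (𝕜 := ℂ) (m := (8, 0)) (k := 8) (n := 0)
    le_rfl le_rfl G k
  rw [norm_iteratedFDeriv_zero] at h
  have h1 : ∏ j, (1 + k j ^ 2) ≤ (1 + ‖k‖) ^ 8 := by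
    calc ∏ j, (1 + k j ^ 2) ≤ ∏ _j : Fin 4, (1 + ‖k‖) ^ 2 := by
          refine Finset.prod_le_prod (fun j _ => by positivity) fun j _ => ?_
          have := norm_le_pi_norm k j
          rw [Real.norm_eq_abs] at this
          nlinarith [sq_abs (k j), abs_nonneg (k j), norm_nonneg k]
      _ = _ := by simp [← pow_mul]
  have h2 : 0 < ∏ j, (1 + k j ^ 2) := Finset.prod_pos fun j _ => by positivity
  have h3 : prodDecay k = (∏ j, (1 + k j ^ 2))⁻¹ := Finset.prod_inv_distrib _
  rw [h3, ← div_eq_mul_inv, le_div_iff₀ h2, mul_comm]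
  calc _ ≤ (1 + ‖k‖) ^ 8 * ‖G k‖ := by gcongr
    _ ≤ c := h
    _ ≤ c + 1 := by linarith

theorem continuous_sdot (ε : Fin 4 → ℤˣ) : Continuous (sdot ε) := by
  unfold sdot; fun_prop

theorem abs_unit_cast (e : ℤˣ) : |((e : ℤ) : ℝ)| = 1 := by
  rcases Int.units_eq_one_or e with h | h <;> simp [h]

/-- The point `(l, k, y₀, y₁)`. -/
def consTwo (l k : ℝ) (y : Fin 2 → ℝ) : Fin 4 → ℝ := Fin.cons l (Fin.cons k y : Fin 3 → ℝ)

theorem consTwo_eq (l k : ℝ) (y : Fin 2 → ℝ) : consTwo l k y = ![l, k, y 0, y 1] := by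
  ext j; fin_cases j <;> rfl

theorem continuous_consTwo : Continuous fun p : ℝ × ℝ × (Fin 2 → ℝ) =>
    consTwo p.1 p.2.1 p.2.2 := by
  simp_rw [consTwo_eq]
  refine continuous_pi fun j => ?_
  fin_cases j <;> simp <;> fun_prop

theorem hasDerivAt_consTwo (l k : ℝ) (y : Fin 2 → ℝ) :
    HasDerivAt (fun t => consTwo l t y) (Pi.single 1 1) k := by
  simp_rw [consTwo_eq]
  rw [hasDerivAt_pi]
  intro j
  fin_cases j
  · exact hasDerivAt_const _ _
  · exact hasDerivAt_id _
  · exact hasDerivAt_const _ _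
  · exact hasDerivAt_const _ _

theorem prodDecay_consTwo (l k : ℝ) (y : Fin 2 → ℝ) :
    prodDecay (consTwo l k y) = prodDecay y * ((1 + k ^ 2)⁻¹ * (1 + l ^ 2)⁻¹) := by
  rw [consTwo, prodDecay_cons, prodDecay_cons]; ring

theorem integral_consTwo {F : (Fin 4 → ℝ) → ℂ} (hF : Integrable F) :
    ∫ k, F k = ∫ y : Fin 2 → ℝ, ∫ k, ∫ l, F (consTwo l k y) := by
  have hI : Integrable fun z : Fin 3 → ℝ => ∫ a : ℝ, F (Fin.insertNth 0 a z) :=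
    (integrable_insertNth 0 hF).integral_prod_right
  rw [integral_insertNth 0 hF, integral_insertNth 0 hI]
  simp only [consTwo, Fin.insertNth_zero']

/-- The functions of `k ∈ ℝ⁴` against which the oscillating factor `exp (i x ε · k)` is
integrated: continuous, decaying, and with an integrable Fourier transform along each
`ε`-direction. -/
structure Amplitude (F : (Fin 4 → ℝ) → ℂ) : Prop where
  continuous : Continuous F
  decay : ∃ M, ∀ k, ‖F k‖ ≤ M * prodDecay k
  integrable_wave : ∀ ε : Fin 4 → ℤˣ, Integrable fun x => ∫ k, F k * wave x (sdot ε k)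

theorem Amplitude.integrable {F : (Fin 4 → ℝ) → ℂ} (hF : Amplitude F) : Integrable F := by
  obtain ⟨M, hM⟩ := hF.decay
  exact (integrable_prodDecay.const_mul M).mono' hF.continuous.aestronglyMeasurable
    (.of_forall hM)

/-- The product of a Schwartz function with a tensor product of bounded continuous functions has
an integrable Fourier transform in the direction `ε`, although the factors have no modulus
of continuity: two of the four variables already suffice to give a product of two
`L²` functions of `x`. -/
theorem amplitude_prod_mul {b : Fin 4 → ℝ → ℂ} (hb : ∀ j, Continuous (b j))
    (hC : ∃ C, ∀ j k, ‖b j k‖ ≤ C) (G : 𝓢(Fin 4 → ℝ, ℂ)) :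
    Amplitude fun k => (∏ j, b j (k j)) * G k := by
  obtain ⟨C, hC0, hCb⟩ : ∃ C, 0 < C ∧ ∀ j k, ‖b j k‖ ≤ C := by
    obtain ⟨C, hC⟩ := hC
    exact ⟨|C| + 1, by positivity, fun j k => (hC j k).trans (by linarith [le_abs_self C])⟩
  obtain ⟨M₀, hM₀, hG⟩ := exists_prodDecay_bound G
  obtain ⟨M₁, hM₁, hG'⟩ := exists_prodDecay_bound
    (LineDeriv.lineDerivOp (Pi.single 1 1 : Fin 4 → ℝ) G)
  set M := max M₀ M₁
  have hM : 0 < M := lt_max_of_lt_left hM₀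
  have hGM : ∀ k, ‖G k‖ ≤ M * prodDecay k := fun k => (hG k).trans
    (mul_le_mul_of_nonneg_right (le_max_left _ _) (prodDecay_pos k).le)
  have hGM' : ∀ k, ‖LineDeriv.lineDerivOp (Pi.single 1 1 : Fin 4 → ℝ) G k‖ ≤ M * prodDecay k :=
    fun k => (hG' k).trans
      (mul_le_mul_of_nonneg_right (le_max_right _ _) (prodDecay_pos k).le)
  set F : (Fin 4 → ℝ) → ℂ := fun k => (∏ j, b j (k j)) * G k
  have hFc : Continuous F := by
    refine Continuous.mul (continuous_finsetProd _ fun j _ => ?_) G.continuous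
    exact (hb j).comp (continuous_apply j)
  have hFd : ∀ k, ‖F k‖ ≤ (C ^ 4 * M) * prodDecay k := by
    intro k
    rw [norm_mul, mul_assoc, norm_prod]
    refine mul_le_mul ?_ (hGM k) (norm_nonneg _) (by positivity)
    calc ∏ j, ‖b j (k j)‖ ≤ ∏ _j : Fin 4, C :=
          Finset.prod_le_prod (fun j _ => norm_nonneg _) fun j _ => hCb j _
      _ = C ^ 4 := by simp
  have hFi : Integrable F :=
    (integrable_prodDecay.const_mul _).mono' hFc.aestronglyMeasurable (.of_forall hFd)
  refine ⟨hFc, ⟨_, hFd⟩, fun ε => ?_⟩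
  have hsd := continuous_sdot ε
  have hmeas : StronglyMeasurable fun x => ∫ k, F k * wave x (sdot ε k) := by
    refine StronglyMeasurable.integral_prod_right (f := fun x k => F k * wave x (sdot ε k)) ?_
    exact Continuous.stronglyMeasurable (by fun_prop)
  refine ⟨hmeas.aestronglyMeasurable, ?_⟩
  have hJ : ∀ x, ∫ k, F k * wave x (sdot ε k)
      = ∫ y, ∫ k, ∫ l, F (consTwo l k y) * wave x (sdot ε (consTwo l k y)) := fun x =>
    integral_consTwo (hFi.mul_bdd (c := 1) (Continuous.aestronglyMeasurable (by fun_prop))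
      (.of_forall fun k => (norm_wave _ _).le))
  have hJm : AEMeasurable (Function.uncurry fun x y =>
      ‖∫ k, ∫ l, F (consTwo l k y) * wave x (sdot ε (consTwo l k y))‖ₑ)
      ((volume : Measure ℝ).prod (volume : Measure (Fin 2 → ℝ))) := by
    refine (StronglyMeasurable.enorm ?_).aemeasurable
    refine StronglyMeasurable.integral_prod_right (f := fun (p : ℝ × (Fin 2 → ℝ)) (k : ℝ) =>
      ∫ l, F (consTwo l k p.2) * wave p.1 (sdot ε (consTwo l k p.2))) ?_
    refine StronglyMeasurable.integral_prod_right
      (f := fun (p : (ℝ × (Fin 2 → ℝ)) × ℝ) (l : ℝ) =>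
        F (consTwo l p.2 p.1.2) * wave p.1.1 (sdot ε (consTwo l p.2 p.1.2))) ?_
    have hc : Continuous fun q : ((ℝ × (Fin 2 → ℝ)) × ℝ) × ℝ => consTwo q.2 q.1.2 q.1.1.2 :=
      continuous_consTwo.comp (f := fun q : ((ℝ × (Fin 2 → ℝ)) × ℝ) × ℝ =>
        (q.2, q.1.2, q.1.1.2)) (by fun_prop)
    exact Continuous.stronglyMeasurable (by fun_prop)
  -- for fixed last two coordinates, the oscillation in the first two gives integrability in `x`
  have hy : ∀ y : Fin 2 → ℝ,
      ∫⁻ x, ‖∫ k, ∫ l, F (consTwo l k y) * wave x (sdot ε (consTwo l k y))‖ₑ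
      ≤ ENNReal.ofReal ((4 * Real.pi ^ 2 * (1 + Real.pi) * C ^ 2 * (C ^ 2 * M)) * prodDecay y) := by
    intro y
    set w : ℂ := b 2 (y 0) * b 3 (y 1)
    have hw : ‖w‖ ≤ C ^ 2 := by
      rw [norm_mul, sq]
      exact mul_le_mul (hCb _ _) (hCb _ _) (norm_nonneg _) hC0.le
    have hp := prodDecay_pos y
    have hcy : Continuous fun q : ℝ × ℝ => consTwo q.2 q.1 y :=
      continuous_consTwo.comp (f := fun q : ℝ × ℝ => (q.2, q.1, y)) (by fun_prop)
    have key := lintegral_integral_integral_wave_le (hb 1) (hb 0) (hCb 1) (hCb 0)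
      (g := fun k l => w * G (consTwo l k y))
      (g' := fun k l => w * LineDeriv.lineDerivOp (Pi.single 1 1 : Fin 4 → ℝ) G (consTwo l k y))
      (continuous_const.mul (G.continuous.comp hcy))
      (continuous_const.mul ((SchwartzMap.continuous _).comp hcy))
      (fun k l => ((G.hasFDerivAt _).comp_hasDerivAt k (hasDerivAt_consTwo l k y)).const_mul w)
      (M := C ^ 2 * M * prodDecay y) (by positivity)
      (fun k l => by
        rw [norm_mul]
        refine (mul_le_mul hw (hGM _) (norm_nonneg _) (by positivity)).trans (le_of_eq ?_)
        rw [prodDecay_consTwo]; ring)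
      (fun k l => by
        rw [norm_mul]
        refine (mul_le_mul hw (hGM' _) (norm_nonneg _) (by positivity)).trans (le_of_eq ?_)
        rw [prodDecay_consTwo]; ring)
      (abs_unit_cast (ε 1)) (abs_unit_cast (ε 0))
    refine le_trans (lintegral_mono fun x => le_of_eq ?_) (key.trans (le_of_eq ?_))
    · have e : ∀ k l, F (consTwo l k y) * wave x (sdot ε (consTwo l k y))
          = wave x (((ε 2 : ℤ) : ℝ) * y 0 + ((ε 3 : ℤ) : ℝ) * y 1) *
            ((b 1 k * wave x (((ε 1 : ℤ) : ℝ) * k)) * (b 0 l * wave x (((ε 0 : ℤ) : ℝ) * l)) *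
              (w * G (consTwo l k y))) := by
        intro k l
        have h1 : sdot ε (consTwo l k y) = (((ε 2 : ℤ) : ℝ) * y 0 + ((ε 3 : ℤ) : ℝ) * y 1)
            + (((ε 1 : ℤ) : ℝ) * k + ((ε 0 : ℤ) : ℝ) * l) := by
          simp [sdot, Fin.sum_univ_four, consTwo_eq]; ring
        have h2 : ∏ j, b j (consTwo l k y j) = b 0 l * b 1 k * w := by
          simp [Fin.prod_univ_four, consTwo_eq, w]; ring
        rw [h1, ← wave_mul_wave, ← wave_mul_wave x (((ε 1 : ℤ) : ℝ) * k)]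
        simp only [F, h2]; ring
      simp_rw [e, integral_const_mul, enorm_mul]
      rw [← ofReal_norm (wave _ _), norm_wave, ENNReal.ofReal_one, one_mul]
    · congr 1; ring
  calc ∫⁻ x, ‖∫ k, F k * wave x (sdot ε k)‖ₑ
      ≤ ∫⁻ x, ∫⁻ y, ‖∫ k, ∫ l, F (consTwo l k y) * wave x (sdot ε (consTwo l k y))‖ₑ := by
        refine lintegral_mono fun x => ?_
        rw [hJ]
        exact enorm_integral_le_lintegral_enorm _
    _ = ∫⁻ y, ∫⁻ x, ‖∫ k, ∫ l, F (consTwo l k y) * wave x (sdot ε (consTwo l k y))‖ₑ :=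
        lintegral_lintegral_swap hJm
    _ ≤ ∫⁻ y : Fin 2 → ℝ, ENNReal.ofReal
          ((4 * Real.pi ^ 2 * (1 + Real.pi) * C ^ 2 * (C ^ 2 * M)) * prodDecay y) :=
        lintegral_mono hy
    _ < ⊤ := (integrable_prodDecay.const_mul _).lintegral_lt_top

/-! ### Integration over the hyperplanes `ε · k = s` -/

/-- The point of the hyperplane `ε · k = s` whose first three coordinates are `q`. -/
def fiberPoint (ε : Fin 4 → ℤˣ) (q : Fin 3 → ℝ) (s : ℝ) : Fin 4 → ℝ :=
  ![q 0, q 1, q 2, ((ε 3 : ℤ) : ℝ) *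
    (s - (((ε 0 : ℤ) : ℝ) * q 0 + ((ε 1 : ℤ) : ℝ) * q 1 + ((ε 2 : ℤ) : ℝ) * q 2))]

theorem fiberPoint_zero (ε : Fin 4 → ℤˣ) (q : Fin 3 → ℝ) : fiberPoint ε q 0 = hyperPoint ε q := by
  simp only [fiberPoint, hyperPoint, zero_sub, mul_neg]

theorem unit_cast_mul_self (e : ℤˣ) : ((e : ℤ) : ℝ) * ((e : ℤ) : ℝ) = 1 := by
  rcases Int.units_eq_one_or e with h | h <;> simp [h]

theorem sdot_fiberPoint (ε : Fin 4 → ℤˣ) (q : Fin 3 → ℝ) (s : ℝ) :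
    sdot ε (fiberPoint ε q s) = s := by
  simp only [sdot, Fin.sum_univ_four, fiberPoint]
  simp only [Matrix.cons_val]
  rw [← mul_assoc, unit_cast_mul_self]; ring

theorem continuous_fiberPoint (ε : Fin 4 → ℤˣ) :
    Continuous fun p : (Fin 3 → ℝ) × ℝ => fiberPoint ε p.1 p.2 := by
  refine continuous_pi fun j => ?_
  fin_cases j <;> simp [fiberPoint] <;> fun_prop

/-- The coefficient of the last coordinate in `ε · k` is `±1`, so that no Jacobian appears. -/
theorem measurePreserving_fiberPoint (ε : Fin 4 → ℤˣ) :
    MeasurePreserving (fun p : (Fin 3 → ℝ) × ℝ => fiberPoint ε p.1 p.2) := by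
  have h1 : MeasurePreserving (fun p : (Fin 3 → ℝ) × ℝ => (p.1, ((ε 3 : ℤ) : ℝ) * (p.2 -
      (((ε 0 : ℤ) : ℝ) * p.1 0 + ((ε 1 : ℤ) : ℝ) * p.1 1 + ((ε 2 : ℤ) : ℝ) * p.1 2)))) := by
    refine (MeasurePreserving.id (volume : Measure (Fin 3 → ℝ))).skew_product
      (g := fun (q : Fin 3 → ℝ) (s : ℝ) => ((ε 3 : ℤ) : ℝ) * (s -
        (((ε 0 : ℤ) : ℝ) * q 0 + ((ε 1 : ℤ) : ℝ) * q 1 + ((ε 2 : ℤ) : ℝ) * q 2)))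
      (Continuous.measurable (by fun_prop)) (.of_forall fun q => ?_)
    set τ := ((ε 0 : ℤ) : ℝ) * q 0 + ((ε 1 : ℤ) : ℝ) * q 1 + ((ε 2 : ℤ) : ℝ) * q 2
    have ht := measurePreserving_sub_right (volume : Measure ℝ) τ
    rcases Int.units_eq_one_or (ε 3) with h | h
    · simpa [h] using ht.map_eq
    · have := ((Measure.measurePreserving_neg (volume : Measure ℝ)).comp ht).map_eq
      simpa [h, Function.comp_def] using this
  have h2 : MeasurePreserving (fun p : (Fin 3 → ℝ) × ℝ =>
      ((Fin.last 3).insertNth p.2 p.1 : Fin 4 → ℝ)) :=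
    (measurePreserving_insertNth (Fin.last 3)).comp Measure.measurePreserving_swap
  have h3 := h2.comp h1
  convert h3 using 1
  ext p j
  fin_cases j <;> rfl

/-- Integration along the hyperplanes `ε · k = s`. -/
theorem integral_eq_integral_fiber (ε : Fin 4 → ℤˣ) {F : (Fin 4 → ℝ) → ℂ} (hF : Integrable F) :
    Integrable (fun s => ∫ q, F (fiberPoint ε q s)) ∧
      ∫ k, F k = ∫ s, ∫ q, F (fiberPoint ε q s) := by
  have hp := measurePreserving_fiberPoint ε
  have hi : Integrable (fun p : (Fin 3 → ℝ) × ℝ => F (fiberPoint ε p.1 p.2)) :=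
    hp.integrable_comp_of_integrable hF
  refine ⟨hi.integral_prod_right, ?_⟩
  rw [← integral_prod_symm _ hi]
  have := integral_map hp.measurable.aemeasurable (f := F) (by rw [hp.map_eq]; exact hF.1)
  rw [hp.map_eq] at this
  exact this

theorem prodDecay_fiberPoint_le (ε : Fin 4 → ℤˣ) (q : Fin 3 → ℝ) (s : ℝ) :
    prodDecay (fiberPoint ε q s) ≤ prodDecay q := by
  simp only [prodDecay, Fin.prod_univ_four, Fin.prod_univ_three, fiberPoint, Matrix.cons_val]
  exact mul_le_of_le_one_right (by positivity) (one_add_sq_inv_le_one _)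

/-- The integral of `F` over the hyperplane `ε · k = s`. -/
def fiberIntegral (ε : Fin 4 → ℤˣ) (F : (Fin 4 → ℝ) → ℂ) (s : ℝ) : ℂ :=
  ∫ q, F (fiberPoint ε q s)

namespace Amplitude

variable {F : (Fin 4 → ℝ) → ℂ}

theorem integrable_fiber (hF : Amplitude F) (ε : Fin 4 → ℤˣ) (s : ℝ) :
    Integrable fun q => F (fiberPoint ε q s) := by
  obtain ⟨M, hM⟩ := hF.decay
  have hM0 : 0 ≤ M := by
    have := (norm_nonneg _).trans (hM 0)
    exact nonneg_of_mul_nonneg_left this (prodDecay_pos _)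
  refine (integrable_prodDecay.const_mul M).mono' ?_ (.of_forall fun q => (hM _).trans
    (mul_le_mul_of_nonneg_left (prodDecay_fiberPoint_le ε q s) hM0))
  exact (hF.continuous.comp ((continuous_fiberPoint ε).comp
    (Continuous.prodMk continuous_id continuous_const))).aestronglyMeasurable

theorem continuous_fiberIntegral (hF : Amplitude F) (ε : Fin 4 → ℤˣ) :
    Continuous (fiberIntegral ε F) := by
  obtain ⟨M, hM⟩ := hF.decay
  have hM0 : 0 ≤ M := by
    have := (norm_nonneg _).trans (hM 0)
    exact nonneg_of_mul_nonneg_left this (prodDecay_pos _)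
  refine continuous_of_dominated (bound := fun q => M * prodDecay q)
    (fun s => (hF.integrable_fiber ε s).1) (fun s => .of_forall fun q => (hM _).trans
    (mul_le_mul_of_nonneg_left (prodDecay_fiberPoint_le ε q s) hM0))
    (integrable_prodDecay.const_mul M) (.of_forall fun q => ?_)
  exact hF.continuous.comp ((continuous_fiberPoint ε).comp
    (Continuous.prodMk continuous_const continuous_id))

theorem integrable_fiberIntegral (hF : Amplitude F) (ε : Fin 4 → ℤˣ) :
    Integrable (fiberIntegral ε F) :=
  (integral_eq_integral_fiber ε hF.integrable).1

theorem integrable_mul_sdot (hF : Amplitude F) (ε : Fin 4 → ℤˣ) {h : ℝ → ℂ}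
    (hm : Measurable h) {B : ℝ}
    (hB : ∀ s, ‖h s‖ ≤ B) : Integrable fun k => h (sdot ε k) * F k :=
  hF.integrable.bdd_mul (c := B) (hm.comp (continuous_sdot ε).measurable).aestronglyMeasurable
    (.of_forall fun _ => hB _)

theorem integral_mul_sdot (hF : Amplitude F) (ε : Fin 4 → ℤˣ) {h : ℝ → ℂ}
    (hm : Measurable h) {B : ℝ}
    (hB : ∀ s, ‖h s‖ ≤ B) :
    ∫ k, h (sdot ε k) * F k = ∫ s, h s * fiberIntegral ε F s := by
  rw [(integral_eq_integral_fiber ε (hF.integrable_mul_sdot ε hm hB)).2]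
  simp only [sdot_fiberPoint, integral_const_mul, fiberIntegral]

theorem integral_wave_eq (hF : Amplitude F) (ε : Fin 4 → ℤˣ) (x : ℝ) :
    ∫ k, F k * wave x (sdot ε k) = ∫ s, fiberIntegral ε F s * wave x s := by
  simp_rw [mul_comm (F _), mul_comm (fiberIntegral ε F _)]
  exact hF.integral_mul_sdot ε (h := wave x) (Continuous.measurable (by fun_prop)) (B := 1)
    fun s => (norm_wave _ _).le

/-- Fourier inversion along the direction `ε`. -/
theorem fiberIntegral_eq (hF : Amplitude F) (ε : Fin 4 → ℤˣ) (s : ℝ) :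
    fiberIntegral ε F s
      = (2 * Real.pi : ℂ)⁻¹ * ∫ x, (∫ k, F k * wave x (sdot ε k)) * wave x (-s) := by
  set H := fiberIntegral ε F
  have hH := hF.integrable_fiberIntegral ε
  have hf : ∀ y, FourierTransform.fourier H y
      = ∫ k, F k * wave (-(2 * Real.pi) * y) (sdot ε k) := by
    intro y
    have hpi := Real.pi_ne_zero
    rw [hF.integral_wave_eq]
    have := integral_mul_wave_eq_fourier H (-(2 * Real.pi) * y) 1
    simp only [one_mul] at this
    rw [this]
    field_simp
  have hne : -(2 * Real.pi) ≠ 0 := by simp [Real.pi_ne_zero]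
  have hfi : Integrable (FourierTransform.fourier H) := by
    rw [funext hf]
    exact (hF.integrable_wave ε).comp_mul_left' hne
  have hinv := (hF.continuous_fiberIntegral ε).fourierInv_fourier_eq hH hfi
  have hs : H s = FourierTransformInv.fourierInv (FourierTransform.fourier H) s :=
    (congrFun hinv s).symm
  rw [hs, Real.fourierInv_eq']
  have e : ∀ y : ℝ, Complex.exp ((↑(2 * Real.pi * inner ℝ y s)) * Complex.I) •
      FourierTransform.fourier H y = (fun x => (∫ k, F k * wave x (sdot ε k)) * wave x (-s))
        (-(2 * Real.pi) * y) := by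
    intro y
    rw [hf, smul_eq_mul, mul_comm]
    congr 1
    simp only [wave]
    congr 1
    simp [mul_comm]; ring
  simp_rw [e]
  refine (Measure.integral_comp_mul_left (fun x => (∫ k, F k * wave x (sdot ε k)) * wave x (-s))
    (-(2 * Real.pi))).trans ?_
  rw [abs_inv, abs_neg, abs_of_pos Real.two_pi_pos, Complex.real_smul]
  push_cast; rfl

theorem hasDelta (hF : Amplitude F) (ε : Fin 4 → ℤˣ) : HasDelta ε F (fiberIntegral ε F 0) := by
  refine ⟨?_, ?_⟩
  · simpa only [fiberPoint_zero] using hF.integrable_fiber ε 0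
  · simp only [fiberIntegral, fiberPoint_zero]

theorem integral_integral_wave (hF : Amplitude F) (ε : Fin 4 → ℤˣ) :
    ∫ x, ∫ k, F k * wave x (sdot ε k) = 2 * Real.pi * fiberIntegral ε F 0 := by
  have hpi : (Real.pi : ℂ) ≠ 0 := by exact_mod_cast Real.pi_ne_zero
  rw [hF.fiberIntegral_eq ε 0]
  simp only [neg_zero, wave_zero_right, mul_one]
  field_simp

end Amplitude

/-! ### The Gaussian and its principal value kernel -/

/-- The standard Gaussian density `(2π)^(-1/2) exp (-s² / 2)`. -/
def gauss (s : ℝ) : ℝ := (Real.sqrt (2 * Real.pi))⁻¹ * Real.exp (-(s ^ 2 / 2))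

theorem abs_pow_mul_exp_le (m : ℕ) (x : ℝ) :
    |x| ^ m * Real.exp (-(x ^ 2 / 2)) ≤ 1 + 2 ^ m * m.factorial := by
  have h1 : |x| ^ m ≤ 1 + x ^ (2 * m) := by
    rw [pow_mul, ← sq_abs x, ← pow_mul, mul_comm 2 m, pow_mul]
    nlinarith [sq_nonneg (|x| ^ m - 1 / 2)]
  have h2 : x ^ (2 * m) ≤ 2 ^ m * m.factorial * Real.exp (x ^ 2 / 2) := by
    have := Real.pow_div_factorial_le_exp (x ^ 2 / 2) (by positivity) m
    rw [div_le_iff₀ (by positivity), div_pow, div_le_iff₀ (by positivity), ← pow_mul] at this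
    linarith
  have h3 : Real.exp (-(x ^ 2 / 2)) ≤ 1 := Real.exp_le_one_iff.2 (by nlinarith [sq_nonneg x])
  have h4 : Real.exp (x ^ 2 / 2) * Real.exp (-(x ^ 2 / 2)) = 1 := by
    rw [← Real.exp_add]; simp
  have h5 := Real.exp_pos (-(x ^ 2 / 2))
  calc _ ≤ (1 + 2 ^ m * m.factorial * Real.exp (x ^ 2 / 2)) * Real.exp (-(x ^ 2 / 2)) := by
        gcongr; linarith
    _ = Real.exp (-(x ^ 2 / 2)) + 2 ^ m * m.factorial *
        (Real.exp (x ^ 2 / 2) * Real.exp (-(x ^ 2 / 2))) := by ring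
    _ ≤ _ := by rw [h4]; linarith

theorem exists_poly_mul_gaussian_bound (p : Polynomial ℤ) (k : ℕ) :
    ∃ C, ∀ x : ℝ, |x| ^ k * |Polynomial.aeval x p * Real.exp (-(x ^ 2 / 2))| ≤ C := by
  induction p using Polynomial.induction_on' with
  | add p q hp hq =>
    obtain ⟨C, hC⟩ := hp
    obtain ⟨D, hD⟩ := hq
    refine ⟨C + D, fun x => ?_⟩
    rw [map_add, add_mul]
    calc _ ≤ |x| ^ k * (_ + _) := by gcongr; exact abs_add_le _ _
      _ ≤ C + D := by rw [mul_add]; exact add_le_add (hC x) (hD x)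
  | monomial n a =>
    refine ⟨|(a : ℝ)| * (1 + 2 ^ (k + n) * (k + n).factorial), fun x => ?_⟩
    rw [Polynomial.aeval_monomial, abs_mul, abs_mul, abs_pow, abs_of_pos (Real.exp_pos _)]
    have := abs_pow_mul_exp_le (k + n) x
    calc _ = |(a : ℝ)| * (|x| ^ (k + n) * Real.exp (-(x ^ 2 / 2))) := by
          rw [pow_add]; simp; ring
      _ ≤ _ := by gcongr

/-- The function `exp (-s² / 2)` as a complex-valued Schwartz function. -/
def expSchwartz : 𝓢(ℝ, ℂ) where
  toFun s := (Real.exp (-(s ^ 2 / 2)) : ℂ)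
  smooth' := Complex.ofRealCLM.contDiff.comp
    (by fun_prop : ContDiff ℝ _ fun s : ℝ => Real.exp (-(s ^ 2 / 2)))
  decay' k n := by
    obtain ⟨C, hC⟩ := exists_poly_mul_gaussian_bound (Polynomial.hermite n) k
    refine ⟨C, fun x => ?_⟩
    have hs : ContDiff ℝ (⊤ : ℕ∞) fun s : ℝ => Real.exp (-(s ^ 2 / 2)) := by fun_prop
    have e := Complex.ofRealLI.norm_iteratedFDeriv_comp_left (x := x) (hs.contDiffAt)
      (i := n) (by exact_mod_cast le_top)
    have e2 : (⇑Complex.ofRealLI ∘ fun s : ℝ => Real.exp (-(s ^ 2 / 2)))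
        = fun s : ℝ => (Real.exp (-(s ^ 2 / 2)) : ℂ) := rfl
    rw [e2] at e
    rw [e, norm_iteratedFDeriv_eq_norm_iteratedDeriv, iteratedDeriv_eq_iterate,
      Polynomial.deriv_gaussian_eq_hermite_mul_gaussian, mul_assoc, norm_mul]
    simpa using hC x

/-- The Gaussian density as a complex-valued Schwartz function. -/
def gaussSchwartz : 𝓢(ℝ, ℂ) := ((Real.sqrt (2 * Real.pi) : ℝ) : ℂ)⁻¹ • expSchwartz

theorem gaussSchwartz_apply (s : ℝ) : gaussSchwartz s = (gauss s : ℂ) := by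
  have h : expSchwartz s = (Real.exp (-(s ^ 2 / 2)) : ℂ) := rfl
  rw [gaussSchwartz, smul_apply, h, gauss]
  push_cast; rfl

theorem gauss_neg (s : ℝ) : gauss (-s) = gauss s := by simp [gauss]

theorem gauss_zero : gauss 0 = (Real.sqrt (2 * Real.pi))⁻¹ := by simp [gauss]

theorem gauss_pos (s : ℝ) : 0 < gauss s := by
  have := Real.pi_pos
  unfold gauss; positivity

theorem gauss_zero_le_one : gauss 0 ≤ 1 := by
  rw [gauss_zero]
  refine inv_le_one_of_one_le₀ (Real.one_le_sqrt.2 ?_)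
  linarith [Real.pi_gt_three]

theorem gauss_le (s : ℝ) : gauss s ≤ gauss 0 := by
  rw [gauss_zero, gauss]
  refine mul_le_of_le_one_right (by positivity) (Real.exp_le_one_iff.2 ?_)
  nlinarith [sq_nonneg s]

theorem gauss_le_one (s : ℝ) : gauss s ≤ 1 := (gauss_le s).trans gauss_zero_le_one

theorem abs_gauss_sub_le {s : ℝ} (hs : |s| ≤ 1) : |gauss s - gauss 0| ≤ |s| := by
  rw [abs_sub_comm, abs_of_nonneg (sub_nonneg.2 (gauss_le s))]
  have h0 := gauss_zero_le_one
  have h1 := gauss_pos 0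
  have e : gauss s = gauss 0 * Real.exp (-(s ^ 2 / 2)) := by simp [gauss]
  have h2 := Real.add_one_le_exp (-(s ^ 2 / 2))
  have h3 : s ^ 2 ≤ |s| := by rw [← sq_abs]; nlinarith [abs_nonneg s]
  rw [e]
  nlinarith [abs_nonneg s]

theorem continuous_gauss : Continuous gauss := by unfold gauss; fun_prop

theorem integrable_exp_neg_sq_half : Integrable fun t : ℝ => Real.exp (-(t ^ 2 / 2)) := by
  have := integrable_exp_neg_mul_sq (b := 1 / 2) (by norm_num)
  refine this.congr (.of_forall fun t => ?_)
  ring_nf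

theorem integrable_gauss : Integrable gauss := integrable_exp_neg_sq_half.const_mul _

theorem integral_gauss : ∫ s, gauss s = 1 := by
  have h := integral_gaussian (1 / 2)
  have e : ∀ t : ℝ, Real.exp (-(t ^ 2 / 2)) = Real.exp (-(1 / 2) * t ^ 2) := fun t => by
    congr 1; ring
  simp_rw [gauss, e]
  rw [integral_const_mul, h]
  have : 0 < Real.sqrt (2 * Real.pi) := Real.sqrt_pos.2 Real.two_pi_pos
  rw [show Real.pi / (1 / 2) = 2 * Real.pi by ring]
  field_simp

theorem integral_gauss_mul_cos (t : ℝ) :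
    ∫ s, gauss s * Real.cos (t * s) = Real.exp (-(t ^ 2 / 2)) := by
  have h := fourierIntegral_gaussian (b := 1 / 2) (by norm_num) t
  have hp : 0 < Real.sqrt (2 * Real.pi) := Real.sqrt_pos.2 Real.two_pi_pos
  have e1 : ((Real.pi : ℂ) / (1 / 2)) ^ (1 / 2 : ℂ) = (Real.sqrt (2 * Real.pi) : ℝ) := by
    rw [Real.sqrt_eq_rpow, Complex.ofReal_cpow Real.two_pi_pos.le]
    push_cast; congr 1; ring
  have e2 : Complex.exp (-(t : ℂ) ^ 2 / (4 * (1 / 2))) = (Real.exp (-(t ^ 2 / 2)) : ℝ) := by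
    push_cast; congr 1; ring
  rw [e1, e2] at h
  have hi : Integrable fun x : ℝ =>
      Complex.exp (Complex.I * t * x) * Complex.exp (-(1 / 2) * (x : ℂ) ^ 2) := by
    refine (integrable_exp_neg_sq_half.ofReal (𝕜 := ℂ)).bdd_mul (c := 1)
      (f := fun x : ℝ => Complex.exp (Complex.I * t * x))
      (Continuous.aestronglyMeasurable (by fun_prop)) (.of_forall fun x => ?_) |>.congr
      (.of_forall fun x => ?_)
    · have := norm_wave x t
      rw [wave] at this; exact this.le
    · simp only [RCLike.ofReal_eq_complex_ofReal]
      push_cast; congr 2; ring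
  have hre := congrArg Complex.re h
  rw [← Complex.ofReal_mul, Complex.ofReal_re] at hre
  have hc : (∫ x : ℝ, Complex.exp (Complex.I * t * x) * Complex.exp (-(1 / 2) * (x : ℂ) ^ 2)).re
      = ∫ x : ℝ, (Complex.exp (Complex.I * t * x) * Complex.exp (-(1 / 2) * (x : ℂ) ^ 2)).re :=
    (Complex.reCLM.integral_comp_comm hi).symm
  rw [hc] at hre
  have e3 : ∀ x : ℝ, (Complex.exp (Complex.I * t * x) * Complex.exp (-(1 / 2) * (x : ℂ) ^ 2)).re
      = Real.cos (t * x) * Real.exp (-(x ^ 2 / 2)) := by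
    intro x
    have a1 : Complex.exp (-(1 / 2) * (x : ℂ) ^ 2) = (Real.exp (-(x ^ 2 / 2)) : ℝ) := by
      push_cast; congr 1; ring
    rw [a1, Complex.re_mul_ofReal, show Complex.I * t * x = ((t * x : ℝ) : ℂ) * Complex.I by
      push_cast; ring, Complex.exp_ofReal_mul_I_re]
  simp_rw [e3] at hre
  simp_rw [gauss]
  have e4 : ∀ s : ℝ, (Real.sqrt (2 * Real.pi))⁻¹ * Real.exp (-(s ^ 2 / 2)) * Real.cos (t * s)
      = (Real.sqrt (2 * Real.pi))⁻¹ * (Real.cos (t * s) * Real.exp (-(s ^ 2 / 2))) := fun s => by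
    ring
  simp_rw [e4]
  rw [integral_const_mul, hre]
  field_simp

/-- The odd primitive of `exp (-t² / 2)`. -/
def gaussPrim (x : ℝ) : ℝ := ∫ t in (0 : ℝ)..x, Real.exp (-(t ^ 2 / 2))

/-- The kernel `sin (x s) / s`, extended by continuity to `s = 0`. -/
def sincKernel (x s : ℝ) : ℝ := x * Real.sinc (x * s)

theorem continuous_sincKernel : Continuous (Function.uncurry sincKernel) := by
  unfold sincKernel Function.uncurry
  have := Real.continuous_sinc
  fun_prop

theorem sincKernel_eq {s : ℝ} (hs : s ≠ 0) (x : ℝ) : sincKernel x s = Real.sin (x * s) / s := by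
  by_cases hx : x = 0
  · simp [sincKernel, hx]
  · rw [sincKernel, Real.sinc_of_ne_zero (mul_ne_zero hx hs)]; field_simp

theorem abs_sincKernel_le (x s : ℝ) : |sincKernel x s| ≤ |x| := by
  rw [sincKernel, abs_mul]
  exact mul_le_of_le_one_right (abs_nonneg _) (Real.abs_sinc_le_one _)

theorem sincKernel_eq_integral (x s : ℝ) :
    sincKernel x s = ∫ t in (0 : ℝ)..x, Real.cos (t * s) := by
  by_cases hs : s = 0
  · simp [hs, sincKernel]
  · rw [sincKernel_eq hs, intervalIntegral.integral_comp_mul_right _ hs]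
    simp; field_simp

theorem integrable_gauss_mul_sincKernel (x : ℝ) : Integrable fun s => gauss s * sincKernel x s :=
  integrable_gauss.mul_bdd (c := |x|)
    (continuous_sincKernel.comp (f := fun s => (x, s)) (by fun_prop)).aestronglyMeasurable
    (.of_forall fun s => abs_sincKernel_le x s)

/-- The Gaussian is its own Fourier transform, and `sin (x s) / s` is the integral of `cos (t s)`
over `0 ≤ t ≤ x`. -/
theorem integral_gauss_mul_sincKernel (x : ℝ) :
    ∫ s, gauss s * sincKernel x s = gaussPrim x := by
  have e : ∀ s, gauss s * sincKernel x s = ∫ t in (0 : ℝ)..x, gauss s * Real.cos (t * s) := by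
    intro s
    rw [intervalIntegral.integral_const_mul, sincKernel_eq_integral]
  simp_rw [e]
  rw [← intervalIntegral_integral_swap (f := fun t s => gauss s * Real.cos (t * s))]
  · simp_rw [integral_gauss_mul_cos]; rfl
  · have h1 : Integrable (fun _ : ℝ => (1 : ℝ)) (volume.restrict (uIoc 0 x)) :=
      (continuous_const.intervalIntegrable 0 x).def'
    have hc := continuous_gauss
    refine (h1.mul_prod integrable_gauss).mono'
      (Continuous.aestronglyMeasurable (by unfold Function.uncurry; fun_prop))
      (.of_forall fun p => ?_)
    rw [Function.uncurry, norm_mul, Real.norm_of_nonneg (gauss_pos _).le, one_mul]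
    exact mul_le_of_le_one_right (gauss_pos _).le (Real.abs_cos_le_one _)

/-- Integration by parts on `[1, y]` bounds the sine integral uniformly. -/
theorem abs_integral_sinc_le_of_nonneg {y : ℝ} (hy : 0 ≤ y) :
    |∫ t in (0 : ℝ)..y, Real.sinc t| ≤ 4 := by
  have hc := Real.continuous_sinc
  have hb : ∀ a b : ℝ, IntervalIntegrable Real.sinc volume a b := fun a b =>
    hc.intervalIntegrable a b
  have small : ∀ z : ℝ, |∫ t in (0 : ℝ)..z, Real.sinc t| ≤ |z| := fun z => by
    have := intervalIntegral.norm_integral_le_of_norm_le_const (a := 0) (b := z) (C := 1)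
      (f := Real.sinc) fun t _ => Real.abs_sinc_le_one t
    simpa using this
  rcases le_total y 1 with h1 | h1
  · exact (small y).trans (by rw [abs_of_nonneg hy]; linarith)
  have hpos : ∀ t ∈ uIcc 1 y, 0 < t := fun t ht => by
    rw [uIcc_of_le h1] at ht; linarith [ht.1]
  have hcinv : ContinuousOn (fun t : ℝ => -(t ^ 2)⁻¹) (uIcc 1 y) :=
    (ContinuousOn.inv₀ (by fun_prop) fun t ht => by have := hpos t ht; positivity).neg
  have hder : ∀ t ∈ uIcc 1 y, HasDerivAt (fun t : ℝ => t⁻¹) (-(t ^ 2)⁻¹) t := fun t ht =>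
    hasDerivAt_inv (hpos t ht).ne'
  have ibp := intervalIntegral.integral_mul_deriv_eq_deriv_mul (a := 1) (b := y)
    (u := fun t : ℝ => t⁻¹) (v := fun t => -Real.cos t) (u' := fun t => -(t ^ 2)⁻¹)
    (v' := Real.sin) hder (fun t _ => (Real.hasDerivAt_cos t).neg.congr_deriv (neg_neg _))
    hcinv.intervalIntegrable (Real.continuous_sin.intervalIntegrable _ _)
  have e1 : ∫ t in (1 : ℝ)..y, Real.sinc t = ∫ t in (1 : ℝ)..y, t⁻¹ * Real.sin t :=
    intervalIntegral.integral_congr fun t ht => by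
      have := (hpos t ht).ne'
      simp only [Real.sinc_of_ne_zero this]; ring
  have e2 : |∫ t in (1 : ℝ)..y, -(t ^ 2)⁻¹ * -Real.cos t| ≤ 1 := by
    have hint : IntervalIntegrable (fun t : ℝ => (t ^ 2)⁻¹) volume 1 y := by
      refine ContinuousOn.intervalIntegrable (hcinv.neg.congr fun t _ => ?_)
      simp
    have h := intervalIntegral.norm_integral_le_of_norm_le (μ := volume) h1
      (f := fun t : ℝ => -(t ^ 2)⁻¹ * -Real.cos t) (g := fun t => (t ^ 2)⁻¹)
      (.of_forall fun t _ => by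
        rw [norm_mul, norm_neg, norm_neg, Real.norm_of_nonneg (by positivity)]
        exact mul_le_of_le_one_right (by positivity) (Real.abs_cos_le_one t)) hint
    have h' := intervalIntegral.integral_eq_sub_of_hasDerivAt hder (hcinv.intervalIntegrable)
    rw [intervalIntegral.integral_neg] at h'
    have hy' : 0 ≤ y⁻¹ := by positivity
    rw [Real.norm_eq_abs] at h
    simp only [inv_one] at h'
    linarith
  have e3 : |∫ t in (1 : ℝ)..y, Real.sinc t| ≤ 3 := by
    rw [e1, ibp]
    have hyi : y⁻¹ ≤ 1 := inv_le_one_of_one_le₀ h1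
    have hy0 : 0 < y⁻¹ := by positivity
    have a1 : |y⁻¹ * -Real.cos y| ≤ 1 := by
      rw [abs_mul, abs_neg, abs_of_pos hy0]
      exact mul_le_one₀ hyi (abs_nonneg _) (Real.abs_cos_le_one _)
    have a2 : |(1 : ℝ)⁻¹ * -Real.cos 1| ≤ 1 := by
      simpa using Real.abs_cos_le_one 1
    rw [abs_le] at *
    constructor <;> linarith [a1.1, a1.2, a2.1, a2.2, e2.1, e2.2]
  rw [← intervalIntegral.integral_add_adjacent_intervals (hb 0 1) (hb 1 y)]
  refine (abs_add_le _ _).trans ?_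
  have := small 1
  simp only [abs_one] at this
  linarith

theorem abs_integral_sinc_le (y : ℝ) : |∫ t in (0 : ℝ)..y, Real.sinc t| ≤ 4 := by
  rcases le_total 0 y with h | h
  · exact abs_integral_sinc_le_of_nonneg h
  · have e := intervalIntegral.integral_comp_neg (a := 0) (b := y) Real.sinc
    simp only [Real.sinc_neg, neg_zero] at e
    rw [e, intervalIntegral.integral_symm, abs_neg]
    exact abs_integral_sinc_le_of_nonneg (by linarith)

/-- The part of `∫ gauss s * sin (x s) / s` removed by the truncation of the principal value. -/
def pvCore (η x : ℝ) : ℝ := ∫ s in (-η)..η, gauss s * sincKernel x s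

theorem abs_pvCore_le {η : ℝ} (hη : 0 < η) (x : ℝ) : |pvCore η x| ≤ 2 * η * |x| := by
  have := intervalIntegral.norm_integral_le_of_norm_le_const (a := -η) (b := η) (C := |x|)
    (f := fun s => gauss s * sincKernel x s) fun s _ => by
      rw [norm_mul, Real.norm_of_nonneg (gauss_pos _).le]
      exact (mul_le_of_le_one_left (norm_nonneg _) (gauss_le_one s)).trans (abs_sincKernel_le x s)
  rw [Real.norm_eq_abs] at this
  refine this.trans (le_of_eq ?_)
  rw [sub_neg_eq_add, abs_of_pos (by linarith : (0 : ℝ) < η + η)]; ring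

/-- The removed part is bounded uniformly in `x` and the truncation, by comparison with the sine
integral. This is the domination needed to pass to the limit in the principal value. -/
theorem abs_pvCore_le_const {η : ℝ} (hη : 0 < η) (hη1 : η ≤ 1) (x : ℝ) : |pvCore η x| ≤ 10 := by
  have hk : Continuous (sincKernel x) :=
    continuous_sincKernel.comp (f := fun s => (x, s)) (by fun_prop)
  have hg := continuous_gauss
  have e : pvCore η x = gauss 0 * (∫ s in (-η)..η, sincKernel x s)
      + ∫ s in (-η)..η, (gauss s - gauss 0) * sincKernel x s := by
    rw [← intervalIntegral.integral_const_mul, ← intervalIntegral.integral_add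
      (Continuous.intervalIntegrable (by fun_prop) _ _)
      (Continuous.intervalIntegrable (by fun_prop) _ _)]
    exact intervalIntegral.integral_congr fun s _ => by ring
  have h1 : |∫ s in (-η)..η, sincKernel x s| ≤ 8 := by
    have hb : ∀ a b : ℝ, IntervalIntegrable Real.sinc volume a b := fun a b =>
      Real.continuous_sinc.intervalIntegrable a b
    simp only [sincKernel]
    rw [intervalIntegral.integral_const_mul, intervalIntegral.mul_integral_comp_mul_left,
      ← intervalIntegral.integral_add_adjacent_intervals (hb _ 0) (hb 0 _),
      intervalIntegral.integral_symm]
    refine (abs_add_le _ _).trans ?_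
    rw [abs_neg]
    linarith [abs_integral_sinc_le (x * -η), abs_integral_sinc_le (x * η)]
  have h2 : |∫ s in (-η)..η, (gauss s - gauss 0) * sincKernel x s| ≤ 2 := by
    have := intervalIntegral.norm_integral_le_of_norm_le_const (a := -η) (b := η) (C := 1)
      (f := fun s => (gauss s - gauss 0) * sincKernel x s) fun s hs => by
        rw [uIoc_of_le (by linarith)] at hs
        have hs1 : |s| ≤ 1 := abs_le.2 ⟨by linarith [hs.1], by linarith [hs.2]⟩
        by_cases h0 : s = 0
        · simp [h0]
        · rw [norm_mul, Real.norm_eq_abs, Real.norm_eq_abs, sincKernel_eq h0, abs_div]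
          have hp : 0 < |s| := abs_pos.2 h0
          calc _ ≤ |s| * (1 / |s|) :=
                mul_le_mul (abs_gauss_sub_le hs1)
                  (div_le_div_of_nonneg_right (Real.abs_sin_le_one _) hp.le)
                  (by positivity) hp.le
            _ = 1 := by field_simp
    rw [Real.norm_eq_abs, sub_neg_eq_add, abs_of_pos (by linarith : (0 : ℝ) < η + η)] at this
    linarith
  rw [e]
  refine (abs_add_le _ _).trans ?_
  rw [abs_mul, abs_of_pos (gauss_pos 0)]
  have h3 := gauss_zero_le_one
  have h4 := gauss_pos 0
  nlinarith [abs_nonneg (∫ s in (-η)..η, sincKernel x s)]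

/-! ### Principal values and Fourier transforms in the direction `ε` -/

/-- The truncation to `|s| > η` of the kernel `gauss s / (i s)`. -/
def pvKernel (η s : ℝ) : ℂ := if η < |s| then (gauss s : ℂ) / (Complex.I * s) else 0

theorem measurableSet_lt_abs (η : ℝ) : MeasurableSet {s : ℝ | η < |s|} :=
  (isOpen_lt continuous_const continuous_abs).measurableSet

theorem measurable_pvKernel (η : ℝ) : Measurable (pvKernel η) := by
  have := continuous_gauss.measurable
  exact Measurable.ite (measurableSet_lt_abs η) (by fun_prop) measurable_const

theorem norm_pvKernel_le {η : ℝ} (hη : 0 < η) (s : ℝ) : ‖pvKernel η s‖ ≤ η⁻¹ * gauss s := by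
  have hg := gauss_pos s
  unfold pvKernel
  split_ifs with h
  · rw [norm_div, norm_mul, Complex.norm_I, one_mul, Complex.norm_real, Complex.norm_real,
      Real.norm_of_nonneg hg.le, Real.norm_eq_abs, div_eq_mul_inv, mul_comm]
    gcongr
  · rw [norm_zero]; positivity

theorem norm_pvKernel_le_inv {η : ℝ} (hη : 0 < η) (s : ℝ) : ‖pvKernel η s‖ ≤ η⁻¹ :=
  (norm_pvKernel_le hη s).trans (mul_le_of_le_one_right (by positivity) (gauss_le_one s))

theorem integrable_pvKernel {η : ℝ} (hη : 0 < η) : Integrable (pvKernel η) :=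
  (integrable_gauss.const_mul η⁻¹).mono' (measurable_pvKernel η).aestronglyMeasurable
    (.of_forall (norm_pvKernel_le hη))

/-- Only the odd part of the exponential survives the symmetric truncation. -/
theorem pvKernel_add_neg {η : ℝ} (hη : 0 < η) (x s : ℝ) :
    pvKernel η s * wave x (-s) + pvKernel η (-s) * wave x (- -s)
      = ((-2 * {s : ℝ | η < |s|}.indicator (fun s => gauss s * sincKernel x s) s : ℝ) : ℂ) := by
  by_cases h : η < |s|
  · have hs : s ≠ 0 := abs_pos.1 (hη.trans h)
    rw [indicator_of_mem (by exact h), sincKernel_eq hs]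
    simp only [pvKernel, abs_neg, h, if_true, gauss_neg, neg_neg]
    have hw : wave x (-s) - wave x s = -2 * Complex.I * Complex.sin (x * s) := by
      have a1 : wave x s = Complex.exp ((x * s : ℂ) * Complex.I) := by
        simp only [wave]; congr 1; ring
      have a2 : wave x (-s) = Complex.exp (-(x * s : ℂ) * Complex.I) := by
        simp only [wave]; congr 1; push_cast; ring
      rw [a1, a2, Complex.sin]
      linear_combination (Complex.exp (-(x * s : ℂ) * Complex.I)
        - Complex.exp ((x * s : ℂ) * Complex.I)) * Complex.I_mul_I
    have hsc : (s : ℂ) ≠ 0 := by exact_mod_cast hs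
    push_cast
    have e : (gauss s : ℂ) / (Complex.I * s) * wave x (-s)
        + (gauss s : ℂ) / (Complex.I * -s) * wave x s
        = (gauss s : ℂ) / (Complex.I * s) * (wave x (-s) - wave x s) := by
      rw [mul_neg, div_neg]; ring
    rw [e, hw]
    field_simp [Complex.I_ne_zero]
  · rw [indicator_of_notMem (by exact h)]
    simp [pvKernel, h]

theorem integral_pvKernel_mul_wave {η : ℝ} (hη : 0 < η) (x : ℝ) :
    ∫ s, pvKernel η s * wave x (-s) = ((pvCore η x - gaussPrim x : ℝ) : ℂ) := by
  set f : ℝ → ℂ := fun s => pvKernel η s * wave x (-s)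
  have hf : Integrable f := (integrable_pvKernel hη).mul_bdd (c := 1)
    (Continuous.aestronglyMeasurable (by fun_prop)) (.of_forall fun s => (norm_wave _ _).le)
  have h1 : ∫ s, (f s + f (-s)) = 2 * ∫ s, f s := by
    rw [integral_add hf hf.comp_neg, integral_neg_eq_self f]; ring
  have h2 : ∫ s, (f s + f (-s)) = ((-2 * (gaussPrim x - pvCore η x) : ℝ) : ℂ) := by
    have e : ∀ s, f s + f (-s) = _ := fun s => pvKernel_add_neg hη x s
    simp_rw [e]
    rw [integral_complex_ofReal, integral_const_mul, integral_indicator (measurableSet_lt_abs η)]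
    congr 2
    have hi := integrable_gauss_mul_sincKernel x
    have hc := integral_add_compl (measurableSet_lt_abs η) hi
    have hs : {s : ℝ | η < |s|}ᶜ = Icc (-η) η := by
      ext s; simp [abs_le]
    rw [integral_gauss_mul_sincKernel, hs, integral_Icc_eq_integral_Ioc,
      ← intervalIntegral.integral_of_le (by linarith)] at hc
    rw [pvCore]; linarith
  rw [h1] at h2
  push_cast at h2 ⊢
  linear_combination h2 / 2

theorem continuous_exp_neg_sq_half : Continuous fun t : ℝ => Real.exp (-(t ^ 2 / 2)) := by fun_prop

theorem hasDerivAt_gaussPrim (x : ℝ) : HasDerivAt gaussPrim (Real.exp (-(x ^ 2 / 2))) x :=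
  intervalIntegral.integral_hasDerivAt_right (continuous_exp_neg_sq_half.intervalIntegrable _ _)
    (continuous_exp_neg_sq_half.stronglyMeasurableAtFilter _ _)
    continuous_exp_neg_sq_half.continuousAt

theorem continuous_gaussPrim : Continuous gaussPrim :=
  continuous_iff_continuousAt.2 fun x => (hasDerivAt_gaussPrim x).continuousAt

theorem gaussPrim_neg (x : ℝ) : gaussPrim (-x) = -gaussPrim x := by
  have e := intervalIntegral.integral_comp_neg (a := 0) (b := x)
    fun t : ℝ => Real.exp (-(t ^ 2 / 2))
  simp only [neg_sq, neg_zero] at e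
  rw [gaussPrim, gaussPrim, e, intervalIntegral.integral_symm]

theorem integral_Ioi_exp_neg_sq_half :
    ∫ t in Ioi (0 : ℝ), Real.exp (-(t ^ 2 / 2)) = Real.sqrt (Real.pi / 2) := by
  have h := integral_gaussian_Ioi (1 / 2)
  have e : ∀ t : ℝ, Real.exp (-(t ^ 2 / 2)) = Real.exp (-(1 / 2) * t ^ 2) := fun t => by ring_nf
  simp_rw [e, h]
  rw [show Real.pi / (1 / 2) = 2 ^ 2 * (Real.pi / 2) by ring,
    Real.sqrt_mul (by norm_num), Real.sqrt_sq (by norm_num)]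
  ring

theorem sqrt_sub_gaussPrim {x : ℝ} (hx : 0 ≤ x) :
    Real.sqrt (Real.pi / 2) - gaussPrim x = ∫ t in Ioi x, Real.exp (-(t ^ 2 / 2)) := by
  rw [← integral_Ioi_exp_neg_sq_half, gaussPrim, intervalIntegral.integral_of_le hx,
    ← Ioc_union_Ioi_eq_Ioi hx, setIntegral_union Ioc_disjoint_Ioi_same measurableSet_Ioi
      integrable_exp_neg_sq_half.integrableOn integrable_exp_neg_sq_half.integrableOn]
  ring

theorem abs_gaussPrim_le (x : ℝ) : |gaussPrim x| ≤ Real.sqrt (Real.pi / 2) := by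
  have key : ∀ y : ℝ, 0 ≤ y → |gaussPrim y| ≤ Real.sqrt (Real.pi / 2) := by
    intro y hy
    have h1 := sqrt_sub_gaussPrim hy
    have h2 : 0 ≤ ∫ t in Ioi y, Real.exp (-(t ^ 2 / 2)) :=
      integral_nonneg fun t => (Real.exp_pos _).le
    have h3 : 0 ≤ gaussPrim y := intervalIntegral.integral_nonneg hy fun t _ =>
      (Real.exp_pos _).le
    rw [abs_of_nonneg h3]; linarith
  rcases le_total 0 x with h | h
  · exact key x h
  · rw [← abs_neg, ← gaussPrim_neg]; exact key _ (by linarith)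

/-- The principal value against the Gaussian pairs the Fourier transform of `F` along `ε` with
the bounded function `gaussPrim`. -/
theorem Amplitude.hasPV {F : (Fin 4 → ℝ) → ℂ} (hF : Amplitude F) (ε : Fin 4 → ℤˣ) :
    HasPV ε gaussSchwartz F (-((2 * Real.pi : ℂ)⁻¹ *
      ∫ x, (gaussPrim x : ℂ) * ∫ k, F k * wave x (sdot ε k))) := by
  have hS : ∀ η : ℝ, MeasurableSet {k : Fin 4 → ℝ | η < |sdot ε k|} := fun η =>
    (continuous_sdot ε).measurable (measurableSet_lt_abs η)
  have hind : ∀ η : ℝ, {k : Fin 4 → ℝ | η < |sdot ε k|}.indicator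
      (fun k => gaussSchwartz (sdot ε k) / (Complex.I * (sdot ε k : ℂ)) * F k)
      = fun k => pvKernel η (sdot ε k) * F k := by
    intro η
    ext k
    by_cases h : η < |sdot ε k|
    · rw [indicator_of_mem (by exact h)]
      simp [pvKernel, h, gaussSchwartz_apply]
    · rw [indicator_of_notMem (by exact h)]
      simp [pvKernel, h]
  set fh : ℝ → ℂ := fun x => ∫ k, F k * wave x (sdot ε k) with hfh
  have hfi : Integrable fh := hF.integrable_wave ε
  refine ⟨fun η hη => ?_, ?_⟩
  · rw [← integrable_indicator_iff (hS η), hind]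
    exact hF.integrable_mul_sdot ε (measurable_pvKernel η) (norm_pvKernel_le_inv hη)
  have hval : ∀ η : ℝ, 0 < η → ∫ k in {k : Fin 4 → ℝ | η < |sdot ε k|},
      gaussSchwartz (sdot ε k) / (Complex.I * (sdot ε k : ℂ)) * F k
      = (2 * Real.pi : ℂ)⁻¹ * ∫ x, ((pvCore η x - gaussPrim x : ℝ) : ℂ) * fh x := by
    intro η hη
    rw [← integral_indicator (hS η), hind,
      hF.integral_mul_sdot ε (measurable_pvKernel η) (norm_pvKernel_le_inv hη)]
    have e : ∀ s : ℝ, pvKernel η s * ((2 * Real.pi : ℂ)⁻¹ * ∫ x, fh x * wave x (-s))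
        = (2 * Real.pi : ℂ)⁻¹ * ∫ x, fh x * (pvKernel η s * wave x (-s)) := by
      intro s
      rw [mul_left_comm, ← integral_const_mul]
      congr 1
      exact integral_congr_ae (.of_forall fun x => by ring)
    -- Fourier inversion in the direction `ε`, then exchange of the integrals in `s` and `x`
    rw [integral_congr_ae (.of_forall fun s => (congrArg (pvKernel η s * ·)
      (hF.fiberIntegral_eq ε s)).trans (e s)), integral_const_mul, integral_integral_swap]
    · congr 1
      refine integral_congr_ae (.of_forall fun x => ?_)
      beta_reduce
      rw [integral_const_mul, integral_pvKernel_mul_wave hη, mul_comm]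
    have hp := hfi.mul_prod (integrable_pvKernel hη)
    refine Integrable.swap (f := fun p : ℝ × ℝ => fh p.1 * (pvKernel η p.2 * wave p.1 (-p.2))) ?_
    refine (hp.mul_bdd (c := 1) (g := fun p : ℝ × ℝ => wave p.1 (-p.2))
      (Continuous.aestronglyMeasurable (by fun_prop))
      (.of_forall fun p => (norm_wave _ _).le)).congr (.of_forall fun p => ?_)
    simp only; ring
  -- dominated convergence, with `pvCore` bounded and tending to zero pointwise
  have hlim : Tendsto (fun η => ∫ x, ((pvCore η x - gaussPrim x : ℝ) : ℂ) * fh x) (𝓝[>] 0)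
      (𝓝 (∫ x, ((0 - gaussPrim x : ℝ) : ℂ) * fh x)) := by
    refine tendsto_integral_filter_of_dominated_convergence
      (fun x => (10 + Real.sqrt (Real.pi / 2)) * ‖fh x‖) ?_ ?_ (hfi.norm.const_mul _) ?_
    · refine .of_forall fun η => ?_
      have : Measurable fun x => pvCore η x := by
        refine StronglyMeasurable.measurable ?_
        unfold pvCore intervalIntegral
        have hc : Continuous (Function.uncurry fun x s => gauss s * sincKernel x s) := by
          have := continuous_gauss
          have := continuous_sincKernel
          unfold Function.uncurry
          exact Continuous.mul (by fun_prop) this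
        exact (StronglyMeasurable.integral_prod_right (f := fun x s => gauss s * sincKernel x s)
          hc.stronglyMeasurable).sub (StronglyMeasurable.integral_prod_right
          (f := fun x s => gauss s * sincKernel x s) hc.stronglyMeasurable)
      refine AEStronglyMeasurable.mul ?_ hfi.1
      exact (Complex.measurable_ofReal.comp
        (this.sub continuous_gaussPrim.measurable)).aestronglyMeasurable
    · have hmem : Ioc (0 : ℝ) 1 ∈ 𝓝[>] (0 : ℝ) := Ioc_mem_nhdsGT one_pos
      filter_upwards [hmem] with η hη
      refine .of_forall fun x => ?_
      rw [norm_mul, Complex.norm_real]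
      gcongr
      refine (norm_sub_le _ _).trans (add_le_add ?_ ?_)
      · exact abs_pvCore_le_const hη.1 hη.2 x
      · exact abs_gaussPrim_le x
    · refine .of_forall fun x => ?_
      have h0 : Tendsto (fun η => pvCore η x) (𝓝[>] 0) (𝓝 0) := by
        have : Tendsto (fun η : ℝ => 2 * η * |x|) (𝓝[>] 0) (𝓝 0) := by
          have : Tendsto (fun η : ℝ => 2 * η * |x|) (𝓝 0) (𝓝 (2 * 0 * |x|)) := by
            have : Continuous fun η : ℝ => 2 * η * |x| := by fun_prop
            exact this.tendsto 0
          simp only [mul_zero, zero_mul] at this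
          exact this.mono_left nhdsWithin_le_nhds
        refine squeeze_zero_norm' ?_ this
        filter_upwards [self_mem_nhdsWithin] with η hη
        exact abs_pvCore_le hη x
      exact (((Complex.continuous_ofReal.tendsto _).comp (h0.sub_const _)).mul_const _)
  have hv : -((2 * Real.pi : ℂ)⁻¹ * ∫ x, (gaussPrim x : ℂ) * fh x)
      = (2 * Real.pi : ℂ)⁻¹ * ∫ x, ((0 - gaussPrim x : ℝ) : ℂ) * fh x := by
    rw [← mul_neg, ← integral_neg]
    congr 1
    refine integral_congr_ae (.of_forall fun x => ?_)
    push_cast; ring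
  rw [hv]
  refine (hlim.const_mul _).congr' ?_
  filter_upwards [self_mem_nhdsWithin] with η hη
  exact (hval η hη).symm

theorem Amplitude.integrable_mul_wave {F : (Fin 4 → ℝ) → ℂ} (hF : Amplitude F) (ε : Fin 4 → ℤˣ)
    {p : ℝ → ℂ} (hp : AEStronglyMeasurable p) {B : ℝ} (hB : ∀ x, ‖p x‖ ≤ B) :
    Integrable fun x => p x * ∫ k, F k * wave x (sdot ε k) :=
  (hF.integrable_wave ε).bdd_mul (c := B) hp (.of_forall hB)

/-- An integrable profile `g` turns the oscillating integral into the action of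
`ĝ(-ε · k)`. -/
theorem Amplitude.hasAction_unitaryFT {F : (Fin 4 → ℝ) → ℂ} (hF : Amplitude F) (ε : Fin 4 → ℤˣ)
    {g : ℝ → ℂ} (hg : Integrable g) :
    Integrable (fun k => unitaryFT g (sdot (-ε) k) * F k) ∧
      ∫ x, g x * ∫ k, F k * wave x (sdot ε k)
        = Real.sqrt (2 * Real.pi) * ∫ k, unitaryFT g (sdot (-ε) k) * F k := by
  have hp : Integrable (Function.uncurry fun (x : ℝ) (k : Fin 4 → ℝ) =>
      g x * (F k * wave x (sdot ε k))) (volume.prod volume) := by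
    have := (hg.mul_prod hF.integrable)
    have hsd := continuous_sdot ε
    refine (this.mul_bdd (c := 1) (g := fun p : ℝ × (Fin 4 → ℝ) => wave p.1 (sdot ε p.2))
      (Continuous.aestronglyMeasurable (by fun_prop))
      (.of_forall fun p => (norm_wave _ _).le)).congr (.of_forall fun p => ?_)
    simp only [Function.uncurry]; ring
  have hsq : ((Real.sqrt (2 * Real.pi) : ℝ) : ℂ) ≠ 0 := by
    exact_mod_cast (Real.sqrt_pos.2 Real.two_pi_pos).ne'
  have hsd : ∀ k, sdot (-ε) k = -sdot ε k := fun k => by simp [sdot, Finset.sum_neg_distrib]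
  have e : ∀ k, unitaryFT g (sdot (-ε) k) * F k
      = ((Real.sqrt (2 * Real.pi) : ℝ) : ℂ)⁻¹ * ∫ x, g x * (F k * wave x (sdot ε k)) := by
    intro k
    rw [unitaryFT, mul_assoc, ← integral_mul_const]
    congr 1
    refine integral_congr_ae (.of_forall fun x => ?_)
    simp only [wave, hsd]
    have : -(Complex.I * x * ((-sdot ε k : ℝ) : ℂ)) = Complex.I * (sdot ε k : ℂ) * x := by
      push_cast; ring
    rw [this]; ring
  simp_rw [e]
  refine ⟨hp.integral_prod_right.const_mul _, ?_⟩
  rw [integral_const_mul, mul_inv_cancel_left₀ hsq, ← integral_integral_swap hp]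
  simp only [integral_const_mul]

/-! ### Step-like profiles -/

/-- A `C¹` profile that tends to `l` at `+∞` and to `m` at `-∞`, at the rate `⟨x⟩ ^ (-γ + 1)`,
with a derivative of the same size. -/
structure StepLike (γ : ℝ) (p : ℝ → ℂ) (l m : ℝ) : Prop where
  contDiff : ContDiff ℝ 1 p
  decay : ∃ C, 0 ≤ C ∧ (∀ x, 0 ≤ x → ‖p x - l‖ ≤ C * jb x ^ (-γ + 1)) ∧
    (∀ x, x ≤ 0 → ‖p x - m‖ ≤ C * jb x ^ (-γ + 1)) ∧
    ∀ x, ‖deriv p x‖ ≤ C * jb x ^ (-γ + 1)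

theorem jb_rpow_pos (x r : ℝ) : 0 < jb x ^ r := Real.rpow_pos_of_pos (jb_pos x) r

theorem jb_rpow_le_one {γ : ℝ} (hγ : 1 ≤ γ) (x : ℝ) : jb x ^ (-γ + 1) ≤ 1 :=
  Real.rpow_le_one_of_one_le_of_nonpos (one_le_jb x) (by linarith)

namespace StepLike

variable {γ : ℝ} {p q : ℝ → ℂ} {l m l' m' : ℝ}

theorem of_hasDerivAt {p' : ℝ → ℂ} (hd : ∀ x, HasDerivAt p (p' x) x) (hc : Continuous p')
    {C : ℝ} (hC : 0 ≤ C) (h1 : ∀ x, 0 ≤ x → ‖p x - l‖ ≤ C * jb x ^ (-γ + 1))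
    (h2 : ∀ x, x ≤ 0 → ‖p x - m‖ ≤ C * jb x ^ (-γ + 1))
    (h3 : ∀ x, ‖p' x‖ ≤ C * jb x ^ (-γ + 1)) : StepLike γ p l m := by
  have e : deriv p = p' := funext fun x => (hd x).deriv
  refine ⟨contDiff_one_iff_deriv.2 ⟨fun x => (hd x).differentiableAt, by rwa [e]⟩,
    C, hC, h1, h2, by rwa [e]⟩

theorem hasDerivAt (hp : StepLike γ p l m) (x : ℝ) : HasDerivAt p (deriv p x) x :=
  (hp.contDiff.differentiable (by norm_num) x).hasDerivAt

theorem continuous_deriv (hp : StepLike γ p l m) : Continuous (deriv p) :=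
  (contDiff_one_iff_deriv.1 hp.contDiff).2

theorem bounded (hγ : 1 ≤ γ) (hp : StepLike γ p l m) : ∃ B, 0 ≤ B ∧ ∀ x, ‖p x‖ ≤ B := by
  obtain ⟨C, hC, h1, h2, -⟩ := hp.decay
  refine ⟨C + |l| + |m|, by positivity, fun x => ?_⟩
  have hj := jb_rpow_le_one hγ x
  have hCj : C * jb x ^ (-γ + 1) ≤ C := mul_le_of_le_one_right hC hj
  have ha := abs_nonneg l
  have hb := abs_nonneg m
  rcases le_total 0 x with h | h
  · have e := norm_le_norm_sub_add (p x) (l : ℂ)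
    rw [Complex.norm_real, Real.norm_eq_abs] at e
    linarith [h1 x h]
  · have e := norm_le_norm_sub_add (p x) (m : ℂ)
    rw [Complex.norm_real, Real.norm_eq_abs] at e
    linarith [h2 x h]

theorem const (γ : ℝ) (c : ℝ) : StepLike γ (fun _ => (c : ℂ)) c c := by
  refine of_hasDerivAt (p' := fun _ => 0) (C := 0) (fun x => hasDerivAt_const x _)
    continuous_const le_rfl ?_ ?_ ?_ <;> intros <;> simp

theorem add (hp : StepLike γ p l m) (hq : StepLike γ q l' m') :
    StepLike γ (fun x => p x + q x) (l + l') (m + m') := by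
  obtain ⟨C, hC, h1, h2, h3⟩ := hp.decay
  obtain ⟨D, hD, k1, k2, k3⟩ := hq.decay
  refine of_hasDerivAt (C := C + D) (fun x => (hp.hasDerivAt x).add (hq.hasDerivAt x))
    (hp.continuous_deriv.add hq.continuous_deriv) (by positivity) (fun x hx => ?_)
    (fun x hx => ?_) (fun x => ?_)
  · rw [add_mul]; push_cast; rw [add_sub_add_comm]
    exact (norm_add_le _ _).trans (add_le_add (h1 x hx) (k1 x hx))
  · rw [add_mul]; push_cast; rw [add_sub_add_comm]
    exact (norm_add_le _ _).trans (add_le_add (h2 x hx) (k2 x hx))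
  · rw [add_mul]; exact (norm_add_le _ _).trans (add_le_add (h3 x) (k3 x))

theorem const_mul (c : ℝ) (hp : StepLike γ p l m) :
    StepLike γ (fun x => (c : ℂ) * p x) (c * l) (c * m) := by
  obtain ⟨C, hC, h1, h2, h3⟩ := hp.decay
  refine of_hasDerivAt (C := |c| * C) (fun x => (hp.hasDerivAt x).const_mul (c : ℂ))
    (continuous_const.mul hp.continuous_deriv) (by positivity) (fun x hx => ?_)
    (fun x hx => ?_) (fun x => ?_)
  · rw [Complex.ofReal_mul, ← mul_sub, norm_mul, Complex.norm_real, Real.norm_eq_abs, mul_assoc]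
    gcongr; exact h1 x hx
  · rw [Complex.ofReal_mul, ← mul_sub, norm_mul, Complex.norm_real, Real.norm_eq_abs, mul_assoc]
    gcongr; exact h2 x hx
  · rw [norm_mul, Complex.norm_real, Real.norm_eq_abs, mul_assoc]
    gcongr; exact h3 x

theorem mul (hγ : 1 ≤ γ) (hp : StepLike γ p l m) (hq : StepLike γ q l' m') :
    StepLike γ (fun x => p x * q x) (l * l') (m * m') := by
  obtain ⟨C, hC, h1, h2, h3⟩ := hp.decay
  obtain ⟨D, hD, k1, k2, k3⟩ := hq.decay
  obtain ⟨A, hA, hpA⟩ := hp.bounded hγ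
  obtain ⟨B, hB, hqB⟩ := hq.bounded hγ
  have key : ∀ x (a b : ℝ), ‖p x - a‖ ≤ C * jb x ^ (-γ + 1) → ‖q x - b‖ ≤ D * jb x ^ (-γ + 1) →
      ‖p x * q x - ((a * b : ℝ) : ℂ)‖ ≤ (C * B + |a| * D) * jb x ^ (-γ + 1) := by
    intro x a b ha hb
    have e : p x * q x - ((a * b : ℝ) : ℂ) = (p x - a) * q x + a * (q x - b) := by push_cast; ring
    have hj := jb_rpow_pos x (-γ + 1)
    rw [e]
    calc _ ≤ ‖p x - a‖ * ‖q x‖ + |a| * ‖q x - b‖ := by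
          refine (norm_add_le _ _).trans ?_
          rw [norm_mul, norm_mul, Complex.norm_real, Real.norm_eq_abs]
      _ ≤ (C * jb x ^ (-γ + 1)) * B + |a| * (D * jb x ^ (-γ + 1)) := by
          gcongr
          exact hqB x
      _ = _ := by ring
  refine of_hasDerivAt (C := C * B + |l| * D + |m| * D + A * D)
    (fun x => (hp.hasDerivAt x).mul (hq.hasDerivAt x))
    ((hp.continuous_deriv.mul hq.contDiff.continuous).add
      (hp.contDiff.continuous.mul hq.continuous_deriv)) (by positivity) (fun x hx => ?_)
    (fun x hx => ?_) (fun x => ?_)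
  · refine (key x l l' (h1 x hx) (k1 x hx)).trans
      (mul_le_mul_of_nonneg_right ?_ (jb_rpow_pos x _).le)
    have : 0 ≤ |m| * D + A * D := by positivity
    linarith
  · refine (key x m m' (h2 x hx) (k2 x hx)).trans
      (mul_le_mul_of_nonneg_right ?_ (jb_rpow_pos x _).le)
    have : 0 ≤ |l| * D + A * D := by positivity
    linarith
  · have hj := jb_rpow_pos x (-γ + 1)
    calc _ ≤ ‖deriv p x‖ * ‖q x‖ + ‖p x‖ * ‖deriv q x‖ := by
          refine (norm_add_le _ _).trans ?_
          rw [norm_mul, norm_mul]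
      _ ≤ (C * jb x ^ (-γ + 1)) * B + A * (D * jb x ^ (-γ + 1)) := by
          gcongr
          · exact h3 x
          · exact hqB x
          · exact hpA x
          · exact k3 x
      _ = (C * B + A * D) * jb x ^ (-γ + 1) := by ring
      _ ≤ _ := by
          refine mul_le_mul_of_nonneg_right ?_ hj.le
          have : 0 ≤ |l| * D + |m| * D := by positivity
          linarith

theorem conj (hp : StepLike γ p l m) :
    StepLike γ (fun x => (starRingEnd ℂ) (p x)) l m := by
  obtain ⟨C, hC, h1, h2, h3⟩ := hp.decay
  refine of_hasDerivAt (p' := fun x => (starRingEnd ℂ) (deriv p x))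
    (fun x => (hp.hasDerivAt x).star) (Complex.continuous_conj.comp hp.continuous_deriv)
    hC (fun x hx => ?_) (fun x hx => ?_) (fun x => ?_)
  · rw [← Complex.conj_ofReal, ← map_sub, RCLike.norm_conj]; exact h1 x hx
  · rw [← Complex.conj_ofReal, ← map_sub, RCLike.norm_conj]; exact h2 x hx
  · rw [RCLike.norm_conj]; exact h3 x

theorem prod_fin_four (hγ : 1 ≤ γ) {p : Fin 4 → ℝ → ℂ} {l m : Fin 4 → ℝ}
    (h : ∀ j, StepLike γ (p j) (l j) (m j)) :
    StepLike γ (fun x => ∏ j, p j x) (∏ j, l j) (∏ j, m j) := by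
  simp only [Fin.prod_univ_four]
  exact (((h 0).mul hγ (h 1)).mul hγ (h 2)).mul hγ (h 3)

theorem decaysC1 (hp : StepLike γ p 0 0) : DecaysC1 γ p := by
  obtain ⟨C, -, h1, h2, h3⟩ := hp.decay
  refine ⟨hp.contDiff, C, fun x => ⟨?_, h3 x⟩⟩
  rcases le_total 0 x with h | h
  · simpa using h1 x h
  · simpa using h2 x h

end StepLike

theorem DecaysC1.integrable {γ : ℝ} (hγ : 5 / 2 < γ) {g : ℝ → ℂ} (hg : DecaysC1 γ g) :
    Integrable g := by
  obtain ⟨hc, C, hC⟩ := hg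
  exact ((integrable_jb_rpow (r := -γ + 1) (by linarith)).const_mul C).mono'
    hc.continuous.aestronglyMeasurable (.of_forall fun x => (hC x).1)

/-! ### The Gaussian primitive, the cut-offs and the resonance are step-like -/

theorem jb_le_one_add_abs (x : ℝ) : jb x ≤ 1 + |x| := by
  rw [jb, Real.sqrt_le_left (by positivity)]
  nlinarith [abs_nonneg x, sq_abs x]

theorem exists_exp_le_jb_rpow (r : ℝ) :
    ∃ C, 0 ≤ C ∧ ∀ t, Real.exp (-(t ^ 2 / 2)) ≤ C * jb t ^ (-r) := by
  obtain ⟨n, hn⟩ := exists_nat_ge r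
  refine ⟨2 ^ (n - 1) * (1 + (1 + 2 ^ n * n.factorial)), by positivity, fun t => ?_⟩
  have hj := jb_rpow_pos t r
  rw [Real.rpow_neg (jb_pos t).le, ← div_eq_mul_inv, le_div_iff₀ hj]
  have h1 : jb t ^ r ≤ 2 ^ (n - 1) * (1 + |t| ^ n) := by
    calc jb t ^ r ≤ jb t ^ (n : ℝ) := Real.rpow_le_rpow_of_exponent_le (one_le_jb t) hn
      _ = jb t ^ n := Real.rpow_natCast _ _
      _ ≤ (1 + |t|) ^ n := by
          gcongr
          · exact (jb_pos t).le
          · exact jb_le_one_add_abs t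
      _ ≤ 2 ^ (n - 1) * (1 ^ n + |t| ^ n) := add_pow_le zero_le_one (abs_nonneg t) n
      _ = _ := by rw [one_pow]
  have h2 := abs_pow_mul_exp_le n t
  have h3 : Real.exp (-(t ^ 2 / 2)) ≤ 1 := Real.exp_le_one_iff.2 (by nlinarith [sq_nonneg t])
  calc _ ≤ Real.exp (-(t ^ 2 / 2)) * (2 ^ (n - 1) * (1 + |t| ^ n)) := by gcongr
    _ = 2 ^ (n - 1) * (Real.exp (-(t ^ 2 / 2)) + |t| ^ n * Real.exp (-(t ^ 2 / 2))) := by ring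
    _ ≤ _ := by gcongr

theorem stepLike_gaussPrim {γ : ℝ} (hγ : 1 ≤ γ) :
    StepLike γ (fun x => (gaussPrim x : ℂ)) (Real.sqrt (Real.pi / 2))
      (-Real.sqrt (Real.pi / 2)) := by
  obtain ⟨C, hC, hexp⟩ := exists_exp_le_jb_rpow (γ + 1)
  have hI := integrable_jb_rpow (r := -2) (by norm_num)
  set J := ∫ t, jb t ^ (-2 : ℝ)
  have hJ : 0 ≤ J := integral_nonneg fun t => (jb_rpow_pos t _).le
  have hpt : ∀ x t, 0 ≤ x → x ≤ t → Real.exp (-(t ^ 2 / 2))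
      ≤ C * jb x ^ (-γ + 1) * jb t ^ (-2 : ℝ) := by
    intro x t hx ht
    have hle : jb x ≤ jb t := Real.sqrt_le_sqrt (by nlinarith)
    have h1 : jb t ^ (-γ + 1) ≤ jb x ^ (-γ + 1) :=
      Real.rpow_le_rpow_of_nonpos (jb_pos x) hle (by linarith)
    calc _ ≤ C * jb t ^ (-(γ + 1)) := hexp t
      _ = C * (jb t ^ (-γ + 1) * jb t ^ (-2 : ℝ)) := by
          rw [← Real.rpow_add (jb_pos t)]; congr 2; ring
      _ ≤ C * (jb x ^ (-γ + 1) * jb t ^ (-2 : ℝ)) := by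
          have := jb_rpow_pos t (-2)
          gcongr
      _ = _ := by ring
  have tail : ∀ x, 0 ≤ x → |gaussPrim x - Real.sqrt (Real.pi / 2)|
      ≤ C * J * jb x ^ (-γ + 1) := by
    intro x hx
    rw [abs_sub_comm, sqrt_sub_gaussPrim hx, abs_of_nonneg (setIntegral_nonneg measurableSet_Ioi
      fun t _ => (Real.exp_pos _).le)]
    have hj := jb_rpow_pos x (-γ + 1)
    calc _ ≤ ∫ t in Ioi x, C * jb x ^ (-γ + 1) * jb t ^ (-2 : ℝ) :=
          setIntegral_mono_on integrable_exp_neg_sq_half.integrableOn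
            (hI.const_mul _).integrableOn measurableSet_Ioi fun t ht => hpt x t hx (le_of_lt ht)
      _ = C * jb x ^ (-γ + 1) * ∫ t in Ioi x, jb t ^ (-2 : ℝ) := integral_const_mul _ _
      _ ≤ C * jb x ^ (-γ + 1) * J := by
          gcongr
          exact setIntegral_le_integral hI (.of_forall fun t => (jb_rpow_pos t _).le)
      _ = _ := by ring
  refine StepLike.of_hasDerivAt (C := C * J + C)
    (fun x => (hasDerivAt_gaussPrim x).ofReal_comp)
    (Complex.continuous_ofReal.comp continuous_exp_neg_sq_half) (by positivity)
    (fun x hx => ?_) (fun x hx => ?_) (fun x => ?_)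
  · rw [← Complex.ofReal_sub, Complex.norm_real, add_mul]
    have := mul_nonneg hC (jb_rpow_pos x (-γ + 1)).le
    exact (tail x hx).trans (by linarith)
  · have h := tail (-x) (by linarith)
    rw [gaussPrim_neg, jb_neg] at h
    rw [← Complex.ofReal_sub, Complex.norm_real, add_mul, Real.norm_eq_abs, sub_neg_eq_add]
    have e : |gaussPrim x + Real.sqrt (Real.pi / 2)|
        = |-gaussPrim x - Real.sqrt (Real.pi / 2)| := by rw [← abs_neg]; congr 1; ring
    rw [e]
    have := mul_nonneg hC (jb_rpow_pos x (-γ + 1)).le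
    linarith
  · rw [Complex.norm_real, Real.norm_of_nonneg (Real.exp_pos _).le]
    have hj := jb_rpow_pos x (-γ + 1)
    calc _ ≤ C * jb x ^ (-(γ + 1)) := hexp x
      _ ≤ C * jb x ^ (-γ + 1) := by
          gcongr
          · exact one_le_jb x
          · linarith
      _ ≤ _ := by rw [add_mul]; have := mul_nonneg (mul_nonneg hC hJ) hj.le; linarith

namespace IsBump

variable {Φ : ℝ → ℝ}

theorem integrable (hΦ : IsBump Φ) : Integrable Φ := by
  by_contra h
  have := hΦ.integral_eq
  rw [integral_undef h] at this
  norm_num at this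

theorem hasDerivAt_chiPlus (hΦ : IsBump Φ) (x : ℝ) : HasDerivAt (chiPlus Φ) (Φ x) x := by
  have hc : Continuous Φ := hΦ.smooth.continuous
  have e : chiPlus Φ = fun x => chiPlus Φ 0 + ∫ t in (0 : ℝ)..x, Φ t := by
    funext y
    rw [← intervalIntegral.integral_Iic_sub_Iic hΦ.integrable.integrableOn
      hΦ.integrable.integrableOn, chiPlus, chiPlus]
    ring
  rw [e]
  exact (intervalIntegral.integral_hasDerivAt_right (hc.intervalIntegrable _ _)
    (hc.stronglyMeasurableAtFilter _ _) hc.continuousAt).const_add _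

theorem chiPlus_eq_one (hΦ : IsBump Φ) {x : ℝ} (hx : 2 ≤ x) : chiPlus Φ x = 1 := by
  rw [chiPlus, ← hΦ.integral_eq]
  refine setIntegral_eq_integral_of_forall_compl_eq_zero fun y hy => hΦ.vanish y fun h => ?_
  simp only [mem_Iic, not_le] at hy
  linarith [h.2]

theorem chiPlus_eq_zero (hΦ : IsBump Φ) {x : ℝ} (hx : x ≤ -2) : chiPlus Φ x = 0 := by
  rcases hx.lt_or_eq with h | h
  · rw [chiPlus]
    refine setIntegral_eq_zero_of_forall_eq_zero fun y hy => hΦ.vanish y fun h' => ?_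
    simp only [mem_Iic] at hy
    linarith [h'.1]
  · rw [chiPlus, integral_Iic_eq_integral_Iio]
    refine setIntegral_eq_zero_of_forall_eq_zero fun y hy => hΦ.vanish y fun h' => ?_
    simp only [mem_Iio] at hy
    linarith [h'.1]

theorem chiPlus_mem (hΦ : IsBump Φ) (x : ℝ) : 0 ≤ chiPlus Φ x ∧ chiPlus Φ x ≤ 1 := by
  refine ⟨setIntegral_nonneg measurableSet_Iic fun y _ => hΦ.nonneg y, ?_⟩
  rw [← hΦ.integral_eq]
  exact setIntegral_le_integral hΦ.integrable (.of_forall hΦ.nonneg)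

theorem stepLike_chiPlus (hΦ : IsBump Φ) {γ : ℝ} (hγ : 1 ≤ γ) :
    StepLike γ (fun x => (chiPlus Φ x : ℂ)) 1 0 := by
  have hc : Continuous Φ := hΦ.smooth.continuous
  obtain ⟨B, hB⟩ := isCompact_Icc.exists_bound_of_continuousOn (s := Icc (-2 : ℝ) 2)
    hc.continuousOn
  have hB0 : 0 ≤ B := (norm_nonneg _).trans (hB 0 (by norm_num))
  -- on `[-2, 2]` the weight `⟨x⟩ ^ (-γ + 1)` is bounded below
  have hlow : ∀ x ∈ Icc (-2 : ℝ) 2, 1 ≤ (3 : ℝ) ^ (γ - 1) * jb x ^ (-γ + 1) := by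
    intro x hx
    have h3 : jb x ≤ 3 := (jb_le_one_add_abs x).trans (by
      have := abs_le.2 hx; linarith)
    have h : (3 : ℝ) ^ (-γ + 1) ≤ jb x ^ (-γ + 1) :=
      Real.rpow_le_rpow_of_nonpos (jb_pos x) h3 (by linarith)
    calc (1 : ℝ) = 3 ^ (γ - 1) * 3 ^ (-γ + 1) := by
          rw [← Real.rpow_add (by norm_num)]; ring_nf; simp
      _ ≤ _ := by gcongr
  have h3p : (0 : ℝ) < 3 ^ (γ - 1) := Real.rpow_pos_of_pos (by norm_num) _
  have key : ∀ (A : ℝ) (z : ℂ) x, 0 ≤ A → (x ∈ Icc (-2 : ℝ) 2 → ‖z‖ ≤ A) →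
      (x ∉ Icc (-2 : ℝ) 2 → z = 0) → ‖z‖ ≤ (A * 3 ^ (γ - 1)) * jb x ^ (-γ + 1) := by
    intro A z x hA h1 h2
    by_cases hx : x ∈ Icc (-2 : ℝ) 2
    · rw [mul_assoc]
      exact (h1 hx).trans (le_mul_of_one_le_right hA (hlow x hx))
    · rw [h2 hx, norm_zero]
      have := jb_rpow_pos x (-γ + 1)
      positivity
  have hle : ∀ x, 1 * (3 : ℝ) ^ (γ - 1) * jb x ^ (-γ + 1)
      ≤ ((1 + B) * 3 ^ (γ - 1)) * jb x ^ (-γ + 1) := fun x => by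
    have := jb_rpow_pos x (-γ + 1)
    gcongr; linarith
  refine StepLike.of_hasDerivAt (C := (1 + B) * 3 ^ (γ - 1))
    (fun x => (hΦ.hasDerivAt_chiPlus x).ofReal_comp) (Complex.continuous_ofReal.comp hc)
    (by positivity) (fun x hx => ?_) (fun x hx => ?_) (fun x => ?_)
  · refine (key 1 _ x zero_le_one (fun _ => ?_) fun h => ?_).trans (hle x)
    · rw [← Complex.ofReal_sub, Complex.norm_real, Real.norm_eq_abs, abs_le]
      constructor <;> linarith [hΦ.chiPlus_mem x]
    · rw [hΦ.chiPlus_eq_one (by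
        by_contra h'; exact h ⟨by linarith, by linarith⟩)]; simp
  · refine (key 1 _ x zero_le_one (fun _ => ?_) fun h => ?_).trans (hle x)
    · rw [← Complex.ofReal_sub, Complex.norm_real, Real.norm_eq_abs, abs_le]
      constructor <;> linarith [hΦ.chiPlus_mem x]
    · rw [hΦ.chiPlus_eq_zero (by
        by_contra h'; exact h ⟨by linarith, by linarith⟩)]; simp
  · refine key (1 + B) _ x (by positivity) (fun h => ?_) fun h => ?_
    · rw [Complex.norm_real]; linarith [hB x h]
    · rw [hΦ.vanish x h]; simp

theorem stepLike_chiMinus (hΦ : IsBump Φ) {γ : ℝ} (hγ : 1 ≤ γ) :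
    StepLike γ (fun x => (chiMinus Φ x : ℂ)) 0 1 := by
  have h := (StepLike.const γ 1).add ((hΦ.stepLike_chiPlus hγ).const_mul (-1))
  have e : (fun x => ((1 : ℝ) : ℂ) + ((-1 : ℝ) : ℂ) * (chiPlus Φ x : ℂ))
      = fun x => (chiMinus Φ x : ℂ) := by
    funext x; simp only [chiMinus]; push_cast; ring
  rw [e] at h
  norm_num at h
  exact h

end IsBump

/-- The odd zero energy resonance interpolates between `-1` and `1`. -/
theorem stepLike_psiPlus_zero {V : ℝ → ℝ} {γ : ℝ} (hγ : 2 ≤ γ)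
    (hV : Integrable fun x => jb x ^ γ * V x) (hodd : OddZeroEnergyResonance V) :
    StepLike γ (fun x => psiPlus V x 0) 1 (-1) := by
  have hV2 := integrable_moment_of_jb hγ hV
  obtain ⟨C, hC, h⟩ := exists_decay_mPlus hγ hV
  have hd : ∀ x, HasDerivAt (fun x => psiPlus V x 0) (tailPlus V 0 x) x := fun x =>
    (hasDerivAt_psiPlus hV2 x 0).congr_deriv (by simp)
  have hp : ∀ x, 0 ≤ x → ‖psiPlus V x 0 - 1‖ ≤ C * jb x ^ (-γ + 1) := fun x hx => by
    rw [psiPlus_zero_eq]; exact (h x 0 (by linarith)).1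
  -- the derivative of an odd function is even
  have heven : ∀ x, tailPlus V 0 (-x) = tailPlus V 0 x := by
    intro x
    have h1 := (hd (-x)).scomp x (hasDerivAt_neg x)
    have e : (fun x => psiPlus V x 0) ∘ Neg.neg = fun x => -psiPlus V x 0 := funext hodd
    rw [e] at h1
    have := h1.unique (hd x).neg
    simpa using this
  refine StepLike.of_hasDerivAt (C := C) hd (hasPrim_tailPlus hV2 0).continuous hC
    (fun x hx => ?_) (fun x hx => ?_) (fun x => ?_)
  · simpa using hp x hx
  · have h1 := hp (-x) (by linarith)
    rw [hodd, jb_neg] at h1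
    rw [← norm_neg]
    refine le_trans (le_of_eq ?_) h1
    congr 1; push_cast; ring
  · rcases le_total 0 x with hx | hx
    · exact (h x 0 (by linarith)).2
    · rw [← heven, ← jb_neg]; exact (h (-x) 0 (by linarith)).2

/-! ### Expansion of the fourfold products -/

/-- Conjugation at the first and third place, the identity at the other two. -/
def altConj : Fin 4 → ℂ →+* ℂ :=
  ![starRingEnd ℂ, RingHom.id ℂ, starRingEnd ℂ, RingHom.id ℂ]

/-- The signs `(-, +, -, +)`. -/
def altSign : Fin 4 → ℤˣ := ![-1, 1, -1, 1]

theorem altProd_eq_prod (z : Fin 4 → ℂ) : altProd z = ∏ j, altConj j (z j) := by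
  simp [altProd, altConj, Fin.prod_univ_four]

theorem continuous_altConj (j : Fin 4) : Continuous (altConj j) := by
  fin_cases j
  · exact Complex.continuous_conj
  · exact continuous_id
  · exact Complex.continuous_conj
  · exact continuous_id

theorem norm_altConj (j : Fin 4) (z : ℂ) : ‖altConj j z‖ = ‖z‖ := by
  fin_cases j <;> simp [altConj]

theorem altConj_ofReal (j : Fin 4) (c : ℝ) : altConj j (c : ℂ) = c := by
  fin_cases j <;> simp [altConj]

theorem altConj_wave (j : Fin 4) (x t : ℝ) :
    altConj j (wave x t) = wave x (((altSign j : ℤ) : ℝ) * t) := by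
  fin_cases j <;> simp [altConj, altSign, conj_wave]

theorem norm_altProd (z : Fin 4 → ℂ) : ‖altProd z‖ = ∏ j, ‖z j‖ := by
  rw [altProd_eq_prod, norm_prod]
  exact Finset.prod_congr rfl fun j _ => norm_altConj j _

theorem continuous_altProd : Continuous altProd := by
  have : altProd = fun z => ∏ j, altConj j (z j) := funext altProd_eq_prod
  rw [this]
  exact continuous_finsetProd _ fun j _ => (continuous_altConj j).comp (continuous_apply j)

theorem altProd_mul (z w : Fin 4 → ℂ) :
    altProd (fun j => z j * w j) = altProd z * altProd w := by
  simp only [altProd_eq_prod, map_mul, Finset.prod_mul_distrib]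

theorem altProd_const_mul (c : ℝ) (z : Fin 4 → ℂ) :
    altProd (fun j => (c : ℂ) * z j) = (c : ℂ) ^ 4 * altProd z := by
  rw [altProd_mul, altProd_eq_prod fun _ => (c : ℂ)]
  simp [altConj_ofReal]

theorem altProd_sum {κ : Type*} [Fintype κ] (z : Fin 4 → κ → ℂ) :
    altProd (fun j => ∑ i, z j i) = ∑ σ : Fin 4 → κ, altProd fun j => z j (σ j) := by
  simp only [altProd_eq_prod, map_sum]
  exact Fintype.prod_sum fun j i => altConj j (z j i)

theorem altProd_wave (x : ℝ) (e : Fin 4 → ℤˣ) (k : Fin 4 → ℝ) :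
    altProd (fun j => wave x (((e j : ℤ) : ℝ) * k j))
      = wave x (sdot (fun j => altSign j * e j) k) := by
  simp only [altProd_eq_prod, altConj_wave, sdot, Fin.prod_univ_four, Fin.sum_univ_four,
    wave_mul_wave]
  congr 1
  push_cast; ring

/-! ### Structure of the singular part -/

/-- The `x`-dependent amplitudes of the plane waves in `𝒦♯_S`. -/
def profile (V Φ : ℝ → ℝ) : Fin 5 → ℝ → ℂ :=
  ![fun x => trans V 0 * mPlus V x 0, fun x => (chiPlus Φ x : ℂ), fun x => (chiPlus Φ x : ℂ),
    fun x => (chiMinus Φ x : ℂ), fun x => (chiMinus Φ x : ℂ)]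

/-- The `k`-dependent amplitudes of the plane waves in `𝒦♯_S`. -/
def coeff (V : ℝ → ℝ) : Fin 5 → ℝ → ℂ :=
  ![fun _ => 1, fun k => (trans V k - trans V 0) * indPlus k,
    fun k => -reflPlus V (-k) * indMinus k, fun k => reflMinus V k * indPlus k,
    fun k => -(trans V (-k) - trans V 0) * indMinus k]

/-- The signs of the frequencies of the plane waves in `𝒦♯_S`. -/
def waveSign : Fin 5 → ℤˣ := ![1, 1, -1, -1, 1]

/-- `𝒦♯_S` is a sum of five plane waves, each with an amplitude that separates `x` and `k`. Only
the resonance, the term of index `0`, has a coefficient that does not vanish at `k = 0`. -/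
theorem sharpKS_eq_sum (V Φ : ℝ → ℝ) (x k : ℝ) :
    sharpKS V Φ x k
      = ∑ i, profile V Φ i x * coeff V i k * wave x (((waveSign i : ℤ) : ℝ) * k) := by
  simp [Fin.sum_univ_five, profile, coeff, waveSign, sharpKS, sharpK0, sharpKp, sharpKm]
  ring

theorem coeff_mem_goodCoeff (V : ℝ → ℝ) (i : Fin 5) : coeff V i ∈ goodCoeff V := by
  fin_cases i <;> simp [coeff, goodCoeff]

/-- The signs of the four frequencies in a term of the expansion of `∏ 𝒦♯_S`. -/
def waveVec (σ : Fin 4 → Fin 5) (j : Fin 4) : ℤˣ := altSign j * waveSign (σ j)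

/-- The `k`-dependent amplitude of a term of the expansion of `∏ 𝒦♯_S`. -/
def coeffProd (V : ℝ → ℝ) (σ : Fin 4 → Fin 5) (k : Fin 4 → ℝ) : ℂ :=
  altProd fun j => coeff V (σ j) (k j)

/-- The `x`-dependent amplitude of a term of the expansion of `∏ 𝒦♯_S`. -/
def profileProd (V Φ : ℝ → ℝ) (σ : Fin 4 → Fin 5) (x : ℝ) : ℂ :=
  altProd fun j => profile V Φ (σ j) x

/-- The terms of the expansion are indexed by the choice `σ` of one of the five plane waves in each
of the four places. -/
theorem altProd_sharpKS (V Φ : ℝ → ℝ) (x : ℝ) (k : Fin 4 → ℝ) :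
    altProd (fun j => sharpKS V Φ x (k j))
      = ∑ σ, profileProd V Φ σ x * (coeffProd V σ k * wave x (sdot (waveVec σ) k)) := by
  simp only [sharpKS_eq_sum]
  rw [altProd_sum fun j i => profile V Φ i x * coeff V i (k j)
    * wave x (((waveSign i : ℤ) : ℝ) * k j)]
  refine Finset.sum_congr rfl fun σ _ => ?_
  rw [altProd_mul, altProd_mul, altProd_wave x (fun j => waveSign (σ j)) k, mul_assoc]
  rfl

theorem coeffProd_mem_coeffC (V : ℝ → ℝ) (σ : Fin 4 → Fin 5) : coeffProd V σ ∈ coeffC V :=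
  ⟨fun j => coeff V (σ j), fun _ => coeff_mem_goodCoeff V _, rfl⟩

theorem altProd_add_eq_sum (V Φ : ℝ → ℝ) (x : ℝ) (k : Fin 4 → ℝ) :
    altProd (fun j => sharpKS V Φ x (k j) + sharpKR V Φ x (k j))
      = altProd (fun j => sharpKS V Φ x (k j))
        + ∑ A ∈ indexR, altProd fun j => sharpKA V Φ (A j) x (k j) := by
  have e : ∀ j, sharpKS V Φ x (k j) + sharpKR V Φ x (k j)
      = ∑ b : Bool, sharpKA V Φ b x (k j) := fun j => by
    simp [sharpKA, add_comm]
  simp only [e]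
  rw [altProd_sum fun j b => sharpKA V Φ b x (k j), indexR,
    ← Finset.add_sum_erase _ _ (Finset.mem_univ (fun _ : Fin 4 => false))]
  simp [sharpKA]

/-! ### The coefficients and the splitting of `𝒦♯` -/

section scattering

variable {V : ℝ → ℝ} {γ : ℝ}

/-- Here the value `R_±(0) = 0` of the non-generic case enters; it makes the coefficients
continuous, although they are cut off at `k = 0`. -/
theorem coeff_zero (hγ : 2 < γ) (hV : Integrable fun x => jb x ^ γ * V x)
    (hodd : OddZeroEnergyResonance V) {i : Fin 5} (hi : i ≠ 0) : coeff V i 0 = 0 := by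
  have hR := (reflMinus_spec hγ hV hodd).1
  fin_cases i
  · exact absurd rfl hi
  · simp [coeff]
  · simp [coeff, indMinus]
  · simp [coeff, hR]
  · simp [coeff]

theorem continuous_mul_indPlus {h : ℝ → ℂ} (hc : Continuous h) (h0 : h 0 = 0) :
    Continuous fun k => h k * indPlus k := by
  have e : (fun k => h k * indPlus k) = fun k => if 0 ≤ k then h k else 0 := by
    funext k; by_cases hk : 0 ≤ k <;> simp [indPlus, hk]
  rw [e]
  exact hc.if_le continuous_const continuous_const continuous_id fun k hk => by
    have hk' : (0 : ℝ) = k := hk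
    rw [← hk', h0]

theorem indMinus_eq (k : ℝ) : indMinus k = 1 - indPlus k := by
  by_cases hk : 0 ≤ k
  · simp [indMinus, indPlus, hk]
  · simp [indMinus, indPlus, hk, not_le.1 hk]

theorem continuous_mul_indMinus {h : ℝ → ℂ} (hc : Continuous h) (h0 : h 0 = 0) :
    Continuous fun k => h k * indMinus k := by
  simp only [indMinus_eq, mul_sub, mul_one]
  exact hc.sub (continuous_mul_indPlus hc h0)

theorem reflPlus_spec (hγ : 2 < γ) (hV : Integrable fun x => jb x ^ γ * V x)
    (hodd : OddZeroEnergyResonance V) :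
    reflPlus V 0 = 0 ∧ Continuous (reflPlus V) ∧ ∀ k, ‖reflPlus V k‖ ≤ 1 := by
  have hV2 := integrable_moment_of_jb hγ.le hV
  rw [reflPlus_eq_mirror hγ hV]
  have h := reflMinus_spec hγ (integrable_jb_mirror hV) (hodd.mirror hV2)
  exact ⟨h.1, h.2.1, h.2.2.1⟩

theorem continuous_coeff (hγ : 2 < γ) (hV : Integrable fun x => jb x ^ γ * V x)
    (hodd : OddZeroEnergyResonance V) (i : Fin 5) : Continuous (coeff V i) := by
  obtain ⟨-, hT, -, -⟩ := trans_spec hγ hV hodd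
  obtain ⟨hR0, hR, -, -⟩ := reflMinus_spec hγ hV hodd
  obtain ⟨hP0, hP, -⟩ := reflPlus_spec hγ hV hodd
  fin_cases i
  · exact continuous_const
  · exact continuous_mul_indPlus (by fun_prop) (by simp)
  · exact continuous_mul_indMinus (by fun_prop) (by simp [hP0])
  · exact continuous_mul_indPlus hR hR0
  · exact continuous_mul_indMinus (by fun_prop) (by simp)

theorem norm_indPlus_le (k : ℝ) : ‖indPlus k‖ ≤ 1 := by
  unfold indPlus; split_ifs <;> simp

theorem norm_indMinus_le (k : ℝ) : ‖indMinus k‖ ≤ 1 := by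
  unfold indMinus; split_ifs <;> simp

theorem norm_coeff_le (hγ : 2 < γ) (hV : Integrable fun x => jb x ^ γ * V x)
    (hodd : OddZeroEnergyResonance V) (i : Fin 5) (k : ℝ) : ‖coeff V i k‖ ≤ 2 := by
  obtain ⟨-, -, hT, -⟩ := trans_spec hγ hV hodd
  obtain ⟨-, -, hR, -⟩ := reflMinus_spec hγ hV hodd
  obtain ⟨-, -, hP⟩ := reflPlus_spec hγ hV hodd
  have hTT : ∀ k, ‖trans V k - trans V 0‖ ≤ 2 := fun k =>
    (norm_sub_le _ _).trans (by linarith [hT k, hT 0])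
  have hmul : ∀ a b : ℂ, ‖a‖ ≤ 2 → ‖b‖ ≤ 1 → ‖a * b‖ ≤ 2 := fun a b ha hb => by
    rw [norm_mul]; nlinarith [norm_nonneg a, norm_nonneg b]
  fin_cases i
  · simp [coeff]
  · exact hmul _ _ (hTT k) (norm_indPlus_le k)
  · exact hmul _ _ (by rw [norm_neg]; linarith [hP (-k)]) (norm_indMinus_le k)
  · exact hmul _ _ (by linarith [hR k]) (norm_indPlus_le k)
  · exact hmul _ _ (by rw [norm_neg]; exact hTT _) (norm_indMinus_le k)

theorem coeffProd_eq_zero (hγ : 2 < γ) (hV : Integrable fun x => jb x ^ γ * V x)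
    (hodd : OddZeroEnergyResonance V) {σ : Fin 4 → Fin 5} {j : Fin 4} (hj : σ j ≠ 0)
    {k : Fin 4 → ℝ} (hk : k j = 0) : coeffProd V σ k = 0 := by
  rw [coeffProd, altProd_eq_prod]
  refine Finset.prod_eq_zero (Finset.mem_univ j) ?_
  rw [hk, coeff_zero hγ hV hodd hj, map_zero]

theorem coeffProd_mem_coeffCL (hγ : 2 < γ) (hV : Integrable fun x => jb x ^ γ * V x)
    (hodd : OddZeroEnergyResonance V) {σ : Fin 4 → Fin 5} (hσ : σ ≠ 0) :
    coeffProd V σ ∈ coeffCL V := by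
  obtain ⟨j, hj⟩ := Function.ne_iff.1 hσ
  have h0 : coeffProd V σ 0 = 0 := coeffProd_eq_zero hγ hV hodd hj rfl
  refine ⟨coeffProd_mem_coeffC V σ, ?_⟩
  rintro (h | h) <;> · rw [h] at h0; simp at h0

theorem amplitude_coeffProd_mul (hγ : 2 < γ) (hV : Integrable fun x => jb x ^ γ * V x)
    (hodd : OddZeroEnergyResonance V) (σ : Fin 4 → Fin 5) (G : 𝓢(Fin 4 → ℝ, ℂ)) :
    Amplitude fun k => coeffProd V σ k * G k := by
  simp only [coeffProd, altProd_eq_prod]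
  exact amplitude_prod_mul (b := fun j k => altConj j (coeff V (σ j) k))
    (fun j => (continuous_altConj j).comp (continuous_coeff hγ hV hodd _))
    ⟨2, fun j k => by rw [norm_altConj]; exact norm_coeff_le hγ hV hodd _ k⟩ G

theorem trans_mul_psiPlus (hγ : 2 < γ) (hV : Integrable fun x => jb x ^ γ * V x)
    (hodd : OddZeroEnergyResonance V) (x k : ℝ) :
    trans V k * psiPlus V x k = psiMinus V x (-k) + reflMinus V k * psiMinus V x k := by
  have hV2 := integrable_moment_of_jb hγ.le hV
  have hT := trans_spec hγ hV hodd
  have hR := reflMinus_spec hγ hV hodd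
  by_cases hk : k = 0
  · rw [hk, hT.1, hR.1, neg_zero, psiMinus_zero hV2 hodd]; ring
  · rw [hT.2.2.2 k hk, hR.2.2.2 k hk, (psiPlus_eq_scattering hV2 hk x).1]
    have := jostAlpha_ne_zero hV2 hk
    field_simp

theorem trans_mul_psiMinus (hγ : 2 < γ) (hV : Integrable fun x => jb x ^ γ * V x)
    (hodd : OddZeroEnergyResonance V) (x k : ℝ) :
    trans V k * psiMinus V x k = psiPlus V x (-k) + reflPlus V k * psiPlus V x k := by
  have hV2 := integrable_moment_of_jb hγ.le hV
  have h := trans_mul_psiPlus hγ (integrable_jb_mirror hV) (hodd.mirror hV2) (-x) k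
  rw [trans_mirror hγ hV hodd, psiMinus_eq_mirror (integrable_moment_mirror hV2),
    psiMinus_eq_mirror (integrable_moment_mirror hV2), mirror_mirror, neg_neg,
    ← psiMinus_eq_mirror hV2, ← reflPlus_eq_mirror hγ hV] at h
  exact h

/-- As `T(0) = -1`, the resonance term `T(0) m₊(x, 0)` is also `m₋(x, 0)`: the sign change in `𝒦♯`
for `k < 0` matches the two ends of the odd resonance. -/
theorem mMinus_zero (hV : Integrable fun t => (1 + |t|) ^ 2 * V t)
    (hodd : OddZeroEnergyResonance V) (x : ℝ) : mMinus V x 0 = -mPlus V x 0 := by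
  rw [← psiPlus_zero_eq, ← psiMinus_zero hV hodd, mMinus]; simp

theorem psiMinus_eq_wave_mul_mMinus (hV : Integrable fun t => (1 + |t|) ^ 2 * V t) (x k : ℝ) :
    psiMinus V x k = wave x (-k) * mMinus V x k := by
  rw [psiMinus_eq_wave_mul hV, mMinus_eq_mirror hV]

/-- The decomposition `√(2π) 𝒦♯ = 𝒦♯_S + 𝒦♯_R`. On the side where the plane waves of the Jost
function in `𝒦♯` are not normalized, the scattering relation is used. -/
theorem sqrt_mul_sharpK (hγ : 2 < γ) (hV : Integrable fun x => jb x ^ γ * V x)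
    (hodd : OddZeroEnergyResonance V) (Φ : ℝ → ℝ) (x k : ℝ) :
    ((Real.sqrt (2 * Real.pi) : ℝ) : ℂ) * sharpK V x k = sharpKS V Φ x k + sharpKR V Φ x k := by
  have hV2 := integrable_moment_of_jb hγ.le hV
  have hsq : ((Real.sqrt (2 * Real.pi) : ℝ) : ℂ) ≠ 0 := by
    exact_mod_cast (Real.sqrt_pos.2 Real.two_pi_pos).ne'
  have hT0 := (trans_spec hγ hV hodd).1
  have hm0 := mMinus_zero hV2 hodd x
  have hχ : (chiMinus Φ x : ℂ) = 1 - chiPlus Φ x := by simp [chiMinus]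
  by_cases hk : 0 ≤ k
  · have h := trans_mul_psiPlus hγ hV hodd x k
    rw [psiMinus_eq_wave_mul_mMinus hV2, psiMinus_eq_wave_mul_mMinus hV2, neg_neg] at h
    simp only [sharpK, eigK, sharpKS, sharpKR, sharpK0, sharpKp, sharpKm, hk, if_true, indPlus,
      indMinus, not_lt.2 hk, if_false]
    rw [mul_inv_cancel_left₀ hsq, hχ, hT0, hm0]
    have h' := psiPlus_eq_wave_mul V x k
    linear_combination (1 - (chiPlus Φ x : ℂ)) * h + (chiPlus Φ x : ℂ) * trans V k * h'
  · have h := trans_mul_psiMinus hγ hV hodd x (-k)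
    rw [psiPlus_eq_wave_mul, psiPlus_eq_wave_mul, neg_neg] at h
    have h' := psiMinus_eq_wave_mul_mMinus hV2 x (-k)
    rw [neg_neg] at h'
    simp only [sharpK, eigK, sharpKS, sharpKR, sharpK0, sharpKp, sharpKm, hk, if_true, indPlus,
      indMinus, not_le.1 hk, if_false]
    rw [mul_neg, mul_inv_cancel_left₀ hsq, hχ, hT0, hm0]
    linear_combination -(chiPlus Φ x : ℂ) * h - (1 - (chiPlus Φ x : ℂ)) * trans V (-k) * h'

theorem two_pi_sq_mul_altProd_sharpK (hγ : 2 < γ) (hV : Integrable fun x => jb x ^ γ * V x)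
    (hodd : OddZeroEnergyResonance V) (Φ : ℝ → ℝ) (x : ℝ) (k : Fin 4 → ℝ) :
    ((2 * Real.pi : ℝ) : ℂ) ^ 2 * altProd (fun j => sharpK V x (k j))
      = altProd (fun j => sharpKS V Φ x (k j))
        + ∑ A ∈ indexR, altProd fun j => sharpKA V Φ (A j) x (k j) := by
  rw [← altProd_add_eq_sum]
  simp only [← sqrt_mul_sharpK hγ hV hodd Φ]
  rw [altProd_const_mul]
  congr 1
  have := Real.sq_sqrt Real.two_pi_pos.le
  rw [← Complex.ofReal_pow, ← Complex.ofReal_pow]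
  congr 1
  calc (2 * Real.pi) ^ 2 = (Real.sqrt (2 * Real.pi) ^ 2) ^ 2 := by rw [this]
    _ = _ := by ring

end scattering

/-! ### Extraction of the delta function and the principal value -/

/-- The decaying part of a step-like profile with limits `l` and `m`. -/
def stepRemainder (P : ℝ → ℂ) (l m : ℝ) (x : ℝ) : ℂ :=
  P x + (((-((l - m) / Real.sqrt (2 * Real.pi)) : ℝ) : ℂ) * gaussPrim x
    + ((-((l + m) / 2) : ℝ) : ℂ))

theorem sqrt_two_pi_eq : Real.sqrt (2 * Real.pi) = 2 * Real.sqrt (Real.pi / 2) := by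
  rw [show 2 * Real.pi = 2 ^ 2 * (Real.pi / 2) by ring, Real.sqrt_mul (by norm_num),
    Real.sqrt_sq (by norm_num)]

/-- The subtracted multiple of `gaussPrim`, whose limits are `±√(π / 2)`, and the constant match
both limits of the profile. -/
theorem decaysC1_stepRemainder {γ : ℝ} (hγ : 1 ≤ γ) {P : ℝ → ℂ} {l m : ℝ}
    (hP : StepLike γ P l m) : DecaysC1 γ (stepRemainder P l m) := by
  have h := hP.add (((stepLike_gaussPrim hγ).const_mul (-((l - m) / Real.sqrt (2 * Real.pi)))).add
    (StepLike.const γ (-((l + m) / 2))))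
  have hp : 0 < Real.sqrt (Real.pi / 2) := Real.sqrt_pos.2 (by positivity)
  refine StepLike.decaysC1 ?_
  have e : stepRemainder P l m = fun x => P x + (((-((l - m) / Real.sqrt (2 * Real.pi)) : ℝ) : ℂ)
    * gaussPrim x + ((-((l + m) / 2) : ℝ) : ℂ)) := rfl
  rw [e]
  convert h using 1
  · rw [sqrt_two_pi_eq]; field_simp; ring
  · rw [sqrt_two_pi_eq]; field_simp; ring

/-- A step-like profile is a constant plus a multiple of `gaussPrim` plus a decaying part.
Integrated against the Fourier transform of `F` along `ε`, these give the delta function, the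
principal value, and a smooth function of `ε · k`. -/
theorem integral_stepLike_mul {γ : ℝ} (hγ : 5 / 2 < γ) {P : ℝ → ℂ} {l m : ℝ}
    (hP : StepLike γ P l m) {F : (Fin 4 → ℝ) → ℂ} (hF : Amplitude F) (ε : Fin 4 → ℤˣ) {vP : ℂ}
    (hv : vP = -((2 * Real.pi : ℂ)⁻¹ * ∫ x, (gaussPrim x : ℂ) * ∫ k, F k * wave x (sdot ε k))) :
    Integrable (fun x => P x * ∫ k, F k * wave x (sdot ε k)) ∧
    ∫ x, P x * ∫ k, F k * wave x (sdot ε k)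
      = Real.pi * (l + m) * fiberIntegral ε F 0 - Real.sqrt (2 * Real.pi) * (l - m) * vP
        + Real.sqrt (2 * Real.pi)
          * ∫ k, unitaryFT (stepRemainder P l m) (sdot (-ε) k) * F k := by
  have hg := decaysC1_stepRemainder (by linarith) hP
  have hgi := hg.integrable hγ
  obtain ⟨B, -, hB⟩ := hP.bounded (by linarith)
  obtain ⟨D, -, hD⟩ : ∃ D, 0 ≤ D ∧ ∀ x, ‖(gaussPrim x : ℂ)‖ ≤ D :=
    (stepLike_gaussPrim (γ := γ) (by linarith)).bounded (by linarith)
  set fh : ℝ → ℂ := fun x => ∫ k, F k * wave x (sdot ε k)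
  have hI1 : Integrable fun x => P x * fh x :=
    hF.integrable_mul_wave ε hP.contDiff.continuous.aestronglyMeasurable hB
  have hI2 : Integrable fun x => (gaussPrim x : ℂ) * fh x := hF.integrable_mul_wave ε
    (Complex.continuous_ofReal.comp continuous_gaussPrim).aestronglyMeasurable hD
  refine ⟨hI1, ?_⟩
  have hI0 : Integrable fh := hF.integrable_wave ε
  have h1 : ∫ x, fh x = 2 * Real.pi * fiberIntegral ε F 0 := hF.integral_integral_wave ε
  have h2 : ∫ x, (gaussPrim x : ℂ) * fh x = -(2 * Real.pi * vP) := by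
    have hpi : (2 * Real.pi : ℂ) ≠ 0 := by exact_mod_cast Real.two_pi_pos.ne'
    rw [hv, mul_neg, neg_neg, mul_inv_cancel_left₀ hpi]
  have h3 := (hF.hasAction_unitaryFT ε hgi).2
  rw [← h3]
  have e : ∀ x, stepRemainder P l m x * fh x = P x * fh x
      + (((-((l - m) / Real.sqrt (2 * Real.pi)) : ℝ) : ℂ) * ((gaussPrim x : ℂ) * fh x)
        + ((-((l + m) / 2) : ℝ) : ℂ) * fh x) := fun x => by
    rw [stepRemainder]; ring
  have h4 : ∫ x, stepRemainder P l m x * fh x = (∫ x, P x * fh x)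
      + (((-((l - m) / Real.sqrt (2 * Real.pi)) : ℝ) : ℂ) * (-(2 * Real.pi * vP))
        + ((-((l + m) / 2) : ℝ) : ℂ) * (2 * Real.pi * fiberIntegral ε F 0)) := by
    have hI3 : Integrable fun x =>
        ((-((l - m) / Real.sqrt (2 * Real.pi)) : ℝ) : ℂ) * ((gaussPrim x : ℂ) * fh x)
          + ((-((l + m) / 2) : ℝ) : ℂ) * fh x := (hI2.const_mul _).add (hI0.const_mul _)
    simp_rw [e]
    rw [integral_add hI1 hI3,
      integral_add (hI2.const_mul _) (hI0.const_mul _), integral_const_mul, integral_const_mul,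
      h1, h2]
  have hr : ((Real.sqrt (2 * Real.pi) : ℝ) : ℂ) ≠ 0 := by
    exact_mod_cast (Real.sqrt_pos.2 Real.two_pi_pos).ne'
  have hr2 : ((Real.sqrt (2 * Real.pi) : ℝ) : ℂ) ^ 2 = 2 * Real.pi := by
    rw [← Complex.ofReal_pow, Real.sq_sqrt Real.two_pi_pos.le]; push_cast; rfl
  change ∫ x, P x * fh x = _ + ∫ x, stepRemainder P l m x * fh x
  rw [h4, ← hr2]
  push_cast
  field_simp
  linear_combination ((fiberIntegral ε F 0) * (l + m)) * hr2

/-! ### The regular part -/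

section regular

variable {V Φ : ℝ → ℝ} {γ : ℝ}

/-- The limits of the profiles at `+∞`. -/
def limPlus : Fin 5 → ℝ := ![-1, 1, 1, 0, 0]

/-- The limits of the profiles at `-∞`. -/
def limMinus : Fin 5 → ℝ := ![1, 0, 0, 1, 1]

theorem stepLike_profile (hγ : 2 < γ) (hV : Integrable fun x => jb x ^ γ * V x)
    (hodd : OddZeroEnergyResonance V) (hΦ : IsBump Φ) (i : Fin 5) :
    StepLike γ (profile V Φ i) (limPlus i) (limMinus i) := by
  have hp := hΦ.stepLike_chiPlus (γ := γ) (by linarith)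
  have hm := hΦ.stepLike_chiMinus (γ := γ) (by linarith)
  fin_cases i
  · have h := (stepLike_psiPlus_zero hγ.le hV hodd).const_mul (-1)
    have e : profile V Φ 0 = fun x => ((-1 : ℝ) : ℂ) * psiPlus V x 0 := by
      funext x
      simp [profile, (trans_spec hγ hV hodd).1, psiPlus_zero_eq]
    rw [← e] at h
    simpa [limPlus, limMinus] using h
  · exact hp
  · exact hp
  · exact hm
  · exact hm

theorem stepLike_profileProd (hγ : 2 < γ) (hV : Integrable fun x => jb x ^ γ * V x)
    (hodd : OddZeroEnergyResonance V) (hΦ : IsBump Φ) (σ : Fin 4 → Fin 5) :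
    StepLike γ (profileProd V Φ σ) (∏ j, limPlus (σ j)) (∏ j, limMinus (σ j)) := by
  have h : ∀ j, StepLike γ (fun x => altConj j (profile V Φ (σ j) x)) (limPlus (σ j))
      (limMinus (σ j)) := fun j => by
    have hs := stepLike_profile hγ hV hodd hΦ (σ j)
    have hid : ∀ p, StepLike γ p (limPlus (σ j)) (limMinus (σ j)) →
        StepLike γ (fun x => altConj j (p x)) (limPlus (σ j)) (limMinus (σ j)) := fun p hp => by
      fin_cases j
      · exact hp.conj
      · exact hp
      · exact hp.conj
      · exact hp
    exact hid _ hs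
  have e : profileProd V Φ σ = fun x => ∏ j, altConj j (profile V Φ (σ j) x) :=
    funext fun x => altProd_eq_prod _
  rw [e]
  exact StepLike.prod_fin_four (by linarith) h

/-- As soon as one factor is not the resonance, a cut-off occurs, and the profile vanishes at one
end at least. The delta function and the principal value then have weights of equal modulus. -/
theorem prod_limPlus_mul_prod_limMinus {σ : Fin 4 → Fin 5} (hσ : σ ≠ 0) :
    (∏ j, limPlus (σ j)) * ∏ j, limMinus (σ j) = 0 := by
  obtain ⟨j, hj⟩ := Function.ne_iff.1 hσ
  rw [← Finset.prod_mul_distrib]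
  refine Finset.prod_eq_zero (Finset.mem_univ j) ?_
  have h : ∀ i : Fin 5, i ≠ 0 → limPlus i * limMinus i = 0 := by
    intro i hi
    fin_cases i
    · exact absurd rfl hi
    all_goals simp [limPlus, limMinus]
  exact h _ hj

theorem continuous_sharpKS (hγ : 2 < γ) (hV : Integrable fun x => jb x ^ γ * V x)
    (hodd : OddZeroEnergyResonance V) (hΦ : IsBump Φ) :
    Continuous (Function.uncurry (sharpKS V Φ)) := by
  have e : Function.uncurry (sharpKS V Φ) = fun p : ℝ × ℝ =>
      ∑ i, profile V Φ i p.1 * coeff V i p.2 * wave p.1 (((waveSign i : ℤ) : ℝ) * p.2) :=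
    funext fun p => sharpKS_eq_sum V Φ p.1 p.2
  rw [e]
  refine continuous_finsetSum _ fun i _ => ?_
  have h1 := (stepLike_profile hγ hV hodd hΦ i).contDiff.continuous
  have h2 := continuous_coeff hγ hV hodd i
  fun_prop

theorem exists_bound_sharpKS (hγ : 2 < γ) (hV : Integrable fun x => jb x ^ γ * V x)
    (hodd : OddZeroEnergyResonance V) (hΦ : IsBump Φ) :
    ∃ B, ∀ x k, ‖sharpKS V Φ x k‖ ≤ B := by
  choose B hB0 hB using fun i => (stepLike_profile hγ hV hodd hΦ i).bounded (by linarith)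
  refine ⟨∑ i, B i * 2, fun x k => ?_⟩
  rw [sharpKS_eq_sum]
  refine norm_sum_le_of_le _ fun i _ => ?_
  rw [norm_mul, norm_mul, norm_wave, mul_one]
  exact mul_le_mul (hB i x) (norm_coeff_le hγ hV hodd i k) (norm_nonneg _) (hB0 i)

theorem measurable_sharpKR (hγ : 2 < γ) (hV : Integrable fun x => jb x ^ γ * V x)
    (hodd : OddZeroEnergyResonance V) (hΦ : IsBump Φ) :
    Measurable (Function.uncurry (sharpKR V Φ)) := by
  have hV2 := integrable_moment_of_jb hγ.le hV
  have hT := (trans_spec hγ hV hodd).2.1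
  have hR := (reflMinus_spec hγ hV hodd).2.1
  have hP := (reflPlus_spec hγ hV hodd).2.1
  have hm : Continuous fun p : ℝ × ℝ => mPlus V p.1 p.2 := (mPlus_spec hV2).1
  have hm' : Continuous fun p : ℝ × ℝ => mPlus (mirror V) p.1 p.2 :=
    (mPlus_spec (integrable_moment_mirror hV2)).1
  have c1 : Continuous fun x => (chiPlus Φ x : ℂ) :=
    (hΦ.stepLike_chiPlus (γ := γ) (by linarith)).contDiff.continuous
  have c2 : Continuous fun x => (chiMinus Φ x : ℂ) :=
    (hΦ.stepLike_chiMinus (γ := γ) (by linarith)).contDiff.continuous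
  have comp : ∀ {f : ℝ → ℝ → ℂ}, Continuous (fun p : ℝ × ℝ => f p.1 p.2) →
      ∀ {a b : ℝ × ℝ → ℝ}, Continuous a → Continuous b → Continuous fun p => f (a p) (b p) :=
    fun hf _ _ ha hb => hf.comp (ha.prodMk hb)
  have q1 : Continuous fun p : ℝ × ℝ => mPlus V p.1 0 := comp hm (by fun_prop) (by fun_prop)
  have q2 : Continuous fun p : ℝ × ℝ => mPlus V p.1 (-p.2) :=
    comp hm (by fun_prop) (by fun_prop)
  have q3 : Continuous fun p : ℝ × ℝ => mPlus (mirror V) (-p.1) 0 :=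
    comp hm' (by fun_prop) (by fun_prop)
  have q4 : Continuous fun p : ℝ × ℝ => mPlus (mirror V) (-p.1) (-p.2) :=
    comp hm' (by fun_prop) (by fun_prop)
  have q5 : Continuous fun p : ℝ × ℝ => mPlus (mirror V) (-p.1) p.2 :=
    comp hm' (by fun_prop) (by fun_prop)
  have d1 : Continuous fun p : ℝ × ℝ => (chiPlus Φ p.1 : ℂ) := c1.comp continuous_fst
  have d2 : Continuous fun p : ℝ × ℝ => (chiMinus Φ p.1 : ℂ) := c2.comp continuous_fst
  unfold Function.uncurry sharpKR
  simp only [mMinus_eq_mirror hV2]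
  refine Measurable.ite (measurableSet_le measurable_const measurable_snd) ?_ ?_
  · exact Continuous.measurable (by fun_prop)
  · exact Continuous.measurable (by fun_prop)

theorem norm_cutoff_mul_wave_le {χ δ : ℝ} {c₀ c m₀ m w : ℂ} (hδ : 0 ≤ δ) (hχ : ‖(χ : ℂ)‖ ≤ 1)
    (hc₀ : ‖c₀‖ ≤ 2) (hc : ‖c‖ ≤ 1) (hw : ‖w‖ = 1)
    (h : χ = 0 ∨ (‖m₀ - 1‖ ≤ δ ∧ ‖m - 1‖ ≤ δ)) :
    ‖(χ : ℂ) * (c₀ * (m₀ - 1) + c * (m - m₀)) * w‖ ≤ 4 * δ := by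
  rcases h with h | ⟨ha, hb⟩
  · rw [h]; simp [hδ]
  · rw [norm_mul, norm_mul, hw, mul_one]
    have e : m - m₀ = (m - 1) - (m₀ - 1) := by ring
    calc _ ≤ 1 * (2 * δ + 1 * (δ + δ)) := by
          gcongr
          refine (norm_add_le _ _).trans ?_
          rw [norm_mul, norm_mul]
          gcongr
          rw [e]
          exact (norm_sub_le _ _).trans (add_le_add hb ha)
      _ = 4 * δ := by ring

theorem norm_cutoff_mul_two_waves_le {χ δ : ℝ} {c m₀ m n w w' : ℂ} (hδ : 0 ≤ δ)
    (hχ : ‖(χ : ℂ)‖ ≤ 1) (hc : ‖c‖ ≤ 1) (hw : ‖w‖ = 1) (hw' : ‖w'‖ = 1)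
    (h : χ = 0 ∨ (‖m₀ - 1‖ ≤ δ ∧ ‖m - 1‖ ≤ δ ∧ ‖n - 1‖ ≤ δ)) :
    ‖(χ : ℂ) * ((m - m₀) * w + c * (n - 1) * w')‖ ≤ 4 * δ := by
  rcases h with h | ⟨ha, hb, hn⟩
  · rw [h]; simp [hδ]
  · rw [norm_mul]
    have e : m - m₀ = (m - 1) - (m₀ - 1) := by ring
    calc _ ≤ 1 * ((δ + δ) + 1 * δ) := by
          gcongr
          refine (norm_add_le _ _).trans ?_
          rw [norm_mul, norm_mul, norm_mul, hw, hw', mul_one, mul_one]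
          gcongr
          rw [e]
          exact (norm_sub_le _ _).trans (add_le_add hb ha)
      _ ≤ 4 * δ := by linarith

/-- The cut-offs restrict each `m_±(x, k) - 1` to the side where it decays, uniformly in `k`. -/
theorem exists_decay_sharpKR (hγ : 2 < γ) (hV : Integrable fun x => jb x ^ γ * V x)
    (hodd : OddZeroEnergyResonance V) (hΦ : IsBump Φ) :
    ∃ C, 0 ≤ C ∧ ∀ x k, ‖sharpKR V Φ x k‖ ≤ C * jb x ^ (-γ + 1) := by
  have hV2 := integrable_moment_of_jb hγ.le hV
  obtain ⟨C₁, hC₁, h₁⟩ := exists_decay_mPlus hγ.le hV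
  obtain ⟨C₂, hC₂, h₂⟩ := exists_decay_mPlus hγ.le (integrable_jb_mirror hV)
  obtain ⟨-, -, hT, -⟩ := trans_spec hγ hV hodd
  obtain ⟨-, -, hR, -⟩ := reflMinus_spec hγ hV hodd
  obtain ⟨-, -, hP⟩ := reflPlus_spec hγ hV hodd
  set C := max C₁ C₂
  have hC : 0 ≤ C := hC₁.trans (le_max_left _ _)
  have hTT : ∀ k, ‖trans V k - trans V 0‖ ≤ 2 := fun k =>
    (norm_sub_le _ _).trans (by linarith [hT k, hT 0])
  -- either the cut-off vanishes, or the difference is small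
  have hp : ∀ x, chiPlus Φ x = 0 ∨ ∀ k, ‖mPlus V x k - 1‖ ≤ C * jb x ^ (-γ + 1) := by
    intro x
    rcases le_total x (-2) with h | h
    · exact Or.inl (hΦ.chiPlus_eq_zero h)
    · exact Or.inr fun k => (h₁ x k h).1.trans
        (mul_le_mul_of_nonneg_right (le_max_left _ _) (jb_rpow_pos _ _).le)
  have hm : ∀ x, chiMinus Φ x = 0 ∨ ∀ k, ‖mMinus V x k - 1‖ ≤ C * jb x ^ (-γ + 1) := by
    intro x
    rcases le_total 2 x with h | h
    · left; simp [chiMinus, hΦ.chiPlus_eq_one h]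
    · refine Or.inr fun k => ?_
      rw [mMinus_eq_mirror hV2, ← jb_neg]
      exact (h₂ (-x) k (by linarith)).1.trans
        (mul_le_mul_of_nonneg_right (le_max_right _ _) (jb_rpow_pos _ _).le)
  have hχp : ∀ x, ‖(chiPlus Φ x : ℂ)‖ ≤ 1 := fun x => by
    rw [Complex.norm_real, Real.norm_eq_abs, abs_le]
    constructor <;> linarith [hΦ.chiPlus_mem x]
  have hχm : ∀ x, ‖(chiMinus Φ x : ℂ)‖ ≤ 1 := fun x => by
    rw [Complex.norm_real, Real.norm_eq_abs, abs_le, chiMinus]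
    constructor <;> linarith [hΦ.chiPlus_mem x]
  refine ⟨8 * C, by positivity, fun x k => ?_⟩
  have hδ : 0 ≤ C * jb x ^ (-γ + 1) := mul_nonneg hC (jb_rpow_pos _ _).le
  have hp' := hp x
  have hm' := hm x
  rw [mul_assoc]
  generalize C * jb x ^ (-γ + 1) = δ at hδ hp' hm' ⊢
  rw [sharpKR]
  split_ifs with hk
  · have b₁ := norm_cutoff_mul_wave_le hδ (hχp x) (hTT k) (hT k) (norm_wave x k)
      (hp'.imp_right fun h => ⟨h 0, h k⟩)
    have b₂ := norm_cutoff_mul_two_waves_le hδ (hχm x) (hR k) (norm_wave x k) (norm_wave x (-k))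
      (hm'.imp_right fun h => ⟨h 0, h (-k), h k⟩)
    exact (norm_add_le _ _).trans (by linarith)
  · have b₁ := norm_cutoff_mul_wave_le hδ (hχm x) (hTT (-k)) (hT (-k)) (norm_wave x k)
      (hm'.imp_right fun h => ⟨h 0, h (-k)⟩)
    have b₂ := norm_cutoff_mul_two_waves_le hδ (hχp x) (hP (-k)) (norm_wave x k)
      (norm_wave x (-k)) (hp'.imp_right fun h => ⟨h 0, h k, h (-k)⟩)
    refine (norm_sub_le _ _).trans ?_
    rw [norm_neg]
    linarith

theorem measurable_sharpKA (hγ : 2 < γ) (hV : Integrable fun x => jb x ^ γ * V x)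
    (hodd : OddZeroEnergyResonance V) (hΦ : IsBump Φ) (b : Bool) :
    Measurable (Function.uncurry (sharpKA V Φ b)) := by
  cases b
  · exact (continuous_sharpKS hγ hV hodd hΦ).measurable
  · exact measurable_sharpKR hγ hV hodd hΦ

theorem measurable_altProd_sharpKA (hγ : 2 < γ) (hV : Integrable fun x => jb x ^ γ * V x)
    (hodd : OddZeroEnergyResonance V) (hΦ : IsBump Φ) (A : Fin 4 → Bool) :
    Measurable fun p : ℝ × (Fin 4 → ℝ) => altProd fun j => sharpKA V Φ (A j) p.1 (p.2 j) := by
  refine continuous_altProd.measurable.comp (measurable_pi_lambda _ fun j => ?_)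
  have h : Measurable fun p : ℝ × (Fin 4 → ℝ) => (p.1, p.2 j) :=
    measurable_fst.prodMk ((measurable_pi_apply j).comp measurable_snd)
  have h' := (measurable_sharpKA hγ hV hodd hΦ (A j)).comp h
  simpa only [Function.comp_def, Function.uncurry_apply_pair] using h'

theorem exists_bound_altProd_sharpKA (hγ : 2 < γ) (hV : Integrable fun x => jb x ^ γ * V x)
    (hodd : OddZeroEnergyResonance V) (hΦ : IsBump Φ) :
    ∃ C, 0 ≤ C ∧ (∀ (A : Fin 4 → Bool) (x : ℝ) (k : Fin 4 → ℝ),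
        ‖altProd fun j => sharpKA V Φ (A j) x (k j)‖ ≤ C) ∧
      ∀ A ∈ indexR, ∀ (x : ℝ) (k : Fin 4 → ℝ),
        ‖altProd fun j => sharpKA V Φ (A j) x (k j)‖ ≤ C * jb x ^ (-γ + 1) := by
  obtain ⟨B, hB⟩ := exists_bound_sharpKS hγ hV hodd hΦ
  obtain ⟨C, hC, hKR⟩ := exists_decay_sharpKR hγ hV hodd hΦ
  set D := max B C
  have hD : 0 ≤ D := hC.trans (le_max_right _ _)
  have hj := fun x => jb_rpow_le_one (γ := γ) (by linarith) x
  have hall : ∀ b x k, ‖sharpKA V Φ b x k‖ ≤ D := by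
    intro b x k
    cases b
    · exact (hB x k).trans (le_max_left _ _)
    · exact (hKR x k).trans ((mul_le_of_le_one_right hC (hj x)).trans (le_max_right _ _))
  refine ⟨D ^ 4, by positivity, fun A x k => ?_, fun A hA x k => ?_⟩
  · rw [norm_altProd]
    calc _ ≤ ∏ _j : Fin 4, D :=
          Finset.prod_le_prod (fun _ _ => norm_nonneg _) fun _ _ => hall _ _ _
      _ = D ^ 4 := by simp
  -- one factor of type `R` provides the decay, the other three are bounded
  · obtain ⟨i, hi⟩ : ∃ i, A i = true := by
      by_contra h
      push Not at h
      exact (Finset.mem_erase.1 hA).1 (funext fun j => Bool.eq_false_iff.2 (h j))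
    have hjp := jb_rpow_pos x (-γ + 1)
    rw [norm_altProd, ← Finset.mul_prod_erase _ _ (Finset.mem_univ i)]
    calc _ ≤ (D * jb x ^ (-γ + 1)) * ∏ _j ∈ Finset.univ.erase i, D := by
          refine mul_le_mul ?_ (Finset.prod_le_prod (fun _ _ => norm_nonneg _)
            fun _ _ => hall _ _ _) (Finset.prod_nonneg fun _ _ => norm_nonneg _) (by positivity)
          rw [hi]
          exact (hKR x _).trans (mul_le_mul_of_nonneg_right (le_max_right _ _) hjp.le)
      _ = D ^ 4 * jb x ^ (-γ + 1) := by
          rw [Finset.prod_const, Finset.card_erase_of_mem (Finset.mem_univ i)]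
          simp; ring

theorem integrable_altProd_sharpKA (hγ : 5 / 2 < γ) (hV : Integrable fun x => jb x ^ γ * V x)
    (hodd : OddZeroEnergyResonance V) (hΦ : IsBump Φ) {A : Fin 4 → Bool} (hA : A ∈ indexR)
    (k : Fin 4 → ℝ) : Integrable fun x => altProd fun j => sharpKA V Φ (A j) x (k j) := by
  obtain ⟨C, -, -, hC⟩ := exists_bound_altProd_sharpKA (by linarith) hV hodd hΦ
  exact ((integrable_jb_rpow (r := -γ + 1) (by linarith)).const_mul C).mono'
    ((measurable_altProd_sharpKA (by linarith) hV hodd hΦ A).comp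
      measurable_prodMk_right).aestronglyMeasurable (.of_forall fun x => hC A hA x k)

theorem integrable_altProd_sharpKA_mul (hγ : 5 / 2 < γ)
    (hV : Integrable fun x => jb x ^ γ * V x) (hodd : OddZeroEnergyResonance V) (hΦ : IsBump Φ)
    {A : Fin 4 → Bool} (hA : A ∈ indexR) (G : 𝓢(Fin 4 → ℝ, ℂ)) :
    Integrable (Function.uncurry fun (x : ℝ) (k : Fin 4 → ℝ) =>
      (altProd fun j => sharpKA V Φ (A j) x (k j)) * G k) (volume.prod volume) := by
  obtain ⟨C, -, -, hC⟩ := exists_bound_altProd_sharpKA (by linarith) hV hodd hΦ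
  refine (((integrable_jb_rpow (r := -γ + 1) (by linarith)).const_mul C).mul_prod
    G.integrable.norm).mono' ?_ (.of_forall fun p => ?_)
  · exact ((measurable_altProd_sharpKA (by linarith) hV hodd hΦ A).mul
      (G.continuous.measurable.comp measurable_snd)).aestronglyMeasurable
  · rw [Function.uncurry, norm_mul]
    exact mul_le_mul_of_nonneg_right (hC A hA _ _) (norm_nonneg _)

theorem integrable_altProd_sharpKA_mul_right (hγ : 2 < γ)
    (hV : Integrable fun x => jb x ^ γ * V x) (hodd : OddZeroEnergyResonance V) (hΦ : IsBump Φ)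
    (A : Fin 4 → Bool) (G : 𝓢(Fin 4 → ℝ, ℂ)) (x : ℝ) :
    Integrable fun k : Fin 4 → ℝ => (altProd fun j => sharpKA V Φ (A j) x (k j)) * G k := by
  obtain ⟨C, -, hC, -⟩ := exists_bound_altProd_sharpKA hγ hV hodd hΦ
  exact G.integrable.bdd_mul (c := C) ((measurable_altProd_sharpKA hγ hV hodd hΦ A).comp
    measurable_prodMk_left).aestronglyMeasurable (.of_forall fun k => hC A x k)

/-- The action of `μ♯_{R,1}`. -/
theorem hasAction_muR1 (hγ : 5 / 2 < γ) (hV : Integrable fun x => jb x ^ γ * V x)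
    (hodd : OddZeroEnergyResonance V) (hΦ : IsBump Φ) (G : 𝓢(Fin 4 → ℝ, ℂ)) :
    HasAction (muR1 V Φ) G (∑ A ∈ indexR, ∫ x, ∫ k : Fin 4 → ℝ,
      (altProd fun j => sharpKA V Φ (A j) x (k j)) * G k) := by
  have e : ∀ k, muR1 V Φ k * G k = ∑ A ∈ indexR, ∫ x : ℝ,
      (altProd fun j => sharpKA V Φ (A j) x (k j)) * G k := fun k => by
    rw [muR1, Finset.sum_mul]
    exact Finset.sum_congr rfl fun A _ => (integral_mul_const _ _).symm
  have hi : ∀ A ∈ indexR, Integrable fun k : Fin 4 → ℝ => ∫ x : ℝ,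
      (altProd fun j => sharpKA V Φ (A j) x (k j)) * G k := fun A hA =>
    (integrable_altProd_sharpKA_mul hγ hV hodd hΦ hA G).integral_prod_right
  refine ⟨?_, ?_⟩
  · simp only [e]
    exact integrable_finsetSum _ hi
  · simp only [e]
    rw [integral_finsetSum _ hi]
    exact Finset.sum_congr rfl fun A hA =>
      (integral_integral_swap (integrable_altProd_sharpKA_mul hγ hV hodd hΦ hA G)).symm

end regular

/-! ### Assembling the decomposition -/

section decomposition

variable {V Φ : ℝ → ℝ} {γ : ℝ}

/-- The term of index `σ` of the expansion of `∏ 𝒦♯_S` at the point `x`, tested against `G`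
in `k`. -/
def singularTerm (V Φ : ℝ → ℝ) (G : 𝓢(Fin 4 → ℝ, ℂ)) (σ : Fin 4 → Fin 5) (x : ℝ) : ℂ :=
  profileProd V Φ σ x * ∫ k, (coeffProd V σ k * G k) * wave x (sdot (waveVec σ) k)

theorem continuous_wave_sdot (x : ℝ) (ε : Fin 4 → ℤˣ) :
    Continuous fun k => wave x (sdot ε k) := by
  unfold sdot
  fun_prop

theorem integral_altProd_sharpKS_mul (hγ : 2 < γ) (hV : Integrable fun x => jb x ^ γ * V x)
    (hodd : OddZeroEnergyResonance V) (G : 𝓢(Fin 4 → ℝ, ℂ)) (x : ℝ) :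
    ∫ k : Fin 4 → ℝ, (altProd fun j => sharpKS V Φ x (k j)) * G k
      = ∑ σ, singularTerm V Φ G σ x := by
  have e : ∀ k : Fin 4 → ℝ, (altProd fun j => sharpKS V Φ x (k j)) * G k
      = ∑ σ, profileProd V Φ σ x
        * ((coeffProd V σ k * G k) * wave x (sdot (waveVec σ) k)) := fun k => by
    rw [altProd_sharpKS, Finset.sum_mul]
    exact Finset.sum_congr rfl fun σ _ => by ring
  simp only [e]
  rw [integral_finsetSum _ fun σ _ =>
    ((amplitude_coeffProd_mul hγ hV hodd σ G).integrable.mul_bdd (c := 1)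
      ((continuous_wave_sdot x _).aestronglyMeasurable)
      (.of_forall fun k => (norm_wave _ _).le)).const_mul _]
  exact Finset.sum_congr rfl fun σ _ => integral_const_mul _ _

theorem hasMuSharp (hγ : 5 / 2 < γ) (hV : Integrable fun x => jb x ^ γ * V x)
    (hodd : OddZeroEnergyResonance V) (hΦ : IsBump Φ) (G : 𝓢(Fin 4 → ℝ, ℂ))
    (hs : ∀ σ, Integrable (singularTerm V Φ G σ)) :
    HasMuSharp V G ((((2 * Real.pi : ℝ) : ℂ) ^ 2)⁻¹ * (∑ σ, (∫ x, singularTerm V Φ G σ x)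
      + ∑ A ∈ indexR, ∫ x, ∫ k : Fin 4 → ℝ,
        (altProd fun j => sharpKA V Φ (A j) x (k j)) * G k)) := by
  have hγ' : 2 < γ := by linarith
  have hpi : ((2 * Real.pi : ℝ) : ℂ) ^ 2 ≠ 0 :=
    pow_ne_zero _ (Complex.ofReal_ne_zero.2 Real.two_pi_pos.ne')
  have e : ∀ (x : ℝ) (k : Fin 4 → ℝ), (altProd fun j => sharpK V x (k j)) * G k
      = (((2 * Real.pi : ℝ) : ℂ) ^ 2)⁻¹ * ((altProd fun j => sharpKS V Φ x (k j)) * G k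
        + ∑ A ∈ indexR, (altProd fun j => sharpKA V Φ (A j) x (k j)) * G k) := fun x k => by
    rw [← Finset.sum_mul, ← add_mul, ← two_pi_sq_mul_altProd_sharpK hγ' hV hodd, mul_assoc,
      inv_mul_cancel_left₀ hpi]
  have hS : ∀ x, Integrable fun k : Fin 4 → ℝ => (altProd fun j => sharpKS V Φ x (k j)) * G k :=
    integrable_altProd_sharpKA_mul_right hγ' hV hodd hΦ (fun _ => false) G
  have hA : ∀ x, ∀ A ∈ indexR, Integrable fun k : Fin 4 → ℝ =>
      (altProd fun j => sharpKA V Φ (A j) x (k j)) * G k := fun x A _ =>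
    integrable_altProd_sharpKA_mul_right hγ' hV hodd hΦ A G x
  have hx : ∀ x, ∫ k : Fin 4 → ℝ, (altProd fun j => sharpK V x (k j)) * G k
      = (((2 * Real.pi : ℝ) : ℂ) ^ 2)⁻¹ * (∑ σ, singularTerm V Φ G σ x
        + ∑ A ∈ indexR, ∫ k : Fin 4 → ℝ,
          (altProd fun j => sharpKA V Φ (A j) x (k j)) * G k) := fun x => by
    simp only [e]
    rw [integral_const_mul, integral_add (hS x) (integrable_finsetSum _ (hA x)),
      integral_finsetSum _ (hA x), integral_altProd_sharpKS_mul hγ' hV hodd]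
  have hR : ∀ A ∈ indexR, Integrable fun x => ∫ k : Fin 4 → ℝ,
      (altProd fun j => sharpKA V Φ (A j) x (k j)) * G k := fun A hA' =>
    (integrable_altProd_sharpKA_mul hγ hV hodd hΦ hA' G).integral_prod_left
  have hs' := integrable_finsetSum Finset.univ fun σ _ => hs σ
  have hR' := integrable_finsetSum _ hR
  refine ⟨fun x => ?_, ?_, ?_⟩
  · simp only [e]
    exact ((hS x).add (integrable_finsetSum _ (hA x))).const_mul _
  · simp only [hx]
    exact (hs'.add hR').const_mul _
  · simp only [hx]
    rw [integral_const_mul, integral_add hs' hR', integral_finsetSum _ fun σ _ => hs σ,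
      integral_finsetSum _ hR]

theorem waveVec_zero : waveVec 0 = ![-1, 1, -1, 1] := by
  funext j
  fin_cases j <;> rfl

/-- The two sign vectors are opposite and define the same hyperplane. -/
theorem hyperPoint_waveVec_zero (q : Fin 3 → ℝ) :
    hyperPoint (waveVec 0) q = hyperPoint ![1, -1, 1, -1] q := by
  rw [waveVec_zero]
  funext j
  fin_cases j <;> simp [hyperPoint]
  ring

theorem coeffProd_zero (V : ℝ → ℝ) (k : Fin 4 → ℝ) : coeffProd V 0 k = 1 := by
  simp [coeffProd, coeff, altProd]

/-- The coefficient of `σ` in `μ♯_L`, for `σ ≠ 0`. -/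
def singularWeight (σ : Fin 4 → Fin 5) : ℝ :=
  Real.sqrt (2 * Real.pi) * (∏ j, limPlus (σ j) + ∏ j, limMinus (σ j))

open Classical in
/-- The sign of the principal value belonging to `σ` in `μ♯_L`: negative if the profile tends to
zero at `-∞`. -/
def singularSign (σ : Fin 4 → Fin 5) : ℤˣ := if ∏ j, limMinus (σ j) = 0 then -1 else 1

theorem singularWeight_mul_sqrt (σ : Fin 4 → Fin 5) :
    singularWeight σ * Real.sqrt (Real.pi / 2)
      = Real.pi * (∏ j, limPlus (σ j) + ∏ j, limMinus (σ j)) := by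
  have h : Real.sqrt (Real.pi / 2) * Real.sqrt (Real.pi / 2) = Real.pi / 2 :=
    Real.mul_self_sqrt (by positivity)
  rw [singularWeight, sqrt_two_pi_eq]
  linear_combination (2 * (∏ j, limPlus (σ j) + ∏ j, limMinus (σ j))) * h

theorem singularWeight_mul_singularSign {σ : Fin 4 → Fin 5} (hσ : σ ≠ 0) :
    singularWeight σ * ((singularSign σ : ℤ) : ℝ)
      = -(Real.sqrt (2 * Real.pi) * (∏ j, limPlus (σ j) - ∏ j, limMinus (σ j))) := by
  rw [singularWeight, singularSign]
  split_ifs with h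
  · rw [h]; simp
  · rw [(mul_eq_zero.1 (prod_limPlus_mul_prod_limMinus hσ)).resolve_right h]; simp

end decomposition

end OddResonance

end

open OddResonance in
theorem theorem4p1 (V : ℝ → ℝ) (γ : ℝ) (hγ : 5 / 2 < γ)
    (hV : MeasureTheory.Integrable (fun x : ℝ => OddResonance.jb x ^ γ * V x))
    (hgen : OddResonance.NonGeneric V)
    (hodd : OddResonance.OddZeroEnergyResonance V)
    (Φ : ℝ → ℝ) (hΦ : OddResonance.IsBump Φ) :
    -- the integrals defining `μ♯_{R,1}` converge
    (∀ A ∈ OddResonance.indexR, ∀ k : Fin 4 → ℝ, MeasureTheory.Integrable (fun x : ℝ =>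
      OddResonance.altProd (fun j => OddResonance.sharpKA V Φ (A j) x (k j)))) ∧
    -- the terms of `μ♯_L`: real weights, coefficients, signs, the sign of the p.v., `φ`
    ∃ (N : ℕ) (c : Fin N → ℝ) (a : Fin N → (Fin 4 → ℝ) → ℂ) (ε : Fin N → Fin 4 → ℤˣ)
      (s : Fin N → ℤˣ) (φ : Fin N → 𝓢(ℝ, ℂ))
      -- the terms of `μ♯_{R,2}`: weights, coefficients, signs, `g` with `ĝ = ϕ`
      (M : ℕ) (d : Fin M → ℂ) (b : Fin M → (Fin 4 → ℝ) → ℂ) (ε' : Fin M → Fin 4 → ℤˣ)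
      (g : Fin M → ℝ → ℂ),
      (∀ i, a i ∈ OddResonance.coeffCL V ∧
        (∃ j, ∀ k : Fin 4 → ℝ, k j = 0 → a i k = 0) ∧
        (∀ ξ, φ i (-ξ) = φ i ξ) ∧ (∫ ξ, φ i ξ) = 1 ∧
        φ i 0 = ((Real.sqrt (2 * Real.pi) : ℝ) : ℂ)⁻¹) ∧
      (∀ i, b i ∈ OddResonance.coeffC V ∧ OddResonance.DecaysC1 γ (g i)) ∧
      ∀ G : 𝓢(Fin 4 → ℝ, ℂ),
        ∃ (vμ vδ vR1 : ℂ) (vL vP : Fin N → ℂ) (vR2 : Fin M → ℂ),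
          OddResonance.HasMuSharp V G vμ ∧
          OddResonance.HasDelta ![1, -1, 1, -1] G vδ ∧
          (∀ i, OddResonance.HasDelta (ε i) (fun k => a i k * G k) (vL i)) ∧
          (∀ i, OddResonance.HasPV (ε i) (φ i) (fun k => a i k * G k) (vP i)) ∧
          OddResonance.HasAction (OddResonance.muR1 V Φ) G vR1 ∧
          (∀ i, OddResonance.HasAction
            (fun k => b i k * OddResonance.unitaryFT (g i) (OddResonance.sdot (ε' i) k))
            G (vR2 i)) ∧
          ((2 * Real.pi : ℝ) : ℂ) ^ 2 * vμ =
            ((2 * Real.pi : ℝ) : ℂ) * vδ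
            + (∑ i, (c i : ℂ) *
                (((Real.sqrt (Real.pi / 2) : ℝ) : ℂ) * vL i + ((s i : ℤ) : ℂ) * vP i))
            + (vR1 + ∑ i, d i * vR2 i) := by
  have hγ' : 2 < γ := by linarith
  refine ⟨fun A hA k => integrable_altProd_sharpKA hγ hV hodd hΦ hA k, ?_⟩
  let σL := (Fintype.equivFin {σ : Fin 4 → Fin 5 // σ ≠ 0}).symm
  let σR := (Fintype.equivFin (Fin 4 → Fin 5)).symm
  let g : (Fin 4 → Fin 5) → ℝ → ℂ := fun σ =>
    stepRemainder (profileProd V Φ σ) (∏ j, limPlus (σ j)) (∏ j, limMinus (σ j))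
  refine ⟨_, fun i => singularWeight (σL i).1, fun i => coeffProd V (σL i).1,
    fun i => waveVec (σL i).1, fun i => singularSign (σL i).1, fun _ => gaussSchwartz,
    _, fun _ => Real.sqrt (2 * Real.pi), fun i => coeffProd V (σR i), fun i => -waveVec (σR i),
    fun i => g (σR i), fun i => ?_, fun i => ?_, fun G => ?_⟩
  · obtain ⟨j, hj⟩ := Function.ne_iff.1 (σL i).2
    refine ⟨coeffProd_mem_coeffCL hγ' hV hodd (σL i).2,
      ⟨j, fun k hk => coeffProd_eq_zero hγ' hV hodd hj hk⟩, fun ξ => ?_, ?_, ?_⟩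
    · rw [gaussSchwartz_apply, gaussSchwartz_apply, gauss_neg]
    · simp only [gaussSchwartz_apply]
      rw [integral_complex_ofReal, integral_gauss, Complex.ofReal_one]
    · rw [gaussSchwartz_apply, gauss_zero, Complex.ofReal_inv]
  · exact ⟨coeffProd_mem_coeffC V _, decaysC1_stepRemainder (by linarith)
      (stepLike_profileProd hγ' hV hodd hΦ _)⟩
  have hF := fun σ => amplitude_coeffProd_mul hγ' hV hodd σ G
  let F : (Fin 4 → Fin 5) → (Fin 4 → ℝ) → ℂ := fun σ k => coeffProd V σ k * G k
  let vP : (Fin 4 → Fin 5) → ℂ := fun σ => -((2 * Real.pi : ℂ)⁻¹ *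
    ∫ x, (gaussPrim x : ℂ) * ∫ k, F σ k * wave x (sdot (waveVec σ) k))
  let vL : (Fin 4 → Fin 5) → ℂ := fun σ => fiberIntegral (waveVec σ) (F σ) 0
  let vR2 : (Fin 4 → Fin 5) → ℂ := fun σ => ∫ k, unitaryFT (g σ) (sdot (-waveVec σ) k) * F σ k
  have hs := fun σ => integral_stepLike_mul hγ (stepLike_profileProd hγ' hV hodd hΦ σ) (hF σ)
    (waveVec σ) (vP := vP σ) rfl
  refine ⟨_, vL 0, _, fun i => vL (σL i).1, fun i => vP (σL i).1, fun i => vR2 (σR i),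
    hasMuSharp hγ hV hodd hΦ G fun σ => (hs σ).1, ?_,
    fun i => (hF _).hasDelta _, fun i => (hF _).hasPV _,
    hasAction_muR1 hγ hV hodd hΦ G, fun i => ?_, ?_⟩
  -- the coefficient of `σ = 0` is `1`, which leaves the test function itself
  · have h := (hF 0).hasDelta (waveVec 0)
    simp only [HasDelta, coeffProd_zero, one_mul, hyperPoint_waveVec_zero] at h
    refine ⟨h.1, ?_⟩
    simp only [vL, F, coeffProd_zero, one_mul]
    exact h.2
  · have h := ((hF (σR i)).hasAction_unitaryFT (waveVec (σR i))
      ((decaysC1_stepRemainder (by linarith)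
        (stepLike_profileProd hγ' hV hodd hΦ (σR i))).integrable hγ)).1
    have e : (fun k => coeffProd V (σR i) k * unitaryFT (g (σR i)) (sdot (-waveVec (σR i)) k)
        * G k) = fun k => unitaryFT (g (σR i)) (sdot (-waveVec (σR i)) k) * F (σR i) k :=
      funext fun k => by simp only [F]; ring
    rw [HasAction, e]
    exact ⟨h, rfl⟩
  · have hpi : ((2 * Real.pi : ℝ) : ℂ) ^ 2 ≠ 0 :=
      pow_ne_zero _ (Complex.ofReal_ne_zero.2 Real.two_pi_pos.ne')
    have hσ : ∀ σ, ∫ x, singularTerm V Φ G σ x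
        = Real.pi * (((∏ j, limPlus (σ j) : ℝ) : ℂ) + ((∏ j, limMinus (σ j) : ℝ) : ℂ)) * vL σ
          - Real.sqrt (2 * Real.pi)
            * (((∏ j, limPlus (σ j) : ℝ) : ℂ) - ((∏ j, limMinus (σ j) : ℝ) : ℂ)) * vP σ
          + Real.sqrt (2 * Real.pi) * vR2 σ := fun σ => (hs σ).2
    -- the profile of `σ = 0` is the product of four resonances, with the limit `1` at both ends,
    -- hence without principal value
    have h0 : ∫ x, singularTerm V Φ G 0 x
        = ((2 * Real.pi : ℝ) : ℂ) * vL 0 + Real.sqrt (2 * Real.pi) * vR2 0 := by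
      rw [hσ]
      simp [limPlus, limMinus]
      ring
    have h1 : ∀ σ : {σ : Fin 4 → Fin 5 // σ ≠ 0}, ∫ x, singularTerm V Φ G σ.1 x
        = (singularWeight σ.1 : ℂ) * (((Real.sqrt (Real.pi / 2) : ℝ) : ℂ) * vL σ.1
          + ((singularSign σ.1 : ℤ) : ℂ) * vP σ.1) + Real.sqrt (2 * Real.pi) * vR2 σ.1 := by
      intro σ
      have e₁ := congrArg Complex.ofReal (singularWeight_mul_sqrt σ.1)
      have e₂ := congrArg Complex.ofReal (singularWeight_mul_singularSign σ.2)
      simp only [Complex.ofReal_mul, Complex.ofReal_add, Complex.ofReal_sub, Complex.ofReal_neg,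
        Complex.ofReal_intCast] at e₁ e₂
      rw [hσ]
      linear_combination -(vL σ.1) * e₁ - vP σ.1 * e₂
    have hL := Equiv.sum_comp σL fun σ => (singularWeight σ.1 : ℂ)
      * (((Real.sqrt (Real.pi / 2) : ℝ) : ℂ) * vL σ.1 + ((singularSign σ.1 : ℤ) : ℂ) * vP σ.1)
    have hR := Equiv.sum_comp σR fun σ => ((Real.sqrt (2 * Real.pi) : ℝ) : ℂ) * vR2 σ
    rw [hL, hR, mul_inv_cancel_left₀ hpi, Fintype.sum_eq_add_sum_subtype_ne _ 0,
      Fintype.sum_eq_add_sum_subtype_ne (fun σ => ((Real.sqrt (2 * Real.pi) : ℝ) : ℂ) * vR2 σ) 0,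
      h0]
    simp only [h1, Finset.sum_add_distrib]
    ring
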